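/- Let $R$ be a commutative ring with unit, let $r_1,\dots,r_n\in R$ be a regular sequence (each $r_i$ is a non-zero-divisor on $R/(r_1,\dots,r_{i-1})$, and $R/(r_1,\dots,r_n)\neq 0$), and let $I=(r_1,\dots,r_n)$. Write $B_I^*(R)=\bigoplus_{s\ge 0}I^s$ with $I^0=R$, and let $$A=\operatorname{Tor}^R_*(R/I,B_I^*(R))=\bigoplus_{s,k\ge 0}\operatorname{Tor}^R_k(R/I,I^s)$$ carry the exterior product $\operatorname{Tor}_k(R/I,I^s)\otimes\operatorname{Tor}_l(R/I,I^t)\to\operatorname{Tor}_{k+l}(R/I,I^{s+t})$ induced by the multiplications $R/I\otimes R/I\to R/I$ and $I^s\otimes I^t\to I^{s+t}$. Let $p_*\colon\operatorname{Tor}_k(R/I,I)\to\operatorname{Tor}_k(R/I,I/I^2)$ be induced by the projection, let $\partial\colon\operatorname{Tor}_{k+1}(R/I,R/I)\to\operatorname{Tor}_k(R/I,I/I^2)$ be the connecting homomorphism of $0\to I/I^2\to R/I^2\to R/I\to 0$, and for $1\le i_0<\dots<i_k\le n$ regard $e_{i_0}\wedge\dots\wedge e_{i_k}$ as the element of $\operatorname{Tor}_{k+1}(R/I,R/I)$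 represented by the corresponding basis element of the Koszul complex of $r_1,\dots,r_n$. Then the following hold. 1. $A$ is an associative, unital, bigraded $R/I$-algebra, with unit $1\otimes 1\in R/I\otimes_R R=\operatorname{Tor}_0(R/I,I^0)$. 2. There is an injective homomorphism of $R/I$-algebras $R/I[x_1,\dots,x_n]\to A$ which sends $x_i$ to the class of $1\otimes r_i$ in $R/I\otimes_R I=\operatorname{Tor}_0(R/I,I)$, and whose image is $\bigoplus_s\operatorname{Tor}_0(R/I,I^s)$. In this way $A$ is an algebra over $R/I[x_1,\dots,x_n]$ (which need not be central in $A$). 3. The map $p_*$ is injective for every $k\geq 0$, and for all $1\le i_0<\dots<i_k\le n$ there is a (unique) element $a_{(i_0,\dots,i_k)}\in\operatorname{Tor}_k(R/I,I)$ with $p_*(a_{(i_0,\dots,i_k)})=\partial(e_{i_0}\wedge\dots\wedge e_{i_k})$. For every $0<k<n$ the elements $a_{(i_0,\dots,i_k)}$, $1\le i_0<\dots<i_k\le n$, form a basis of the $R/I$-module $\operatorname{Tor}_k(R/I,I)$. 4. As an algebra over $R/I[x_1,\dots,x_n]$, $A$ is generated by the elements $a_{(i_0,\dots,i_k)}$ with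 $0<k<n$ and $1\le i_0<\dots<i_k\le n$: the only subring of $A$ that contains the image of $R/I[x_1,\dots,x_n]$ and all these elements is $A$ itself. -/

import Mathlib

namespace TorBlowup

universe u

noncomputable section

open CategoryTheory MonoidalCategory

variable {R : Type u} [CommRing R]

/-! ### Lifting to projective resolutions -/

/-- The augmentation of a projective resolution. -/
def aug {Y : ModuleCat.{u} R} (Q : ProjectiveResolution Y) : Q.complex.X 0 ⟶ Y := Q.π.f 0

instance {Y : ModuleCat.{u} R} (Q : ProjectiveResolution Y) : Epi (aug Q) :=
  inferInstanceAs (Epi (Q.π.f 0))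

theorem d_aug {Y : ModuleCat.{u} R} (Q : ProjectiveResolution Y) :
    Q.complex.d 1 0 ≫ aug Q = 0 := Q.complex_d_comp_π_f_zero

theorem exact_aug {Y : ModuleCat.{u} R} (Q : ProjectiveResolution Y) :
    (ShortComplex.mk _ _ (d_aug Q)).Exact := Q.exact₀

/-- A chosen lift of `ε : C_0 ⟶ Y` to a chain map from a complex `C` of projectives, augmented by
`ε`, to a projective resolution of `Y` (unique up to homotopy). -/
def augLift (C : ChainComplex (ModuleCat.{u} R) ℕ)
    [∀ k, Projective (C.X k)] {Y : ModuleCat.{u} R} (ε : C.X 0 ⟶ Y) (hε : C.d 1 0 ≫ ε = 0)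
    (Q : ProjectiveResolution Y) : C ⟶ Q.complex :=
  ChainComplex.mkHom _ _ (Projective.factorThru ε (aug Q))
    ((exact_aug Q).liftFromProjective (C.d 1 0 ≫ Projective.factorThru ε (aug Q)) (by simpa))
    ((exact_aug Q).liftFromProjective_comp _ _)
    fun n g => ⟨(Q.exact_succ n).liftFromProjective (C.d (n + 2) (n + 1) ≫ g.2.1)
        (by simp [g.2.2]), (Q.exact_succ n).liftFromProjective_comp _ _⟩

theorem augLift_comp (C : ChainComplex (ModuleCat.{u} R) ℕ)
    [∀ k, Projective (C.X k)] {Y : ModuleCat.{u} R} (ε : C.X 0 ⟶ Y) (hε : C.d 1 0 ≫ ε = 0)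
    (Q : ProjectiveResolution Y) : (augLift C ε hε Q).f 0 ≫ aug Q = ε := by
  simp [augLift]

/-- The projective resolution `P` of `R/I` through which Mathlib computes `Tor'`. -/
abbrev resolution (I : Ideal R) : ProjectiveResolution (ModuleCat.of R (R ⧸ I)) :=
  projectiveResolution _

theorem projTensor (P Q : ModuleCat.{u} R) [Projective P] [Projective Q] : Projective (P ⊗ Q) := by
  have h1 : Module.Projective R P := (IsProjective.iff_projective (R:=R) P).2 inferInstance
  have h2 : Module.Projective R Q := (IsProjective.iff_projective (R:=R) Q).2 inferInstance
  exact (IsProjective.iff_projective (R := R) (TensorProduct R P Q)).1 inferInstance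

/-- The tensor square `C ⊗ C` of a chain complex, with the usual sign in its differential. -/
abbrev sq (C : ChainComplex (ModuleCat.{u} R) ℕ) : ChainComplex (ModuleCat.{u} R) ℕ :=
  HomologicalComplex.tensorObj C C

/-- The map `C_p ⊗ C_q ⟶ (C ⊗ C)_n`: the inclusion if `p + q = n`, and `0` otherwise. -/
def sqι (C : ChainComplex (ModuleCat.{u} R) ℕ) (p q n : ℕ) : C.X p ⊗ C.X q ⟶ (sq C).X n :=
  HomologicalComplex.ιMapBifunctorOrZero C C (curriedTensor (ModuleCat.{u} R))
    (ComplexShape.down ℕ) p q n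

theorem sqι_d (C : ChainComplex (ModuleCat.{u} R) ℕ) (p q n m : ℕ) (h : p + q = n)
    (hm : m + 1 = n) :
    sqι C p q n ≫ (sq C).d n m = (C.d p (p - 1) ▷ C.X q) ≫ sqι C (p - 1) q m
      + (-1 : R) ^ p • ((C.X p ◁ C.d q (q - 1)) ≫ sqι C p (q - 1) m) := by
  subst h
  unfold sqι
  rw [HomologicalComplex.mapBifunctor.d_eq, 
    HomologicalComplex.ιMapBifunctorOrZero_eq _ _ _ _ p q (p+q) rfl, Preadditive.comp_add,
    HomologicalComplex.mapBifunctor.ι_D₁, HomologicalComplex.mapBifunctor.ι_D₂]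
  congr 1
  · rcases p with _ | p
    · rw [HomologicalComplex.mapBifunctor.d₁_eq_zero _ _ _ _ _ _ _ (by simp)]
      simp
    · rw [HomologicalComplex.mapBifunctor.d₁_eq' _ _ _ _ (i₁' := p) (by simp)]
      have : ((ComplexShape.down ℕ).ε₁ (ComplexShape.down ℕ) (ComplexShape.down ℕ) (p+1,q)) = 1 := rfl
      rw [this, one_smul]
      rfl
  · rcases q with _ | q
    · rw [HomologicalComplex.mapBifunctor.d₂_eq_zero _ _ _ _ _ _ _ (by simp)]
      simp
    · rw [HomologicalComplex.mapBifunctor.d₂_eq' _ _ _ _ _ (i₂' := q) (by simp)]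
      have : ((ComplexShape.down ℕ).ε₂ (ComplexShape.down ℕ) (ComplexShape.down ℕ) (p,q+1)) = (-1)^p := by simp
      rw [this]
      rcases Nat.even_or_odd p with hp | hp
      · rw [hp.neg_one_pow, hp.neg_one_pow, one_smul, one_smul]
        rfl
      · rw [hp.neg_one_pow, hp.neg_one_pow, neg_smul, one_smul, Units.neg_smul, one_smul]
        rfl

instance (C : ChainComplex (ModuleCat.{u} R) ℕ) [∀ k, Projective (C.X k)] (k : ℕ) :
    Projective ((sq C).X k) := by
  refine Projective.mk fun {E X} f e _ => ?_
  have := projTensor (R := R)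
  refine ⟨HomologicalComplex.mapBifunctorDesc fun p q h =>
    @Projective.factorThru _ _ (C.X p ⊗ C.X q) _ _ (projTensor _ _)
     (HomologicalComplex.ιTensorObj _ _ p q k h ≫ f) e _, ?_⟩
  apply HomologicalComplex.mapBifunctor.hom_ext
  intro p q h
  rw [HomologicalComplex.ι_mapBifunctorDesc_assoc]
  exact @Projective.factorThru_comp _ _ _ _ _ (projTensor _ _) _ _ _


/-- The augmentation `P_0 ⊗ P_0 ⟶ R/I ⊗ R/I ⟶ R/I` of `P ⊗ P`, using the multiplication of
`R/I`. -/
def sqAug (I : Ideal R) : (sq (resolution I).complex).X 0 ⟶ ModuleCat.of R (R ⧸ I) :=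
  HomologicalComplex.mapBifunctorDesc fun p q _ =>
    if h' : p = 0 ∧ q = 0 then
      (((eqToHom (by rw [h'.1]) : (resolution I).complex.X p ⟶ (resolution I).complex.X 0) ≫
        aug (resolution I)) ⊗ₘ
      ((eqToHom (by rw [h'.2]) : (resolution I).complex.X q ⟶ (resolution I).complex.X 0) ≫
        aug (resolution I))) ≫ (ModuleCat.ofHom (LinearMap.mul' R (R ⧸ I)) :
          ModuleCat.of R (R ⧸ I) ⊗ ModuleCat.of R (R ⧸ I) ⟶ ModuleCat.of R (R ⧸ I))
    else 0

theorem sqι_aug (I : Ideal R) : sqι (resolution I).complex 0 0 0 ≫ sqAug I =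
     (aug (resolution I) ⊗ₘ aug (resolution I)) ≫ (ModuleCat.ofHom (LinearMap.mul' R (R ⧸ I)) :
          ModuleCat.of R (R ⧸ I) ⊗ ModuleCat.of R (R ⧸ I) ⟶ ModuleCat.of R (R ⧸ I)) := by
  unfold sqι sqAug
  rw [HomologicalComplex.ιMapBifunctorOrZero_eq _ _ _ _ 0 0 0 rfl, HomologicalComplex.ι_mapBifunctorDesc]
  simp

theorem d_sqAug (I : Ideal R) : (sq (resolution I).complex).d 1 0 ≫ sqAug I = 0 := by
  apply HomologicalComplex.mapBifunctor.hom_ext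
  intro p q h
  have h' : p + q = 1 := h
  have key := sqι_d (resolution I).complex p q 1 0 h' rfl
  have e : HomologicalComplex.ιMapBifunctor (resolution I).complex (resolution I).complex
    (curriedTensor (ModuleCat R)) (ComplexShape.down ℕ) p q 1 h = sqι _ p q 1 := by
    unfold sqι
    rw [HomologicalComplex.ιMapBifunctorOrZero_eq _ _ _ _ p q 1 h]
  rw [e, Limits.comp_zero, ← Category.assoc, key]
  have hd := d_aug (resolution I)
  have h0 : (resolution I).complex.d 0 0 = 0 := (resolution I).complex.shape 0 0 (by simp)
  obtain ⟨rfl, rfl⟩ | ⟨rfl, rfl⟩ : (p = 1 ∧ q = 0) ∨ (p = 0 ∧ q = 1) := by omega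
  · simp only [h0, MonoidalPreadditive.whiskerLeft_zero, Limits.zero_comp,
      smul_zero, add_zero]
    change (((resolution I).complex.d 1 0 ▷ (resolution I).complex.X 0) ≫
      sqι (resolution I).complex 0 0 0) ≫ sqAug I = 0
    rw [Category.assoc, sqι_aug, ← Category.assoc, whiskerRight_comp_tensorHom, hd]
    simp
  · simp only [h0, MonoidalPreadditive.zero_whiskerRight, Limits.zero_comp,
      pow_zero, one_smul, zero_add]
    change (((resolution I).complex.X 0 ◁ (resolution I).complex.d 1 0) ≫
      sqι (resolution I).complex 0 0 0) ≫ sqAug I = 0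
    rw [Category.assoc, sqι_aug, ← Category.assoc, whiskerLeft_comp_tensorHom, hd]
    simp

instance (I : Ideal R) (k : ℕ) : Projective ((resolution I).complex.X k) := (resolution I).projective k

/-- A chain map `P ⊗ P ⟶ P` that covers the multiplication `R/I ⊗ R/I ⟶ R/I`. -/
def mult (I : Ideal R) : sq (resolution I).complex ⟶ (resolution I).complex :=
  augLift _ (sqAug I) (d_sqAug I) (resolution I)

/-- `mult` as bilinear maps `P_p × P_q → P_n` (zero unless `p + q = n`). -/
def multBil (I : Ideal R) (p q n : ℕ) : (resolution I).complex.X p →ₗ[R] (resolution I).complex.X q →ₗ[R]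
    (resolution I).complex.X n :=
  TensorProduct.curry (sqι (resolution I).complex p q n ≫ (mult I).f n).hom

theorem multBil_d (I : Ideal R) (p q n m : ℕ) (h : p + q = n) (hm : m + 1 = n)
    (x : (resolution I).complex.X p) (y : (resolution I).complex.X q) :
    (resolution I).complex.d n m (multBil I p q n x y) =
      multBil I (p - 1) q m ((resolution I).complex.d p (p - 1) x) y +
        (-1 : R) ^ p • multBil I p (q - 1) m x ((resolution I).complex.d q (q - 1) y) := by
  have e : (sqι (resolution I).complex p q n ≫ (mult I).f n) ≫ (resolution I).complex.d n m =
      (((resolution I).complex.d p (p - 1) ▷ (resolution I).complex.X q) ≫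
        (sqι (resolution I).complex (p - 1) q m ≫ (mult I).f m))
      + (-1 : R) ^ p • (((resolution I).complex.X p ◁ (resolution I).complex.d q (q - 1)) ≫
        (sqι (resolution I).complex p (q - 1) m ≫ (mult I).f m)) := by
    rw [Category.assoc, (mult I).comm, ← Category.assoc, sqι_d _ _ _ _ _ h hm]
    simp
  exact congrArg (fun f => f.hom (x ⊗ₜ[R] y)) e

/-! ### The Koszul complex -/

/-- The ideal generated by `r_1, …, r_n`. -/
abbrev seqIdeal {n : ℕ} (r : Fin n → R) : Ideal R := Ideal.span (Set.range r)


theorem contractLeft_mem (n : ℕ) (δ : Module.Dual R (Fin n → R)) (k : ℕ)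
    (x : ExteriorAlgebra R (Fin n → R)) (hx : x ∈ ⋀[R]^(k + 1) (Fin n → R)) :
    CliffordAlgebra.contractLeft (Q := (0 : QuadraticForm R (Fin n → R))) δ x ∈
      ⋀[R]^k (Fin n → R) := by
  induction k generalizing x with
  | zero =>
    change x ∈ LinearMap.range (ExteriorAlgebra.ι R) ^ (0 + 1) at hx
    rw [zero_add, pow_one] at hx
    obtain ⟨v, rfl⟩ := hx
    change _ ∈ LinearMap.range (ExteriorAlgebra.ι R) ^ 0
    rw [pow_zero]
    rw [ExteriorAlgebra.ι, CliffordAlgebra.contractLeft_ι]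
    exact Submodule.algebraMap_mem _
  | succ k ih =>
    change x ∈ LinearMap.range (ExteriorAlgebra.ι R) ^ (k + 1 + 1) at hx
    rw [pow_succ'] at hx
    induction hx using Submodule.mul_induction_on' with
    | mem_mul_mem m hm y hy =>
      obtain ⟨v, rfl⟩ := hm
      have := CliffordAlgebra.contractLeft_ι_mul (Q := (0 : QuadraticForm R (Fin n → R))) (d := δ) v y
      refine this.symm ▸ Submodule.sub_mem _ (Submodule.smul_mem _ _ hy) ?_
      change _ ∈ LinearMap.range (ExteriorAlgebra.ι R) ^ (k + 1)
      rw [pow_succ']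
      exact Submodule.mul_mem_mul ⟨v, rfl⟩ (ih y hy)
    | add x _ y _ hx hy => rw [map_add]; exact Submodule.add_mem _ hx hy

/-- Contraction with the linear form `δ`, as a map `⋀^{k+1} R^n → ⋀^k R^n`. -/
def contract {n : ℕ} (δ : Module.Dual R (Fin n → R)) (k : ℕ) :
    ⋀[R]^(k + 1) (Fin n → R) →ₗ[R] ⋀[R]^k (Fin n → R) :=
  (CliffordAlgebra.contractLeft (Q := (0 : QuadraticForm R (Fin n → R))) δ).restrict
    (contractLeft_mem n δ k)

/-- The Koszul complex of `r_1, …, r_n`: the exterior algebra on `e_1, …, e_n` with the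
antiderivation `e_i ↦ r_i` as differential. -/
def koszul {n : ℕ} (r : Fin n → R) : ChainComplex (ModuleCat.{u} R) ℕ :=
  ChainComplex.of (fun k => ModuleCat.of R (⋀[R]^k (Fin n → R)))
    (fun k => ModuleCat.ofHom (contract (Fintype.linearCombination R r) k)) (by
      intro k
      refine ModuleCat.hom_ext (LinearMap.ext fun x => ?_)
      exact Subtype.ext (CliffordAlgebra.contractLeft_contractLeft _ _))


instance {n : ℕ} (r : Fin n → R) (k : ℕ) : Projective ((koszul r).X k) := by
  change Projective (ModuleCat.of R (⋀[R]^k (Fin n → R)))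
  exact (IsProjective.iff_projective _).1 inferInstance

theorem koszul_d {n : ℕ} (r : Fin n → R) (k : ℕ) :
    (koszul r).d (k + 1) k = ModuleCat.ofHom (contract (Fintype.linearCombination R r) k) := by
  exact ChainComplex.of_d (V := ModuleCat.{u} R) (fun k => ModuleCat.of R (⋀[R]^k (Fin n → R)))
    (fun k => ModuleCat.ofHom (contract (Fintype.linearCombination R r) k)) k

theorem contract_linearCombination {n : ℕ} (r : Fin n → R) (k : ℕ) (x : ⋀[R]^(k + 1) (Fin n → R)) :
    contract (Fintype.linearCombination R r) k x ∈
      seqIdeal r • (⊤ : Submodule R (⋀[R]^k (Fin n → R))) := by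
  have e : contract (Fintype.linearCombination R r) k x =
      ∑ i, r i • contract (LinearMap.proj i) k x := by
    apply Subtype.ext
    have h : Fintype.linearCombination R r =
        ∑ i, r i • (LinearMap.proj i : (Fin n → R) →ₗ[R] R) := by
      ext i
      simp [Fintype.linearCombination_apply, Pi.single_apply]
    simp [contract, h]
  rw [e]
  exact Submodule.sum_mem _ fun i _ => Submodule.smul_mem_smul
    (Ideal.subset_span ⟨i, rfl⟩) Submodule.mem_top

/-- The augmentation `⋀^0 R^n = R ⟶ R/I`. -/
def koszulAug {n : ℕ} (r : Fin n → R) :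
    (koszul r).X 0 ⟶ ModuleCat.of R (R ⧸ seqIdeal r) :=
  ModuleCat.ofHom ((Submodule.mkQ (seqIdeal r)).comp
    (exteriorPower.zeroEquiv R (Fin n → R)).toLinearMap)

theorem d_koszulAug {n : ℕ} (r : Fin n → R) : (koszul r).d 1 0 ≫ koszulAug r = 0 := by
  rw [koszul_d]
  refine ModuleCat.hom_ext (LinearMap.ext fun x => ?_)
  change Submodule.mkQ (seqIdeal r) (exteriorPower.zeroEquiv R (Fin n → R)
    (contract (Fintype.linearCombination R r) 0 x)) = 0
  rw [Submodule.mkQ_apply, Submodule.Quotient.mk_eq_zero]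
  have := Submodule.mem_map_of_mem (f := (exteriorPower.zeroEquiv R (Fin n → R)).toLinearMap)
    (contract_linearCombination r 0 x)
  rw [Submodule.map_smul''] at this
  have h := Submodule.smul_mono le_rfl le_top this
  simpa using h

/-- A chain map from the Koszul complex to the resolution `P` of `R/I` that covers the identity. -/
def koszulLift {n : ℕ} (r : Fin n → R) :
    koszul r ⟶ (resolution (seqIdeal r)).complex :=
  augLift _ (koszulAug r) (d_koszulAug r) _

/-! ### Tor, its exterior product and connecting homomorphism -/

variable (I : Ideal R)

/-- `Tor_k^R(R/I, N)`. -/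
def TorQ (I : Ideal R) (k : ℕ) (N : Type u) [AddCommGroup N] [Module R N] : Type u :=
  ((Tor' (ModuleCat.{u} R) k).obj (ModuleCat.of R (R ⧸ I))).obj (ModuleCat.of R N)

section
variable (k : ℕ) (N : Type u) [AddCommGroup N] [Module R N]

instance : AddCommGroup (TorQ I k N) := inferInstanceAs (AddCommGroup
  (((Tor' (ModuleCat.{u} R) k).obj (ModuleCat.of R (R ⧸ I))).obj (ModuleCat.of R N) : ModuleCat R))
instance : Module R (TorQ I k N) := inferInstanceAs (Module R
  (((Tor' (ModuleCat.{u} R) k).obj (ModuleCat.of R (R ⧸ I))).obj (ModuleCat.of R N) : ModuleCat R))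

/-- The complex `P ⊗ N`, where `P` is the resolution of `R/I`. -/
def resTensor (N : ModuleCat.{u} R) : ChainComplex (ModuleCat.{u} R) ℕ :=
  ((tensorRight N).mapHomologicalComplex _).obj (resolution I).complex

/-- `Tor_k(R/I, N)` is the homology of `P ⊗ N`. -/
def torIso : TorQ I k N ≃ₗ[R] (resTensor I (ModuleCat.of R N)).homology k :=
  ((resolution I).isoLeftDerivedObj (tensorRight (ModuleCat.of R N)) k).toLinearEquiv

/-- `Tor_0(R/I, N) = R/I ⊗ N`. -/
def torZero : TorQ I 0 N ≃ₗ[R] TensorProduct R (R ⧸ I) N :=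
  ((tensorRight (ModuleCat.of R N)).leftDerivedZeroIsoSelf.app (ModuleCat.of R (R ⧸ I))).toLinearEquiv

end

/-- The cycles in degree `k`. -/
def cyc (C : ChainComplex (ModuleCat.{u} R) ℕ) (k : ℕ) : Submodule R (C.X k) :=
  LinearMap.ker (C.d k (k - 1)).hom

theorem next_down (k : ℕ) : (ComplexShape.down ℕ).next k = k - 1 := by
  cases k <;> simp

theorem d_mem_cyc (C : ChainComplex (ModuleCat.{u} R) ℕ) (k : ℕ) (x : C.X (k + 1)) :
    C.d (k + 1) k x ∈ cyc C k :=
  LinearMap.congr_fun (congrArg ModuleCat.Hom.hom (C.d_comp_d (k + 1) k (k - 1))) x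

/-- The homology class of a cycle. -/
def cls (C : ChainComplex (ModuleCat.{u} R) ℕ) (k : ℕ) : cyc C k →ₗ[R] C.homology k :=
  (C.liftCycles (A := ModuleCat.of R (cyc C k)) (ModuleCat.ofHom (cyc C k).subtype) (k - 1)
    (next_down k) (ModuleCat.hom_ext (LinearMap.ext fun x => x.2)) ≫ C.homologyπ k).hom

theorem cls_surjective (C : ChainComplex (ModuleCat.{u} R) ℕ) (k : ℕ) :
    Function.Surjective (cls C k) := by
  intro h
  obtain ⟨c, rfl⟩ := (ModuleCat.epi_iff_surjective (C.homologyπ k)).1 inferInstance h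
  have hc : C.iCycles k c ∈ cyc C k :=
    LinearMap.congr_fun (congrArg ModuleCat.Hom.hom (C.iCycles_d k (k - 1))) c
  refine ⟨⟨_, hc⟩, congrArg (C.homologyπ k).hom ?_⟩
  apply (ModuleCat.mono_iff_injective (C.iCycles k)).1 inferInstance
  exact congrArg (fun f => f.hom ⟨_, hc⟩) (C.liftCycles_i
    (A := ModuleCat.of R (cyc C k)) (ModuleCat.ofHom (cyc C k).subtype) (k - 1)
    (next_down k) (ModuleCat.hom_ext (LinearMap.ext fun x => x.2)))

theorem cls_eq_zero (C : ChainComplex (ModuleCat.{u} R) ℕ) (k : ℕ) (z : cyc C k)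
    (hz : cls C k z = 0) : ∃ y : C.X (k + 1), C.d (k + 1) k y = z := by
  have ex := ShortComplex.exact_of_g_is_cokernel
    (ShortComplex.mk _ _ (C.toCycles_comp_homologyπ (k + 1) k))
    (C.homologyIsCokernel (k + 1) k (by simp))
  obtain ⟨y, hy⟩ := (ShortComplex.moduleCat_exact_iff _).1 ex _ hz
  refine ⟨y, ?_⟩
  have h1 := congrArg (fun f => f.hom y) (C.toCycles_i (k + 1) k)
  have h2 := congrArg (fun f => f.hom z) (C.liftCycles_i
    (A := ModuleCat.of R (cyc C k)) (ModuleCat.ofHom (cyc C k).subtype) (k - 1)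
    (next_down k) (ModuleCat.hom_ext (LinearMap.ext fun x => x.2)))
  exact (h1.symm.trans (congrArg (C.iCycles k).hom hy)).trans h2

theorem cls_boundary (C : ChainComplex (ModuleCat.{u} R) ℕ) (k : ℕ) (y : C.X (k + 1)) :
    cls C k ⟨C.d (k + 1) k y, d_mem_cyc C k y⟩ = 0 := by
  have h := C.toCycles_comp_homologyπ (k + 1) k
  have h1 := congrArg (fun f => f.hom y) h
  refine Eq.trans (congrArg (C.homologyπ k).hom ?_) h1
  apply (ModuleCat.mono_iff_injective (C.iCycles k)).1 inferInstance
  have h1 := congrArg (fun f => f.hom y) (C.toCycles_i (k + 1) k)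
  have h2 := congrArg (fun f => f.hom ⟨C.d (k + 1) k y, d_mem_cyc C k y⟩) (C.liftCycles_i
    (A := ModuleCat.of R (cyc C k)) (ModuleCat.ofHom (cyc C k).subtype) (k - 1)
    (next_down k) (ModuleCat.hom_ext (LinearMap.ext fun x => x.2)))
  exact h2.trans h1.symm

theorem descPairing_aux {A A' B B' C : Type u} [AddCommGroup A] [Module R A] [AddCommGroup A']
    [Module R A'] [AddCommGroup B] [Module R B] [AddCommGroup B'] [Module R B']
    [AddCommGroup C] [Module R C] (f : A →ₗ[R] A') (g : B →ₗ[R] B') (b : A →ₗ[R] B →ₗ[R] C)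
    (h₁ : ∀ a, f a = 0 → b a = 0) (h₂ : ∀ a c, g c = 0 → b a c = 0) {a a' : A} {c c' : B}
    (ha : f a = f a') (hc : g c = g c') : b a c = b a' c' := by
  have e₁ : b (a - a') c = 0 := by rw [h₁ _ (by rw [map_sub, ha, sub_self])]; rfl
  have e₂ : b a' (c - c') = 0 := h₂ _ _ (by rw [map_sub, hc, sub_self])
  rw [map_sub, LinearMap.sub_apply, sub_eq_zero] at e₁
  rw [map_sub, sub_eq_zero] at e₂
  rw [e₁, e₂]

/-- A bilinear map that kills the kernels of two surjections descends to their targets. -/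
def descPairing {A A' B B' C : Type u} [AddCommGroup A] [Module R A] [AddCommGroup A']
    [Module R A'] [AddCommGroup B] [Module R B] [AddCommGroup B'] [Module R B']
    [AddCommGroup C] [Module R C] (f : A →ₗ[R] A') (g : B →ₗ[R] B')
    (hf : Function.Surjective f) (hg : Function.Surjective g) (b : A →ₗ[R] B →ₗ[R] C)
    (h₁ : ∀ a, f a = 0 → b a = 0) (h₂ : ∀ a c, g c = 0 → b a c = 0) : A' →ₗ[R] B' →ₗ[R] C :=
  LinearMap.mk₂ R (fun x y => b (hf x).choose (hg y).choose)
    (fun x x' y => descPairing_aux f g b h₁ h₂ (a := (hf (x + x')).choose)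
      (a' := (hf x).choose + (hf x').choose) (by
        rw [map_add, (hf _).choose_spec, (hf _).choose_spec, (hf _).choose_spec]) rfl |>.trans
      (by simp))
    (fun c x y => descPairing_aux f g b h₁ h₂ (a := (hf (c • x)).choose)
      (a' := c • (hf x).choose) (by
        rw [map_smul, (hf _).choose_spec, (hf _).choose_spec]) rfl |>.trans
      (by simp))
    (fun x y y' => descPairing_aux f g b h₁ h₂ (c := (hg (y + y')).choose)
      (c' := (hg y).choose + (hg y').choose) rfl (by
        rw [map_add, (hg _).choose_spec, (hg _).choose_spec, (hg _).choose_spec]) |>.trans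
      (by simp))
    (fun c x y => descPairing_aux f g b h₁ h₂ (c := (hg (c • y)).choose)
      (c' := c • (hg y).choose) rfl (by
        rw [map_smul, (hg _).choose_spec, (hg _).choose_spec]) |>.trans
      (by simp))

theorem descPairing_apply {A A' B B' C : Type u} [AddCommGroup A] [Module R A] [AddCommGroup A']
    [Module R A'] [AddCommGroup B] [Module R B] [AddCommGroup B'] [Module R B']
    [AddCommGroup C] [Module R C] (f : A →ₗ[R] A') (g : B →ₗ[R] B')
    (hf : Function.Surjective f) (hg : Function.Surjective g) (b : A →ₗ[R] B →ₗ[R] C)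
    (h₁ : ∀ a, f a = 0 → b a = 0) (h₂ : ∀ a c, g c = 0 → b a c = 0) (a : A) (c : B) :
    descPairing f g hf hg b h₁ h₂ (f a) (g c) = b a c :=
  descPairing_aux f g b h₁ h₂ (hf _).choose_spec (hg _).choose_spec

section Pairing
variable {C D E : ChainComplex (ModuleCat.{u} R) ℕ}

/-- A family of bilinear maps `C_p × D_q → E_n` that satisfies the graded Leibniz rule (the degrees
`p - 1` and `q - 1` are truncated, where the differential is zero). -/
def IsLeibniz (b : ∀ p q n, C.X p →ₗ[R] D.X q →ₗ[R] E.X n) : Prop :=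
  ∀ p q n m, p + q = n → m + 1 = n → ∀ x y,
    E.d n m (b p q n x y) = b (p - 1) q m (C.d p (p - 1) x) y +
      (-1 : R) ^ p • b p (q - 1) m x (D.d q (q - 1) y)

theorem IsLeibniz.mem_cyc {b : ∀ p q n, C.X p →ₗ[R] D.X q →ₗ[R] E.X n} (hb : IsLeibniz b)
    (p q : ℕ) {x : C.X p} {y : D.X q} (hx : x ∈ cyc C p)
    (hy : y ∈ cyc D q) : b p q (p + q) x y ∈ cyc E (p + q) := by
  have hx' : C.d p (p - 1) x = 0 := hx
  have hy' : D.d q (q - 1) y = 0 := hy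
  change E.d (p + q) (p + q - 1) _ = 0
  rcases Nat.eq_zero_or_pos (p + q) with h | h
  · rw [E.shape _ _ (by simp; omega)]
    rfl
  · rw [hb p q (p + q) (p + q - 1) rfl (by omega), hx', hy']
    simp

variable (b : ∀ p q n, C.X p →ₗ[R] D.X q →ₗ[R] E.X n) (hb : IsLeibniz b)

/-- The class of the product of two cycles. -/
def cycPairing (p q : ℕ) : cyc C p →ₗ[R] cyc D q →ₗ[R] E.homology (p + q) :=
  LinearMap.mk₂ R (fun z w => cls E (p + q) ⟨b p q (p + q) z w, hb.mem_cyc p q z.2 w.2⟩)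
    (fun z z' w => by rw [← map_add]; congr 1; ext; simp)
    (fun c z w => by rw [← map_smul]; congr 1; ext; simp)
    (fun z w w' => by rw [← map_add]; congr 1; ext; simp)
    (fun c z w => by rw [← map_smul]; congr 1; ext; simp)

theorem cycPairing_left (p q : ℕ) (z : cyc C p) (hz : cls C p z = 0) :
    cycPairing b hb p q z = 0 := by
  ext w
  obtain ⟨y, hy⟩ := cls_eq_zero C p z hz
  have hw : D.d q (q - 1) w = 0 := w.2
  have h := hb (p + 1) q (p + q + 1) (p + q) (by omega) rfl y w
  rw [hw, map_zero, smul_zero, add_zero] at h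
  refine Eq.trans (congrArg (cls E (p + q)) (Subtype.ext ?_)) 
    (cls_boundary E (p + q) (b (p + 1) q (p + q + 1) y w))
  change b p q (p + q) z w = E.d _ _ _
  rw [h, ← hy]
  rfl

theorem cycPairing_right (p q : ℕ) (z : cyc C p) (w : cyc D q) (hw : cls D q w = 0) :
    cycPairing b hb p q z w = 0 := by
  obtain ⟨y, hy⟩ := cls_eq_zero D q w hw
  have hz : C.d p (p - 1) z = 0 := z.2
  have h := hb p (q + 1) (p + q + 1) (p + q) rfl rfl z y
  rw [hz, map_zero, LinearMap.zero_apply, zero_add] at h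
  refine Eq.trans (congrArg (cls E (p + q)) (Subtype.ext ?_)) 
    (cls_boundary E (p + q) ((-1 : R) ^ p • b p (q + 1) (p + q + 1) z y))
  change b p q (p + q) z w = E.d _ _ _
  rw [map_smul, h, smul_smul, ← mul_pow, ← hy]
  simp

/-- The pairing `[z], [w] ↦ [b(z, w)]` on homology. -/
def homPairing (p q : ℕ) : C.homology p →ₗ[R] D.homology q →ₗ[R] E.homology (p + q) :=
  descPairing (cls C p) (cls D q) (cls_surjective C p) (cls_surjective D q) (cycPairing b hb p q)
    (cycPairing_left b hb p q) (cycPairing_right b hb p q)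

theorem homPairing_cls (p q : ℕ) (z : cyc C p) (w : cyc D q) :
    homPairing b hb p q (cls C p z) (cls D q w) =
      cls E (p + q) ⟨b p q (p + q) z w, hb.mem_cyc p q z.2 w.2⟩ :=
  descPairing_apply _ _ _ _ _ _ _ z w

end Pairing

theorem map₂_leibniz {A A' B B' C C' M N L : Type u} [AddCommGroup A] [Module R A]
    [AddCommGroup A'] [Module R A'] [AddCommGroup B] [Module R B] [AddCommGroup B'] [Module R B']
    [AddCommGroup C] [Module R C] [AddCommGroup C'] [Module R C'] [AddCommGroup M] [Module R M]
    [AddCommGroup N] [Module R N] [AddCommGroup L] [Module R L]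
    (b : A →ₗ[R] B →ₗ[R] C) (b₁ : A' →ₗ[R] B →ₗ[R] C') (b₂ : A →ₗ[R] B' →ₗ[R] C')
    (dA : A →ₗ[R] A') (dB : B →ₗ[R] B') (dC : C →ₗ[R] C') (s : R)
    (h : ∀ x y, dC (b x y) = b₁ (dA x) y + s • b₂ x (dB y)) (β : M →ₗ[R] N →ₗ[R] L)
    (x : TensorProduct R A M) (y : TensorProduct R B N) :
    dC.rTensor L (TensorProduct.map₂ b β x y) =
      TensorProduct.map₂ b₁ β (dA.rTensor M x) y +
        s • TensorProduct.map₂ b₂ β x (dB.rTensor N y) := by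
  induction x with
  | zero => simp
  | add x x' hx hx' =>
    simp only [map_add, LinearMap.add_apply, hx, hx', smul_add]
    abel
  | tmul x m =>
    induction y with
    | zero => simp
    | add y y' hy hy' =>
      simp only [map_add, hy, hy', smul_add]
      abel
    | tmul y n =>
      simp [h, TensorProduct.add_tmul, TensorProduct.smul_tmul']

section
variable {M N L : Type u} [AddCommGroup M] [Module R M] [AddCommGroup N] [Module R N]
  [AddCommGroup L] [Module R L]

/-- `(x ⊗ m, y ⊗ n) ↦ x y ⊗ β(m, n)` on `P ⊗ M` and `P ⊗ N`. -/
def chainPairing (β : M →ₗ[R] N →ₗ[R] L) (p q n : ℕ) :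
    (resTensor I (ModuleCat.of R M)).X p →ₗ[R] (resTensor I (ModuleCat.of R N)).X q →ₗ[R]
      (resTensor I (ModuleCat.of R L)).X n :=
  TensorProduct.map₂ (multBil I p q n) β

theorem chainPairing_leibniz (β : M →ₗ[R] N →ₗ[R] L) : IsLeibniz (chainPairing I β) := by
  intro p q n m h hm x y
  exact map₂_leibniz _ _ _ ((resolution I).complex.d p (p - 1)).hom
    ((resolution I).complex.d q (q - 1)).hom ((resolution I).complex.d n m).hom _
    (multBil_d I p q n m h hm) β x y

/-- The exterior product `Tor_p(R/I, M) × Tor_q(R/I, N) → Tor_{p+q}(R/I, L)` induced by the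
multiplication of `R/I` and a bilinear map `β : M × N → L`. -/
def torProd (β : M →ₗ[R] N →ₗ[R] L) (p q : ℕ) :
    TorQ I p M →ₗ[R] TorQ I q N →ₗ[R] TorQ I (p + q) L :=
  ((homPairing (chainPairing I β) (chainPairing_leibniz I β) p q).compl₁₂
    (torIso I p M).toLinearMap (torIso I q N).toLinearMap).compr₂
      (torIso I (p + q) L).symm.toLinearMap

end

theorem smul_homology_eq_zero (k : ℕ) (N : ModuleCat.{u} R) (c : R) (hc : c ∈ I)
    (x : (resTensor I N).homology k) : c • x = 0 := by
  have hc0 : c • 𝟙 (ModuleCat.of R (R ⧸ I)) = 0 := by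
    refine ModuleCat.hom_ext (LinearMap.ext fun y => ?_)
    obtain ⟨y, rfl⟩ := Submodule.mkQ_surjective _ y
    change Submodule.mkQ I (c • y) = 0
    rw [Submodule.mkQ_apply, Submodule.Quotient.mk_eq_zero]
    exact I.mul_mem_right _ hc
  have h1 := ProjectiveResolution.isoLeftDerivedObj_inv_naturality
    (0 : ModuleCat.of R (R ⧸ I) ⟶ ModuleCat.of R (R ⧸ I)) (resolution I) (resolution I)
    (c • 𝟙 (resolution I).complex) (by
      have h : c • aug (resolution I) = 0 := by
        rw [← Category.comp_id (aug (resolution I)), ← Linear.comp_smul, hc0, Limits.comp_zero]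
      change (c • 𝟙 ((resolution I).complex.X 0)) ≫ aug (resolution I) = aug (resolution I) ≫ 0
      rw [Limits.comp_zero, Linear.smul_comp, Category.id_comp, h]) (tensorRight N) k
  have h2 := ProjectiveResolution.isoLeftDerivedObj_inv_naturality
    (0 : ModuleCat.of R (R ⧸ I) ⟶ ModuleCat.of R (R ⧸ I)) (resolution I) (resolution I)
    0 (Limits.zero_comp.trans Limits.comp_zero.symm) (tensorRight N) k
  rw [h2, cancel_mono, Functor.map_zero] at h1
  have h3 : ((tensorRight N).mapHomologicalComplex (ComplexShape.down ℕ)).map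
      (c • 𝟙 (resolution I).complex) = c • 𝟙 (resTensor I N) := by
    ext i : 1
    change (c • 𝟙 ((resolution I).complex.X i)) ▷ N = c • 𝟙 ((resolution I).complex.X i ⊗ N)
    rw [MonoidalLinear.smul_whiskerRight, id_whiskerRight]
  have h4 : HomologicalComplex.homologyMap (c • 𝟙 (resTensor I N)) k = 0 :=
    (congrArg (fun f => HomologicalComplex.homologyMap f k) h3).symm.trans h1.symm
  have h5 : HomologicalComplex.homologyMap (c • 𝟙 (resTensor I N)) k =
      c • 𝟙 ((resTensor I N).homology k) := by
    have := ShortComplex.homologyMap_smul (𝟙 ((resTensor I N).sc k)) c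
    rw [ShortComplex.homologyMap_id] at this
    exact this
  exact LinearMap.congr_fun (congrArg ModuleCat.Hom.hom (h5.symm.trans h4)) x

theorem torQ_isTorsion (k : ℕ) (N : Type u) [AddCommGroup N] [Module R N] :
    Module.IsTorsionBySet R (TorQ I k N) I := by
  intro x c
  apply (torIso I k N).injective
  rw [map_zero, map_smul]
  exact smul_homology_eq_zero I k _ c.1 c.2 _

/-- `Tor_k(R/I, N)` as a module over `R/I`. -/
instance (k : ℕ) (N : Type u) [AddCommGroup N] [Module R N] : Module (R ⧸ I) (TorQ I k N) :=
  (torQ_isTorsion I k N).module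

/-- Functoriality of `Tor_k(R/I, -)`. -/
def torMap (k : ℕ) {M N : Type u} [AddCommGroup M] [Module R M] [AddCommGroup N] [Module R N]
    (f : M →ₗ[R] N) : TorQ I k M →ₗ[R] TorQ I k N :=
  (((Tor' (ModuleCat.{u} R) k).obj (ModuleCat.of R (R ⧸ I))).map (ModuleCat.ofHom f)).hom

section Connecting
variable {M N L : Type u} [AddCommGroup M] [Module R M] [AddCommGroup N] [Module R N]
  [AddCommGroup L] [Module R L] (f : M →ₗ[R] N) (g : N →ₗ[R] L)

/-- `P ⊗ M ⟶ P ⊗ N`. -/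
def resTensorMap {M N : ModuleCat.{u} R} (f : M ⟶ N) : resTensor I M ⟶ resTensor I N :=
  (NatTrans.mapHomologicalComplex ((tensoringRight (ModuleCat.{u} R)).map f) _).app
    (resolution I).complex

theorem resTensorMap_comp (hfg : Function.Exact f g) : resTensorMap I (ModuleCat.ofHom f) ≫
    resTensorMap I (ModuleCat.ofHom g) = 0 := by
  ext i : 1
  change (_ ◁ ModuleCat.ofHom f) ≫ ((resolution I).complex.X i ◁ ModuleCat.ofHom g) = 0
  rw [← whiskerLeft_comp]
  have : ModuleCat.ofHom f ≫ ModuleCat.ofHom g = 0 :=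
    ModuleCat.hom_ext (LinearMap.ext fun x => hfg.apply_apply_eq_zero x)
  rw [this, MonoidalPreadditive.whiskerLeft_zero]

theorem resTensor_shortExact (hf : Function.Injective f) (hfg : Function.Exact f g)
    (hg : Function.Surjective g) : (ShortComplex.mk (resTensorMap I (ModuleCat.ofHom f))
    (resTensorMap I (ModuleCat.ofHom g)) (resTensorMap_comp I f g hfg)).ShortExact := by
  apply HomologicalComplex.shortExact_of_degreewise_shortExact
  intro i
  have hp : Module.Projective R ((resolution I).complex.X i) :=
    (IsProjective.iff_projective (R := R) _).2
      (inferInstanceAs (Projective ((resolution I).complex.X i)))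
  refine ModuleCat.shortComplex_shortExact _ ?_ ?_ ?_
  · exact lTensor_exact ((resolution I).complex.X i) hfg hg
  · exact Module.Flat.lTensor_preserves_injective_linearMap (M := (resolution I).complex.X i) f hf
  · exact LinearMap.lTensor_surjective ((resolution I).complex.X i) hg

/-- The connecting homomorphism `Tor_{k+1}(R/I, L) → Tor_k(R/I, M)` of a short exact sequence
`0 → M → N → L → 0`. -/
def torδ (hf : Function.Injective f) (hfg : Function.Exact f g) (hg : Function.Surjective g)
    (k : ℕ) : TorQ I (k + 1) L →ₗ[R] TorQ I k M :=
  (torIso I k M).symm.toLinearMap.comp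
    (((resTensor_shortExact I f g hf hfg hg).δ (k + 1) k rfl).hom.comp
      (torIso I (k + 1) L).toLinearMap)

end Connecting

section Koszul
variable {n : ℕ} (r : Fin n → R)

theorem koszulChain_mem (k : ℕ) (v : ⋀[R]^k (Fin n → R)) :
    (((koszulLift r).f k).hom v ⊗ₜ[R] (1 : R ⧸ seqIdeal r) :
      TensorProduct R ((resolution (seqIdeal r)).complex.X k)
        (R ⧸ seqIdeal r)) ∈
      cyc (resTensor (seqIdeal r) (ModuleCat.of R _)) k := by
  rcases k with _ | k
  · change (resTensor _ _).d 0 (0 - 1) _ = 0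
    rw [(resTensor _ _).shape 0 (0 - 1) (by simp)]
    rfl
  · change ((resolution (seqIdeal r)).complex.d (k + 1) k
      (((koszulLift r).f (k + 1)).hom v)) ⊗ₜ[R] (1 : R ⧸ seqIdeal r) = 0
    have h : (resolution (seqIdeal r)).complex.d (k + 1) k
      (((koszulLift r).f (k + 1)).hom v) = ((koszulLift r).f k).hom
        (contract (Fintype.linearCombination R r) k v) := by
      have := (koszulLift r).comm (k + 1) k
      rw [koszul_d] at this
      exact LinearMap.congr_fun (congrArg ModuleCat.Hom.hom this) v
    rw [h]
    let F : ⋀[R]^k (Fin n → R) →ₗ[R] (resolution (seqIdeal r)).complex.X k :=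
      ((koszulLift r).f k).hom
    refine Submodule.smul_induction_on (p := fun x => F x ⊗ₜ[R] (1 : R ⧸ _) = 0)
      (contract_linearCombination r k v) ?_ ?_
    · intro c hc w _
      rw [map_smul, TensorProduct.smul_tmul]
      have : c • (1 : R ⧸ seqIdeal r) = 0 := by
        rw [Algebra.smul_def, mul_one]
        exact Ideal.Quotient.eq_zero_iff_mem.2 hc
      rw [this, TensorProduct.tmul_zero]
    · intro x y hx hy
      rw [map_add, TensorProduct.add_tmul, hx, hy, add_zero]

/-- The class in `Tor_k(R/I, R/I)` of an element `v` of degree `k` of the exterior algebra on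
`e_1, …, e_n`, that is, of the cycle `v ⊗ 1` in (Koszul complex) `⊗ R/I`. -/
def koszulClass (k : ℕ) (v : ⋀[R]^k (Fin n → R)) :
    TorQ (seqIdeal r) k (R ⧸ seqIdeal r) :=
  (torIso _ k _).symm (cls _ k ⟨_, koszulChain_mem r k v⟩)

end Koszul

/-! ### The bigraded algebra -/

/-- `p_* : Tor_k(R/I, I) → Tor_k(R/I, I/I²)`, induced by the projection. -/
def projStar (k : ℕ) : TorQ I k ↥I →ₗ[R] TorQ I k I.Cotangent :=
  torMap I k I.toCotangent

/-- The multiplication `I ^ s × I ^ t → I ^ (s + t)`. -/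
def powMul (s t : ℕ) : ↥(I ^ s) →ₗ[R] ↥(I ^ t) →ₗ[R] ↥(I ^ (s + t)) :=
  LinearMap.mk₂ R (fun x y => ⟨x * y, pow_add I s t ▸ Ideal.mul_mem_mul x.2 y.2⟩)
    (fun x x' y => Subtype.ext (add_mul (x : R) x' y))
    (fun c x y => Subtype.ext (mul_assoc c (x : R) y))
    (fun x y y' => Subtype.ext (mul_add (x : R) y y'))
    (fun c x y => Subtype.ext (mul_left_comm (x : R) c y))

/-- The bigraded module `⨁_{s,k} Tor_k(R/I, I^s)`; the bidegree is `(s, k)`. -/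
def BlowupTor : Type u := DirectSum (ℕ × ℕ) fun p => TorQ I p.2 ↥(I ^ p.1)

instance : AddCommGroup (BlowupTor I) :=
  inferInstanceAs (AddCommGroup (DirectSum (ℕ × ℕ) fun p => TorQ I p.2 ↥(I ^ p.1)))

instance : Module R (BlowupTor I) :=
  inferInstanceAs (Module R (DirectSum (ℕ × ℕ) fun p => TorQ I p.2 ↥(I ^ p.1)))

instance : Module (R ⧸ I) (BlowupTor I) :=
  inferInstanceAs (Module (R ⧸ I) (DirectSum (ℕ × ℕ) fun p => TorQ I p.2 ↥(I ^ p.1)))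

/-- The inclusion of the summand `Tor_k(R/I, I^s)`. -/
def BlowupTor.of (s k : ℕ) : TorQ I k ↥(I ^ s) →ₗ[R] BlowupTor I :=
  DirectSum.lof R (ℕ × ℕ) (fun p => TorQ I p.2 ↥(I ^ p.1)) (s, k)

/-- The component of bidegree `(s, k)`. -/
def BlowupTor.component (s k : ℕ) : BlowupTor I →ₗ[R] TorQ I k ↥(I ^ s) :=
  DirectSum.component R (ℕ × ℕ) (fun p => TorQ I p.2 ↥(I ^ p.1)) (s, k)

/-- The product on `⨁ Tor_k(R/I, I^s)`: the sum of the exterior products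
`Tor_k(R/I, I^s) × Tor_l(R/I, I^t) → Tor_{k+l}(R/I, I^{s+t})`. -/
def BlowupTor.mulHom : BlowupTor I →ₗ[R] BlowupTor I →ₗ[R] BlowupTor I :=
  DirectSum.toModule R (ℕ × ℕ) _ fun p => LinearMap.flip <|
    DirectSum.toModule R (ℕ × ℕ) _ fun q => LinearMap.flip <|
      (torProd I (powMul I p.1 q.1) p.2 q.2).compr₂ (BlowupTor.of I (p.1 + q.1) (p.2 + q.2))

instance : NonUnitalNonAssocRing (BlowupTor I) where
  mul x y := BlowupTor.mulHom I x y
  left_distrib x y z := map_add (BlowupTor.mulHom I x) y z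
  right_distrib x y z := LinearMap.map_add₂ (BlowupTor.mulHom I) x y z
  zero_mul x := LinearMap.map_zero₂ (BlowupTor.mulHom I) x
  mul_zero x := map_zero (BlowupTor.mulHom I x)

theorem of_mul_of (s k t l : ℕ) (x : TorQ I k ↥(I ^ s)) (y : TorQ I l ↥(I ^ t)) :
    BlowupTor.of I s k x * BlowupTor.of I t l y =
      BlowupTor.of I (s + t) (k + l) (torProd I (powMul I s t) k l x y) := by
  change BlowupTor.mulHom I _ _ = _
  unfold BlowupTor.mulHom BlowupTor.of
  erw [DirectSum.toModule_lof, LinearMap.flip_apply, DirectSum.toModule_lof]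
  rfl

/-- The unit is `1 ⊗ 1` in `R/I ⊗ I^0 = Tor_0(R/I, I^0)`, where `I^0 = R`. -/
instance : One (BlowupTor I) where
  one := BlowupTor.of I 0 0 ((torZero I _).symm (1 ⊗ₜ[R] ⟨1, by simp⟩))

/-- The element `x_i` of bidegree `(1, 0)`: the class of `1 ⊗ r_i` in `R/I ⊗ I = Tor_0(R/I, I)`. -/
def polyVar {n : ℕ} (r : Fin n → R) (i : Fin n) : BlowupTor (seqIdeal r) :=
  BlowupTor.of _ 1 0 ((torZero _ _).symm
    (1 ⊗ₜ[R] ⟨r i, (pow_one (seqIdeal r)).symm ▸ Ideal.subset_span ⟨i, rfl⟩⟩))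

/-- The inclusion of `Tor_k(R/I, I)` (with `I = I^1`). -/
def ofIdeal (k : ℕ) : TorQ I k ↥I →ₗ[R] BlowupTor I :=
  (BlowupTor.of I 1 k).comp
    (torMap I k (LinearEquiv.ofEq I (I ^ 1) (pow_one I).symm).toLinearMap)

/-- The connecting homomorphism `∂ : Tor_{k+1}(R/I, R/I) → Tor_k(R/I, I/I²)` of
`0 → I/I² → R/I² → R/I → 0`. -/
def connecting (k : ℕ) : TorQ I (k + 1) (R ⧸ I) →ₗ[R] TorQ I k I.Cotangent :=
  torδ I I.cotangentToQuotientSquare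
    (Submodule.factor (Ideal.pow_le_self two_ne_zero) : (R ⧸ I ^ 2) →ₗ[R] (R ⧸ I))
    (Ideal.cotangentToQuotientSquare_injective I)
    (by
      intro x
      obtain ⟨x, rfl⟩ := Submodule.mkQ_surjective _ x
      constructor
      · intro h
        have hx : x ∈ I := (Submodule.Quotient.mk_eq_zero I).1 h
        exact ⟨I.toCotangent ⟨x, hx⟩, rfl⟩
      · rintro ⟨y, hy⟩
        obtain ⟨y, rfl⟩ := I.toCotangent_surjective y
        rw [← hy]
        exact (Submodule.Quotient.mk_eq_zero I).2 y.2)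
    (Submodule.factor_surjective _) k

/-- `e_{i_1} ∧ ⋯ ∧ e_{i_k}` for `i_1 < ⋯ < i_k`. -/
def wedge (R : Type u) [CommRing R] {n k : ℕ} (i : Fin k ↪o Fin n) : ⋀[R]^k (Fin n → R) :=
  exteriorPower.ιMulti R k fun j => Pi.single (i j) 1

end
end TorBlowup

open TorBlowup

namespace TorBlowup

universe u v

open scoped Pointwise

/-! ### The Koszul complex of a regular sequence, in coordinates -/

section Coordinates

variable {R : Type u} [CommRing R] {M : Type v} [AddCommGroup M] [Module R M]

/-! The Koszul complex K = ∧R^n of a regular sequence not only resolves R/I, it does so strictly for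
the I-adic filtration: a cycle in I^s K that has positive degree, or has s > 0, is the boundary of
an element of I^(s-1) K (`exists_koszulD_eq`). The theorem rests on this sharpening of exactness.

Since K is free, K ⊗ J embeds in K for every ideal J, so Tor_k(R/I, J) is the module of cycles in J
∧^k modulo d(J ∧^(k+1)) (`extCls_surjective`, `extCls_eq_zero_iff`). The product of Tor is defined
through another resolution P. The two maps K ⊗ K → P, multiplying in K or multiplying in P, cover
the same map to R/I and are therefore homotopic; so on Koszul cycles the product of Tor is the wedge
product (`torProd_extCls`). Associativity and the unit are inherited from the exterior algebra.

In degree k = 0 the summand for s is I^s/I^(s+1), and a form of degree s goes to its value at r.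
Injectivity is then quasi-regularity: a form of degree s with value in I^(s+1) has all coefficients
in I (`mem_smul_top_of_homogeneousEval_mem`).

The element a_(i_0,…,i_k) is the class of the cycle d(e_{i_0} ∧ ⋯ ∧ e_{i_k}), whose coefficients lie
in I (`connecting_koszulClass`). If p_* kills the class of z, then z differs by d(I ∧^(k+1)) from a
cycle in I² ∧^k, which by strictness also lies in d(I ∧^(k+1)). A cycle in I^(s+1) ∧^k is d y with y
in I^s ∧^(k+1); expanding y in the basis e_{i_0} ∧ ⋯ ∧ e_{i_k} writes its class as a sum of products
of classes from I^s with the a's. This gives spanning (s = 0) and generation of the algebra. For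
independence, if d v = d y with y in I ∧^(k+1), then v - y is a cycle of positive degree, hence a
boundary, hence in I ∧^(k+1), and so is v.

Strictness and quasi-regularity are both proved by induction on n through M/r_0 M, for arbitrary
coefficient modules. Their common input is that r_0 m in I^s M forces m into I^(s-1) M
(`mem_pow_of_smul_mem`), which follows from r_0 being a non-zero-divisor modulo the powers of the
ideal of the remaining elements (`mem_pow_tail_of_smul_mem`). -/

/-- The Koszul differential on `∧ R^n ⊗ M`, where the coordinate of `b : Fin n → Bool` is that of the
product of the `e_i` with `b i = true`. -/
def coordDiff (M : Type v) [AddCommGroup M] [Module R M] : ∀ {n : ℕ} (_ : Fin n → R),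
    ((Fin n → Bool) → M) →ₗ[R] ((Fin n → Bool) → M)
  | 0, _ => 0
  | _ + 1, r =>
    -- With d' the differential for the tail, d(x + e_0 y) = (d' x + r_0 y) - e_0 d' y; the two
    -- branches are the two summands.
    { toFun := fun f b => bif b 0 then
        - coordDiff M (Fin.tail r) (fun β => f (Fin.cons true β)) (Fin.tail b)
        else coordDiff M (Fin.tail r) (fun β => f (Fin.cons false β)) (Fin.tail b) +
          r 0 • f (Fin.cons true (Fin.tail b))
      map_add' := fun f g => by
        funext b
        rw [Pi.add_apply]
        have h : ∀ c, (fun β => (f + g) (Fin.cons c β)) =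
          (fun β => f (Fin.cons c β)) + fun β => g (Fin.cons c β) := fun c => rfl
        rw [h, h, map_add, map_add, Pi.add_apply, Pi.add_apply, Pi.add_apply, smul_add]
        cases b 0
        · simp only [cond_false]; abel
        · simp only [cond_true]; abel
      map_smul' := fun c f => by
        funext b
        rw [Pi.smul_apply]
        have h : ∀ a, (fun β => (c • f) (Fin.cons a β)) = c • (fun β => f (Fin.cons a β)) :=
          fun a => rfl
        rw [h, h, map_smul, map_smul, Pi.smul_apply, Pi.smul_apply, Pi.smul_apply, smul_comm (r 0)]
        cases b 0 <;> simp }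

theorem coordDiff_false {n : ℕ} (r : Fin (n + 1) → R) (f : (Fin (n + 1) → Bool) → M)
    (β : Fin n → Bool) : coordDiff M r f (Fin.cons false β) =
      coordDiff M (Fin.tail r) (fun β => f (Fin.cons false β)) β + r 0 • f (Fin.cons true β) := by
  simp [coordDiff]

theorem coordDiff_true {n : ℕ} (r : Fin (n + 1) → R) (f : (Fin (n + 1) → Bool) → M)
    (β : Fin n → Bool) : coordDiff M r f (Fin.cons true β) =
      -coordDiff M (Fin.tail r) (fun β => f (Fin.cons true β)) β := by
  simp [coordDiff]

theorem funext_cons {n : ℕ} {X : Type*} {f g : (Fin (n + 1) → Bool) → X}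
    (h₀ : ∀ β, f (Fin.cons false β) = g (Fin.cons false β))
    (h₁ : ∀ β, f (Fin.cons true β) = g (Fin.cons true β)) : f = g := by
  funext b
  obtain ⟨c, β, rfl⟩ : ∃ c β, b = Fin.cons c β := ⟨b 0, Fin.tail b, by simp⟩
  cases c
  exacts [h₀ β, h₁ β]

theorem coordDiff_comp_coordDiff {n : ℕ} (r : Fin n → R) (f : (Fin n → Bool) → M) :
    coordDiff M r (coordDiff M r f) = 0 := by
  induction n with
  | zero => rfl
  | succ n ih =>
    have h₁ : (fun β => coordDiff M r f (Fin.cons true β)) =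
        -coordDiff M (Fin.tail r) (fun β => f (Fin.cons true β)) :=
      funext fun β => coordDiff_true r f β
    have h₀ : (fun β => coordDiff M r f (Fin.cons false β)) =
        coordDiff M (Fin.tail r) (fun β => f (Fin.cons false β)) +
          r 0 • fun β => f (Fin.cons true β) :=
      funext fun β => coordDiff_false r f β
    refine funext_cons (fun β => ?_) (fun β => ?_)
    · rw [coordDiff_false, h₀, map_add, ih, map_smul, coordDiff_true]
      simp
    · rw [coordDiff_true, h₁, map_neg, ih]
      simp

theorem coordDiff_map {N : Type*} [AddCommGroup N] [Module R N] (g : M →ₗ[R] N) {n : ℕ}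
    (r : Fin n → R) (f : (Fin n → Bool) → M) (b : Fin n → Bool) :
    coordDiff N r (fun b => g (f b)) b = g (coordDiff M r f b) := by
  induction n with
  | zero => simp [coordDiff]
  | succ n ih =>
    obtain ⟨c, β, rfl⟩ : ∃ c β, b = Fin.cons c β := ⟨b 0, Fin.tail b, by simp⟩
    cases c
    · rw [coordDiff_false, coordDiff_false, map_add, map_smul]
      congr 1
      exact ih (Fin.tail r) (fun β => f (Fin.cons false β)) β
    · rw [coordDiff_true, coordDiff_true, map_neg]
      congr 1
      exact ih (Fin.tail r) (fun β => f (Fin.cons true β)) β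

theorem seqIdeal_succ {n : ℕ} (r : Fin (n + 1) → R) :
    seqIdeal r = Ideal.span {r 0} ⊔ seqIdeal (Fin.tail r) := by
  rw [seqIdeal, seqIdeal, ← Submodule.span_union]
  congr 1
  ext x
  simp only [Set.mem_range, Fin.exists_fin_succ, Set.mem_union, Set.mem_singleton_iff, Fin.tail,
    eq_comm]

theorem seqIdeal_tail_le {n : ℕ} (r : Fin (n + 1) → R) : seqIdeal (Fin.tail r) ≤ seqIdeal r :=
  le_sup_right.trans (seqIdeal_succ r).ge

theorem mem_seqIdeal {n : ℕ} (r : Fin n → R) (i : Fin n) : r i ∈ seqIdeal r :=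
  Ideal.subset_span ⟨i, rfl⟩

/-- The differential raises the I-adic filtration by one, since its coefficients are among the ±
r_i. Strict acyclicity is the converse on cycles. -/
theorem coordDiff_mem {n : ℕ} (r : Fin n → R) (N : Submodule R M) (f : (Fin n → Bool) → M)
    (hf : ∀ b, f b ∈ N) (b : Fin n → Bool) : coordDiff M r f b ∈ seqIdeal r • N := by
  induction n with
  | zero => exact Submodule.zero_mem _
  | succ n ih =>
    obtain ⟨c, β, rfl⟩ : ∃ c β, b = Fin.cons c β := ⟨b 0, Fin.tail b, by simp⟩
    have hle := Submodule.smul_mono_left (N := N) (seqIdeal_tail_le r)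
    cases c
    · rw [coordDiff_false]
      exact Submodule.add_mem _ (hle (ih _ _ (fun β => hf _) _))
        (Submodule.smul_mem_smul (mem_seqIdeal r 0) (hf _))
    · rw [coordDiff_true]
      exact Submodule.neg_mem _ (hle (ih _ _ (fun β => hf _) _))

theorem const_false_succ (n : ℕ) :
    (fun _ => false : Fin (n + 1) → Bool) = Fin.cons false fun _ => false := by
  ext i; refine Fin.cases ?_ (fun i => ?_) i <;> simp

theorem single_cons_true {X : Type*} [Zero X] {n : ℕ} (x : X) (β : Fin n → Bool) :
    (Pi.single (fun _ => false) x : (Fin (n + 1) → Bool) → X) (Fin.cons true β) = 0 :=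
  Pi.single_eq_of_ne (fun h => by simpa using congrFun h 0) _

theorem single_cons_false {X : Type*} [Zero X] {n : ℕ} (x : X) (β : Fin n → Bool) :
    (Pi.single (fun _ => false) x : (Fin (n + 1) → Bool) → X) (Fin.cons false β) =
      (Pi.single (fun _ => false) x : (Fin n → Bool) → X) β := by
  rw [Pi.single_apply, Pi.single_apply, const_false_succ]
  exact if_congr ⟨fun h => (Fin.cons_injective2 h).2, fun h => by rw [h]⟩ rfl rfl

theorem coordDiff_single {n : ℕ} (r : Fin n → R) (x : M) :
    coordDiff M r (Pi.single (fun _ => false) x) = 0 := by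
  induction n with
  | zero => rfl
  | succ n ih =>
    refine funext_cons (fun β => ?_) (fun β => ?_)
    · rw [coordDiff_false, funext (single_cons_false x), ih, single_cons_true]
      simp
    · rw [coordDiff_true, funext (single_cons_true x)]
      exact neg_eq_zero.2 (congrFun (map_zero (coordDiff M (Fin.tail r))) β)

/-- An element of `I • N` is the differential of an element of degree one with coordinates
in `N`. -/
theorem exists_coordDiff_eq {n : ℕ} (r : Fin n → R) (N : Submodule R M) (x : M)
    (hx : x ∈ seqIdeal r • N) : ∃ f : (Fin n → Bool) → M, (∀ b, f b ∈ N) ∧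
      f (fun _ => false) = 0 ∧ coordDiff M r f = Pi.single (fun _ => false) x := by
  induction n generalizing x with
  | zero =>
    have h : seqIdeal r = ⊥ := by simp [seqIdeal, Set.range_eq_empty]
    rw [h, Submodule.bot_smul, Submodule.mem_bot] at hx
    exact ⟨0, fun _ => N.zero_mem, rfl, by simp [hx]⟩
  | succ n ih =>
    rw [seqIdeal_succ, Submodule.sup_smul] at hx
    obtain ⟨y, hy, z, hz, rfl⟩ := Submodule.mem_sup.1 hx
    rw [Submodule.ideal_span_singleton_smul] at hy
    obtain ⟨y, hyN, rfl⟩ := (Submodule.mem_smul_pointwise_iff_exists _ _ _).1 hy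
    obtain ⟨f, hf, hf₀, hd⟩ := ih (Fin.tail r) z hz
    -- With x = r_0 y + z and z in the tail ideal times N, the preimage is f + e_0 y, where d' f =
    -- z: the term e_0 y contributes exactly r_0 y in degree zero.
    let g : (Fin n → Bool) → M := Pi.single (fun _ => false) y
    have hg : ∀ β, g β ∈ N := fun β => by
      by_cases h : β = fun _ => false
      · simpa [g, h] using hyN
      · simp [g, h]
    refine ⟨fun b => bif b 0 then g (Fin.tail b) else f (Fin.tail b), fun b => ?_, hf₀,
      funext_cons (fun β => ?_) (fun β => ?_)⟩
    · obtain ⟨c, β, rfl⟩ : ∃ c β, b = Fin.cons c β := ⟨b 0, Fin.tail b, by simp⟩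
      cases c
      exacts [hf _, hg _]
    · rw [coordDiff_false]
      simp only [Fin.cons_zero, Fin.tail_cons, cond_false, cond_true]
      rw [hd, single_cons_false, Pi.single_add]
      simp only [g, Pi.add_apply, Pi.single_apply]
      split_ifs
      · exact add_comm _ _
      · simp
    · rw [coordDiff_true, single_cons_true]
      simp only [Fin.cons_zero, Fin.tail_cons, cond_true]
      rw [coordDiff_single, Pi.zero_apply, neg_zero]

/-- A product of s + 1 factors from a + b expands into terms that contain a factor from a and one
term with all factors in b. -/
theorem sup_pow_succ_le (a b : Ideal R) (s : ℕ) :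
    (a ⊔ b) ^ (s + 1) ≤ a * (a ⊔ b) ^ s ⊔ b ^ (s + 1) := by
  induction s with
  | zero => simp
  | succ s ih =>
    rw [pow_succ' (a ⊔ b) (s + 1), Submodule.sup_mul]
    refine sup_le le_sup_left ((Ideal.mul_mono_right ih).trans ?_)
    rw [Submodule.mul_sup]
    refine sup_le (le_sup_of_le_left ?_) (le_sup_of_le_right (pow_succ' b (s + 1)).ge)
    rw [mul_left_comm, pow_succ' (a ⊔ b)]
    exact Ideal.mul_mono_right (Ideal.mul_mono_left le_sup_right)

/-- Cycles with coordinates in `I ^ s • M` and no component of degree zero bound elements with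
coordinates in `I ^ (s - 1) • M`. -/
def StrictlyAcyclic (M : Type v) [AddCommGroup M] [Module R M] {n : ℕ} (r : Fin n → R) : Prop :=
  ∀ (s : ℕ) (f : (Fin n → Bool) → M), coordDiff M r f = 0 → f (fun _ => false) = 0 →
    (∀ b, f b ∈ seqIdeal r ^ s • (⊤ : Submodule R M)) →
    ∃ g, coordDiff M r g = f ∧ ∀ b, g b ∈ seqIdeal r ^ (s - 1) • (⊤ : Submodule R M)

/-! ### Induction on the length of the sequence: reduction modulo the first element -/

section FirstElement

variable {n : ℕ} {r : Fin (n + 1) → R}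

theorem mkQ_eq_zero_iff (t : R) (x : M) :
    (t • (⊤ : Submodule R M)).mkQ x = 0 ↔ ∃ y, t • y = x := by
  rw [Submodule.mkQ_apply, Submodule.Quotient.mk_eq_zero, Submodule.mem_smul_pointwise_iff_exists]
  simp

theorem mkQ_mem_smul_top (t : R) (J : Ideal R) (x : M)
    (hx : (t • (⊤ : Submodule R M)).mkQ x ∈ J • (⊤ : Submodule R (QuotSMulTop t M))) :
    ∃ y ∈ J • (⊤ : Submodule R M), ∃ z, x = y + t • z := by
  have h : (J • (⊤ : Submodule R M)).map (t • (⊤ : Submodule R M)).mkQ = J • ⊤ := by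
    rw [Submodule.map_smul'', Submodule.map_top, Submodule.range_mkQ]
  rw [← h] at hx
  obtain ⟨y, hy, hxy⟩ := hx
  rw [eq_comm, ← sub_eq_zero, ← map_sub, mkQ_eq_zero_iff] at hxy
  obtain ⟨z, hz⟩ := hxy
  exact ⟨y, hy, z, by rw [hz]; abel⟩

/-- By `sup_pow_succ_le`, a positive power of I is contained in (r_0) plus the same power of the
tail ideal, and r_0 dies in the quotient. -/
theorem mkQ_mem_pow_tail (s : ℕ) (x : M) (hx : x ∈ seqIdeal r ^ s • (⊤ : Submodule R M)) :
    (r 0 • (⊤ : Submodule R M)).mkQ x ∈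
      seqIdeal (Fin.tail r) ^ s • (⊤ : Submodule R (QuotSMulTop (r 0) M)) := by
  rcases s with _ | s
  · simp
  · have h := Submodule.smul_mono_left (N := (⊤ : Submodule R M))
      (sup_pow_succ_le (Ideal.span {r 0}) (seqIdeal (Fin.tail r)) s)
    rw [← seqIdeal_succ] at h
    have h := h hx
    rw [Submodule.sup_smul, mul_smul, Submodule.ideal_span_singleton_smul] at h
    obtain ⟨y, hy, z, hz, rfl⟩ := Submodule.mem_sup.1 h
    obtain ⟨y, -, rfl⟩ := (Submodule.mem_smul_pointwise_iff_exists _ _ _).1 hy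
    rw [map_add, (mkQ_eq_zero_iff (r 0) _).2 ⟨y, rfl⟩, zero_add]
    have := Submodule.mem_map_of_mem (f := (r 0 • (⊤ : Submodule R M)).mkQ) hz
    rwa [Submodule.map_smul'', Submodule.map_top, Submodule.range_mkQ] at this

theorem exists_lift_coord (t : R) (J : Ideal R) {X : Type*} (f : X → QuotSMulTop t M)
    (hf : ∀ b, f b ∈ J • (⊤ : Submodule R (QuotSMulTop t M))) :
    ∃ g : X → M, (∀ b, g b ∈ J • (⊤ : Submodule R M)) ∧
      (fun b => (t • (⊤ : Submodule R M)).mkQ (g b)) = f := by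
  have h : (J • (⊤ : Submodule R M)).map (t • (⊤ : Submodule R M)).mkQ = J • ⊤ := by
    rw [Submodule.map_smul'', Submodule.map_top, Submodule.range_mkQ]
  have : ∀ b, ∃ y ∈ J • (⊤ : Submodule R M), (t • (⊤ : Submodule R M)).mkQ y = f b := fun b => by
    have := hf b
    rwa [← h] at this
  choose g hg hgf using this
  exact ⟨g, hg, funext hgf⟩

/-- Induction on s, with J the tail ideal. If r_0 m lies in J^(s+1) M, write r_0 m = d f with f over
J^s M. Modulo r_0 this f is a cycle, so f - d g = r_0 p for some g over J^(s-1) M, and the induction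
hypothesis moves p into J^s M. Applying d and cancelling r_0 gives m = d p, which lies in J^(s+1) M.
-/
theorem mem_pow_tail_of_smul_mem (ht : IsSMulRegular M (r 0))
    (hs : StrictlyAcyclic (QuotSMulTop (r 0) M) (Fin.tail r)) (s : ℕ) (m : M)
    (hm : r 0 • m ∈ seqIdeal (Fin.tail r) ^ s • (⊤ : Submodule R M)) :
    m ∈ seqIdeal (Fin.tail r) ^ s • (⊤ : Submodule R M) := by
  induction s generalizing m with
  | zero => simp
  | succ s ih =>
    rw [pow_succ', mul_smul] at hm
    obtain ⟨f, hf, hf₀, hd⟩ := exists_coordDiff_eq _ _ _ hm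
    have hd' : coordDiff (QuotSMulTop (r 0) M) (Fin.tail r)
        (fun b => (r 0 • (⊤ : Submodule R M)).mkQ (f b)) = 0 := by
      funext b
      rw [coordDiff_map, hd, Pi.zero_apply, mkQ_eq_zero_iff]
      exact ⟨(Pi.single (fun _ => false) m : (Fin n → Bool) → M) b, by
        rw [Pi.single_apply, Pi.single_apply]; split_ifs <;> simp⟩
    obtain ⟨g', hg', hgs'⟩ := hs s _ hd' (by rw [hf₀, map_zero]) (fun b => by
      have := Submodule.mem_map_of_mem (f := (r 0 • (⊤ : Submodule R M)).mkQ) (hf b)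
      rwa [Submodule.map_smul'', Submodule.map_top, Submodule.range_mkQ] at this)
    obtain ⟨g, hgs, rfl⟩ := exists_lift_coord _ _ g' hgs'
    have : ∀ b, ∃ p, r 0 • p = f b - coordDiff M (Fin.tail r) g b := fun b => by
      rw [← mkQ_eq_zero_iff, map_sub, ← coordDiff_map, sub_eq_zero]
      exact (congrFun hg' b).symm
    choose p hp using this
    have hps : ∀ b, p b ∈ seqIdeal (Fin.tail r) ^ s • (⊤ : Submodule R M) := fun b => by
      apply ih
      rw [hp]
      refine Submodule.sub_mem _ (hf b) ?_
      have := coordDiff_mem (Fin.tail r) _ _ hgs b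
      rw [← mul_smul, ← pow_succ'] at this
      -- The exponent here is (s - 1) + 1 with truncated subtraction; it is at least s even for s =
      -- 0, and the inclusion is enough.
      exact Submodule.smul_mono_left (Ideal.pow_le_pow_right (by omega)) this
    have e : r 0 • coordDiff M (Fin.tail r) p = Pi.single (fun _ => false) (r 0 • m) := by
      have : r 0 • p = f - coordDiff M (Fin.tail r) g := funext hp
      rw [← map_smul, this, map_sub, coordDiff_comp_coordDiff, sub_zero, hd]
    have e' : m = coordDiff M (Fin.tail r) p (fun _ => false) := by
      apply ht
      have := congrFun e fun _ => false
      simpa using this.symm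
    rw [e', pow_succ', mul_smul]
    exact coordDiff_mem _ _ _ hps _

/-- For s > 0 write r_0 m = r_0 y + z with y in I^(s-1) M and z in J^s M, J being the tail ideal.
Then r_0 (m - y) = z, and `mem_pow_tail_of_smul_mem` puts m - y in J^s M. One power is lost only
because r_0 itself belongs to I. -/
theorem mem_pow_of_smul_mem (ht : IsSMulRegular M (r 0))
    (hs : StrictlyAcyclic (QuotSMulTop (r 0) M) (Fin.tail r)) (s : ℕ) (m : M)
    (hm : r 0 • m ∈ seqIdeal r ^ s • (⊤ : Submodule R M)) :
    m ∈ seqIdeal r ^ (s - 1) • (⊤ : Submodule R M) := by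
  rcases s with _ | s
  · simp
  · have h := Submodule.smul_mono_left (N := (⊤ : Submodule R M))
      (sup_pow_succ_le (Ideal.span {r 0}) (seqIdeal (Fin.tail r)) s)
    rw [← seqIdeal_succ] at h
    have h := h hm
    rw [Submodule.sup_smul, mul_smul, Submodule.ideal_span_singleton_smul] at h
    obtain ⟨y, hy, z, hz, hyz⟩ := Submodule.mem_sup.1 h
    obtain ⟨y, hy', rfl⟩ := (Submodule.mem_smul_pointwise_iff_exists _ _ _).1 hy
    have h₁ : r 0 • (m - y) ∈ seqIdeal (Fin.tail r) ^ (s + 1) • (⊤ : Submodule R M) := by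
      rwa [smul_sub, ← hyz, add_sub_cancel_left]
    have h₂ := mem_pow_tail_of_smul_mem ht hs _ _ h₁
    have h₃ : m - y ∈ seqIdeal r ^ s • (⊤ : Submodule R M) :=
      Submodule.smul_mono_left ((Ideal.pow_right_mono (seqIdeal_tail_le r) _).trans
        (Ideal.pow_le_pow_right (by omega))) h₂
    have := Submodule.add_mem _ h₃ hy'
    rwa [sub_add_cancel] at this

/-- Write the cycle as u + e_0 v, so d' u + r_0 v = 0 and d' v = 0. Modulo r_0 the part u is a cycle
of the tail complex, hence a boundary there; lifting gives u = d' w + r_0 p with w under control.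
Since r_0 p lies in I^s M, `mem_pow_of_smul_mem` controls p as well. -/
theorem StrictlyAcyclic.of_tail (ht : IsSMulRegular M (r 0))
    (hs : StrictlyAcyclic (QuotSMulTop (r 0) M) (Fin.tail r)) : StrictlyAcyclic M r := by
  intro s f hf hf₀ hfs
  have hu := fun β => coordDiff_false r f β
  have hv := fun β => coordDiff_true r f β
  simp only [hf, Pi.zero_apply] at hu hv
  set u : (Fin n → Bool) → M := fun β => f (Fin.cons false β) with hudef
  set v : (Fin n → Bool) → M := fun β => f (Fin.cons true β) with hvdef
  obtain ⟨w', hw', hws'⟩ := hs s (fun β => (r 0 • (⊤ : Submodule R M)).mkQ (u β))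
    (funext fun β => by
      rw [coordDiff_map, Pi.zero_apply, mkQ_eq_zero_iff]
      exact ⟨-v β, by rw [smul_neg, eq_comm, eq_neg_iff_add_eq_zero]; exact (hu β).symm⟩)
    (by rw [hudef]; simp only; rw [← const_false_succ, hf₀, map_zero])
    (fun β => mkQ_mem_pow_tail s _ (hfs _))
  obtain ⟨w, hws, rfl⟩ := exists_lift_coord _ _ w' hws'
  have : ∀ β, ∃ p, r 0 • p = u β - coordDiff M (Fin.tail r) w β := fun β => by
    rw [← mkQ_eq_zero_iff, map_sub, ← coordDiff_map, sub_eq_zero]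
    exact (congrFun hw' β).symm
  choose p hp using this
  have hws₁ : ∀ b, w b ∈ seqIdeal r ^ (s - 1) • (⊤ : Submodule R M) := fun b =>
    Submodule.smul_mono_left (Ideal.pow_right_mono (seqIdeal_tail_le r) _) (hws b)
  have hps : ∀ b, p b ∈ seqIdeal r ^ (s - 1) • (⊤ : Submodule R M) := fun b => by
    apply mem_pow_of_smul_mem ht hs
    rw [hp]
    refine Submodule.sub_mem _ (hfs _) ?_
    have := coordDiff_mem (Fin.tail r) _ _ hws₁ b
    have := Submodule.smul_mono_left (seqIdeal_tail_le r) this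
    rw [← mul_smul, ← pow_succ'] at this
    exact Submodule.smul_mono_left (Ideal.pow_le_pow_right (by omega)) this
  -- The preimage is w + e_0 p. Its e_0-free part is right by the choice of p; for the other part,
  -- -d' p = v holds after multiplication by r_0, which can be cancelled.
  refine ⟨fun b => bif b 0 then p (Fin.tail b) else w (Fin.tail b),
    funext_cons (fun β => ?_) (fun β => ?_), fun b => ?_⟩
  · rw [coordDiff_false]
    simp only [Fin.cons_zero, Fin.tail_cons, cond_false, cond_true]
    rw [hp, add_sub_cancel]
  · rw [coordDiff_true]
    simp only [Fin.cons_zero, Fin.tail_cons, cond_true]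
    apply ht
    have e : r 0 • p = u - coordDiff M (Fin.tail r) w := funext hp
    have e' := congrFun (congrArg (coordDiff M (Fin.tail r)) e) β
    rw [map_smul, map_sub, coordDiff_comp_coordDiff, sub_zero, Pi.smul_apply] at e'
    change r 0 • -coordDiff M (Fin.tail r) p β = r 0 • v β
    rw [smul_neg, e', neg_eq_iff_add_eq_zero]
    exact (hu β).symm
  · obtain ⟨c, β, rfl⟩ : ∃ c β, b = Fin.cons c β := ⟨b 0, Fin.tail b, by simp⟩
    cases c
    exacts [hws₁ _, hps _]

end FirstElement

-- The module M has to vary in the induction, because each step replaces it by M/r_0 M. For n = 0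
-- only the empty index exists, and there f vanishes by assumption.
open RingTheory.Sequence in
theorem strictlyAcyclic {n : ℕ} (r : Fin n → R) (hr : IsWeaklyRegular M (List.ofFn r)) :
    StrictlyAcyclic M r := by
  induction n generalizing M with
  | zero =>
    intro s f _ hf₀ _
    refine ⟨0, funext fun b => ?_, fun b => Submodule.zero_mem _⟩
    rw [Subsingleton.elim b fun _ => false, hf₀, map_zero, Pi.zero_apply]
  | succ n ih =>
    rw [List.ofFn_succ, isWeaklyRegular_cons_iff] at hr
    exact StrictlyAcyclic.of_tail hr.1 (ih (Fin.tail r) hr.2)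

/-! ### Regular sequences are quasi-regular -/

/-- The value at `r` of the part of degree `s` of the polynomial with coefficients `c`. -/
def homogeneousEval : ∀ {n : ℕ} (_ : Fin n → R) (_ : ℕ), ((Fin n → ℕ) → M) →ₗ[R] M
  | 0, _, s => if s = 0 then LinearMap.proj Fin.elim0 else 0
  | _ + 1, r, s => ∑ ij ∈ Finset.HasAntidiagonal.antidiagonal s, r 0 ^ ij.1 •
      (homogeneousEval (Fin.tail r) ij.2).comp
        (LinearMap.funLeft R M fun β => (Fin.cons ij.1 β : Fin (_ + 1) → ℕ))

theorem homogeneousEval_zero_succ {n : ℕ} (r : Fin (n + 1) → R) (c : (Fin (n + 1) → ℕ) → M) :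
    homogeneousEval r 0 c = homogeneousEval (Fin.tail r) 0 (fun β => c (Fin.cons 0 β)) := by
  simp [homogeneousEval]
  rfl

/-- The monomials free of the first variable are separated from those divisible by it; dividing the
latter by the variable lowers the degree, which drives the induction on s. -/
theorem homogeneousEval_succ_succ {n : ℕ} (r : Fin (n + 1) → R) (s : ℕ)
    (c : (Fin (n + 1) → ℕ) → M) :
    homogeneousEval r (s + 1) c =
      homogeneousEval (Fin.tail r) (s + 1) (fun β => c (Fin.cons 0 β)) +
        r 0 • homogeneousEval r s (fun α => c (Fin.cons (α 0 + 1) (Fin.tail α))) := by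
  simp only [homogeneousEval, LinearMap.sum_apply, Finset.Nat.sum_antidiagonal_succ]
  rw [Finset.smul_sum]
  refine congrArg₂ (fun x y : M => x + y) ?_ ?_
  · rw [LinearMap.smul_apply, pow_zero, one_smul]
    rfl
  · rw [LinearMap.sum_apply]
    refine Finset.sum_congr rfl fun ij _ => ?_
    rw [LinearMap.smul_apply, LinearMap.smul_apply, smul_smul, ← pow_succ']
    rfl

theorem homogeneousEval_mem {n : ℕ} (r : Fin n → R) (s : ℕ) (N : Submodule R M)
    (c : (Fin n → ℕ) → M) (hc : ∀ α, ∑ i, α i = s → c α ∈ N) :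
    homogeneousEval r s c ∈ seqIdeal r ^ s • N := by
  induction n generalizing s with
  | zero =>
    rw [homogeneousEval]
    split_ifs with h
    · subst h
      rw [pow_zero, Ideal.one_eq_top, Submodule.top_smul]
      exact hc _ (by simp)
    · simp
  | succ n ih =>
    induction s generalizing c with
    | zero =>
      rw [homogeneousEval_zero_succ]
      have := ih (Fin.tail r) 0 (fun β => c (Fin.cons 0 β)) fun α hα => hc _ (by
        rw [Fin.sum_univ_succ]; simpa using hα)
      simpa using this
    | succ s ihs =>
      rw [homogeneousEval_succ_succ]
      refine Submodule.add_mem _ (Submodule.smul_mono_left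
        (Ideal.pow_right_mono (seqIdeal_tail_le r) _) (ih _ _ _ fun α hα => hc _ (by
        rw [Fin.sum_univ_succ]; simpa using hα))) ?_
      rw [pow_succ', mul_smul]
      exact Submodule.smul_mem_smul (mem_seqIdeal r 0) (ihs _ fun α hα => hc _ (by
        rw [Fin.sum_univ_succ] at hα ⊢
        simp only [Fin.cons_zero, Fin.cons_succ, Fin.tail]
        omega))

theorem homogeneousEval_map {N : Type*} [AddCommGroup N] [Module R N] (g : M →ₗ[R] N) {n : ℕ}
    (r : Fin n → R) (s : ℕ) (c : (Fin n → ℕ) → M) :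
    homogeneousEval r s (fun α => g (c α)) = g (homogeneousEval r s c) := by
  induction n generalizing s with
  | zero =>
    rw [homogeneousEval, homogeneousEval]
    split_ifs
    · rfl
    · simp
  | succ n ih =>
    simp only [homogeneousEval, LinearMap.sum_apply, map_sum, LinearMap.smul_apply, map_smul]
    refine Finset.sum_congr rfl fun ij _ => congrArg _ ?_
    exact ih (Fin.tail r) ij.2 fun β => c (Fin.cons ij.1 β)

-- Double induction on n and s. Modulo r_0 only the monomials without the first variable survive,
-- and induction on n puts their coefficients in I M. The part they form then lies in I^(s+1) M and
-- can be subtracted; what remains is r_0 times a form of lower degree.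
open RingTheory.Sequence in
theorem mem_smul_top_of_homogeneousEval_mem {n : ℕ} (r : Fin n → R)
    (hr : IsWeaklyRegular M (List.ofFn r)) (s : ℕ) (c : (Fin n → ℕ) → M)
    (h : homogeneousEval r s c ∈ seqIdeal r ^ (s + 1) • (⊤ : Submodule R M))
    (α : Fin n → ℕ) (hα : ∑ i, α i = s) : c α ∈ seqIdeal r • (⊤ : Submodule R M) := by
  induction n generalizing M s with
  | zero =>
    obtain rfl : s = 0 := by simpa using hα.symm
    rw [homogeneousEval, if_pos rfl, zero_add, pow_one] at h
    rwa [Subsingleton.elim α Fin.elim0]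
  | succ n ih =>
    have hr' := hr
    rw [List.ofFn_succ, isWeaklyRegular_cons_iff] at hr'
    -- Stated for all s and c, since the induction on s changes both. G is the part free of the
    -- first variable; knowing that its coefficients lie in I M puts it in I^s · I M.
    have key : ∀ (s : ℕ) (c : (Fin (n + 1) → ℕ) → M),
        homogeneousEval r s c ∈ seqIdeal r ^ (s + 1) • (⊤ : Submodule R M) →
        ∃ G ∈ seqIdeal r ^ (s + 1) • (⊤ : Submodule R M),
          G = homogeneousEval (Fin.tail r) s (fun β => c (Fin.cons 0 β)) ∧
        ∀ β, ∑ i, β i = s → c (Fin.cons 0 β) ∈ seqIdeal r • (⊤ : Submodule R M) := by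
      intro s c h
      have e : (r 0 • (⊤ : Submodule R M)).mkQ (homogeneousEval r s c) =
          homogeneousEval (Fin.tail r) s
            (fun β => (r 0 • (⊤ : Submodule R M)).mkQ (c (Fin.cons 0 β))) := by
        rw [homogeneousEval_map]
        rcases s with _ | s
        · rw [homogeneousEval_zero_succ]
        · rw [homogeneousEval_succ_succ, map_add, add_eq_left, mkQ_eq_zero_iff]
          exact ⟨_, rfl⟩
      have h₁ : ∀ β, ∑ i, β i = s → c (Fin.cons 0 β) ∈ seqIdeal r • (⊤ : Submodule R M) := by
        intro β hβ
        have := ih (M := QuotSMulTop (r 0) M) (Fin.tail r) hr'.2 s _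
          (e ▸ mkQ_mem_pow_tail (s + 1) _ h) β hβ
        obtain ⟨y, hy, z, hz⟩ := mkQ_mem_smul_top _ _ _ this
        rw [hz]
        exact Submodule.add_mem _ (Submodule.smul_mono_left (seqIdeal_tail_le r) hy)
          (Submodule.smul_mem_smul (mem_seqIdeal r 0) trivial)
      refine ⟨_, ?_, rfl, h₁⟩
      rw [pow_succ, mul_smul]
      exact Submodule.smul_mono_left (Ideal.pow_right_mono (seqIdeal_tail_le r) _)
        (homogeneousEval_mem (Fin.tail r) s _ _ h₁)
    induction s generalizing c α with
    | zero =>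
      obtain ⟨-, -, -, h₁⟩ := key 0 c h
      have hz : ∀ i, α i = 0 := by simpa using hα
      have : α = Fin.cons 0 (Fin.tail α) := by rw [← hz 0, Fin.cons_self_tail]
      rw [this]
      exact h₁ _ (by simp [Fin.tail, hz])
    | succ s ihs =>
      obtain ⟨G, hG, hGe, h₁⟩ := key (s + 1) c h
      obtain ⟨a, β, rfl⟩ : ∃ a β, α = Fin.cons a β := ⟨α 0, Fin.tail α, by simp⟩
      rw [Fin.sum_univ_succ] at hα
      simp only [Fin.cons_zero, Fin.cons_succ] at hα
      rcases a with _ | a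
      · exact h₁ _ (by omega)
      · rw [homogeneousEval_succ_succ, ← hGe] at h
        have h₂ := (Submodule.add_mem_iff_right _ hG).1 h
        -- Cancelling r_0 costs one power of I, which is exactly the drop in degree of the remaining
        -- form.
        have h₃ := mem_pow_of_smul_mem hr'.1 (strictlyAcyclic _ hr'.2) _ _ h₂
        have := ihs _ h₃ (Fin.cons a β) (by
          rw [Fin.sum_univ_succ]
          simp only [Fin.cons_zero, Fin.cons_succ]
          omega)
        simpa using this

end Coordinates
/-! ### The Koszul differential on the exterior algebra -/

section Exterior

variable {R : Type u} [CommRing R]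

/-- The exterior algebra on `e_1, …, e_n`. -/
abbrev Ext (R : Type u) [CommRing R] (n : ℕ) : Type u := ExteriorAlgebra R (Fin n → R)

/-- Contraction with a linear form. -/
def contr {V : Type*} [AddCommGroup V] [Module R V] (δ : Module.Dual R V) :
    ExteriorAlgebra R V →ₗ[R] ExteriorAlgebra R V :=
  CliffordAlgebra.contractLeft (Q := (0 : QuadraticForm R V)) δ

theorem contr_ι_mul {V : Type*} [AddCommGroup V] [Module R V] (δ : Module.Dual R V) (v : V)
    (x : ExteriorAlgebra R V) : contr δ (ExteriorAlgebra.ι R v * x) =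
      δ v • x - ExteriorAlgebra.ι R v * contr δ x :=
  CliffordAlgebra.contractLeft_ι_mul (Q := (0 : QuadraticForm R V)) (d := δ) v x

theorem contr_algebraMap {V : Type*} [AddCommGroup V] [Module R V] (δ : Module.Dual R V) (c : R) :
    contr δ (algebraMap R (ExteriorAlgebra R V) c) = 0 :=
  CliffordAlgebra.contractLeft_algebraMap (Q := (0 : QuadraticForm R V)) (d := δ) c

theorem exterior_induction {V : Type*} [AddCommGroup V] [Module R V]
    {P : ExteriorAlgebra R V → Prop} (algebraMap : ∀ c : R, P (algebraMap R _ c))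
    (add : ∀ x y, P x → P y → P (x + y)) (ι_mul : ∀ x v, P x → P (ExteriorAlgebra.ι R v * x))
    (x : ExteriorAlgebra R V) : P x :=
  CliffordAlgebra.left_induction (Q := (0 : QuadraticForm R V)) algebraMap add ι_mul x

theorem contr_map {V W : Type*} [AddCommGroup V] [Module R V] [AddCommGroup W] [Module R W]
    (f : V →ₗ[R] W) (δ : Module.Dual R W) (x : ExteriorAlgebra R V) :
    contr δ (ExteriorAlgebra.map f x) = ExteriorAlgebra.map f (contr (δ.comp f) x) := by
  induction x using exterior_induction with
  | algebraMap c => rw [AlgHom.commutes, contr_algebraMap, contr_algebraMap, map_zero]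
  | add x y hx hy => simp only [map_add, hx, hy]
  | ι_mul x v h =>
    rw [map_mul, ExteriorAlgebra.map_apply_ι, contr_ι_mul, h, contr_ι_mul, map_sub, map_smul,
      map_mul, ExteriorAlgebra.map_apply_ι, LinearMap.comp_apply]

theorem contr_zero {V : Type*} [AddCommGroup V] [Module R V] (x : ExteriorAlgebra R V) :
    contr (0 : Module.Dual R V) x = 0 := by
  rw [contr, map_zero, LinearMap.zero_apply]

/-- `∧ R^n ⟶ ∧ R^{n+1}`, `e_i ↦ e_{i+1}`. -/
def extShift (R : Type u) [CommRing R] (n : ℕ) : Ext R n →ₐ[R] Ext R (n + 1) :=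
  ExteriorAlgebra.map (LinearMap.vecCons 0 LinearMap.id)

/-- The element of the exterior algebra with the given coordinates. -/
def ofCoord : ∀ n : ℕ, ((Fin n → Bool) → R) →ₗ[R] Ext R n
  | 0 => (Algebra.linearMap R (Ext R 0)).comp (LinearMap.proj fun _ => false)
  | n + 1 => (extShift R n).toLinearMap.comp
      ((ofCoord n).comp (LinearMap.funLeft R R fun β => (Fin.cons false β : Fin (n + 1) → Bool))) +
    (LinearMap.mulLeft R (ExteriorAlgebra.ι R (Pi.single 0 1))).comp ((extShift R n).toLinearMap.comp
      ((ofCoord n).comp (LinearMap.funLeft R R fun β => (Fin.cons true β : Fin (n + 1) → Bool))))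

theorem ofCoord_succ (n : ℕ) (f : (Fin (n + 1) → Bool) → R) : ofCoord (n + 1) f =
    extShift R n (ofCoord n fun β => f (Fin.cons false β)) +
      ExteriorAlgebra.ι R (Pi.single 0 1) *
        extShift R n (ofCoord n fun β => f (Fin.cons true β)) := rfl

theorem contr_extShift {n : ℕ} (δ : Module.Dual R (Fin (n + 1) → R)) (x : Ext R n) :
    contr δ (extShift R n x) =
      extShift R n (contr (δ.comp (LinearMap.vecCons 0 LinearMap.id)) x) :=
  contr_map _ _ _

theorem extShift_injective (n : ℕ) : Function.Injective (extShift R n) := by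
  have : Function.LeftInverse (ExteriorAlgebra.map (LinearMap.funLeft R R Fin.succ))
      (extShift R n) := by
    intro x
    rw [extShift, ← AlgHom.comp_apply, ExteriorAlgebra.map_comp_map]
    have h : (LinearMap.funLeft R R Fin.succ).comp
        (LinearMap.vecCons 0 LinearMap.id : (Fin n → R) →ₗ[R] (Fin (n + 1) → R)) = LinearMap.id := by
      ext v i
      simp [LinearMap.funLeft]
    rw [h, ExteriorAlgebra.map_id, AlgHom.id_apply]
  exact this.injective

/-- The Koszul differential. -/
def koszulD {n : ℕ} (r : Fin n → R) : Ext R n →ₗ[R] Ext R n :=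
  contr (Fintype.linearCombination R r)

/-- Contraction satisfies d(e_0 x) = r_0 x - e_0 d x, which is the recursion defining `coordDiff`.
Strict acyclicity is carried from coordinates to the exterior algebra along this identity. -/
theorem koszulD_ofCoord {n : ℕ} (r : Fin n → R) (f : (Fin n → Bool) → R) :
    koszulD r (ofCoord n f) = ofCoord n (coordDiff R r f) := by
  induction n with
  | zero =>
    change contr _ (algebraMap R _ _) = _
    rw [contr_algebraMap]
    simp [coordDiff]
  | succ n ih =>
    have hδ : (Fintype.linearCombination R r).comp (LinearMap.vecCons 0 LinearMap.id) =
        Fintype.linearCombination R (Fin.tail r) := by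
      ext i
      simp [Fintype.linearCombination_apply, Fin.sum_univ_succ, Fin.tail]
    have h₀ : (fun β => coordDiff R r f (Fin.cons false β)) =
        coordDiff R (Fin.tail r) (fun β => f (Fin.cons false β)) +
          r 0 • fun β => f (Fin.cons true β) :=
      funext fun β => coordDiff_false r f β
    have h₁ : (fun β => coordDiff R r f (Fin.cons true β)) =
        -coordDiff R (Fin.tail r) (fun β => f (Fin.cons true β)) :=
      funext fun β => coordDiff_true r f β
    have ih' := fun f => ih (Fin.tail r) f
    rw [koszulD] at ih' ⊢
    rw [ofCoord_succ, map_add, contr_ι_mul, contr_extShift, contr_extShift, hδ, ih', ih',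
      ofCoord_succ, h₀, h₁]
    simp [map_add, map_neg, map_smul, Fintype.linearCombination_apply, Fin.sum_univ_succ]
    abel

/-- Contraction with the first coordinate form kills everything in the image of `extShift`, so it
extracts b from a + e_0 b; after that a is visible too. -/
theorem ofCoord_injective (n : ℕ) : Function.Injective (ofCoord (R := R) n) := by
  rw [injective_iff_map_eq_zero]
  induction n with
  | zero =>
    intro f hf
    have hf : algebraMap R (Ext R 0) (f fun _ => false) = 0 := hf
    rw [map_eq_zero_iff _ (ExteriorAlgebra.algebraMap_leftInverse _).injective] at hf
    funext b
    rw [Subsingleton.elim b fun _ => false, hf, Pi.zero_apply]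
  | succ n ih =>
    intro f hf
    rw [ofCoord_succ] at hf
    have hδ : (LinearMap.proj 0 : Module.Dual R (Fin (n + 1) → R)).comp
        (LinearMap.vecCons 0 LinearMap.id) = 0 := by
      ext i
      simp
    have h := congrArg (contr (LinearMap.proj 0 : Module.Dual R (Fin (n + 1) → R))) hf
    rw [map_add, contr_ι_mul, contr_extShift, contr_extShift, hδ, contr_zero, contr_zero, map_zero,
      map_zero, mul_zero, zero_add, sub_zero, LinearMap.proj_apply, Pi.single_eq_same,
      one_smul, map_eq_zero_iff _ (extShift_injective n)] at h
    rw [h, map_zero, mul_zero, add_zero, map_eq_zero_iff _ (extShift_injective n)] at hf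
    exact funext_cons (congrFun (ih _ hf)) (congrFun (ih _ h))

theorem ofCoord_surjective (n : ℕ) : Function.Surjective (ofCoord (R := R) n) := by
  induction n with
  | zero =>
    intro x
    induction x using exterior_induction with
    | algebraMap c => exact ⟨fun _ => c, rfl⟩
    | add x y hx hy =>
      obtain ⟨f, rfl⟩ := hx
      obtain ⟨g, rfl⟩ := hy
      exact ⟨f + g, map_add _ _ _⟩
    | ι_mul x v _ =>
      rw [Subsingleton.elim v 0, map_zero, zero_mul]
      exact ⟨0, map_zero _⟩
  | succ n ih =>
    have key : ∀ a b : Ext R n, ∃ f, ofCoord (n + 1) f =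
        extShift R n a + ExteriorAlgebra.ι R (Pi.single 0 1) * extShift R n b := by
      intro a b
      obtain ⟨f, rfl⟩ := ih a
      obtain ⟨g, rfl⟩ := ih b
      refine ⟨fun b => bif b 0 then g (Fin.tail b) else f (Fin.tail b), ?_⟩
      rw [ofCoord_succ]
      simp
    intro x
    suffices h : ∃ a b, x = extShift R n a +
        ExteriorAlgebra.ι R (Pi.single 0 1) * extShift R n b by
      obtain ⟨a, b, rfl⟩ := h
      exact key a b
    induction x using exterior_induction with
    | algebraMap c => exact ⟨algebraMap R _ c, 0, by simp⟩
    | add x y hx hy =>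
      obtain ⟨a, b, rfl⟩ := hx
      obtain ⟨a', b', rfl⟩ := hy
      exact ⟨a + a', b + b', by simp only [map_add, mul_add]; abel⟩
    | ι_mul x v hx =>
      obtain ⟨a, b, rfl⟩ := hx
      have hv : v = v 0 • (Pi.single 0 1 : Fin (n + 1) → R) +
          (LinearMap.vecCons 0 LinearMap.id : (Fin n → R) →ₗ[R] (Fin (n + 1) → R)) (Fin.tail v) := by
        ext i
        refine Fin.cases ?_ (fun i => ?_) i <;> simp [Fin.tail]
      set w := Fin.tail v
      set e : Fin (n + 1) → R := Pi.single 0 1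
      have hw : ExteriorAlgebra.ι R
          ((LinearMap.vecCons 0 LinearMap.id : (Fin n → R) →ₗ[R] (Fin (n + 1) → R)) w) =
          extShift R n (ExteriorAlgebra.ι R w) := by
        rw [extShift, ExteriorAlgebra.map_apply_ι]
      have hanti : extShift R n (ExteriorAlgebra.ι R w) * ExteriorAlgebra.ι R e =
          -(ExteriorAlgebra.ι R e * extShift R n (ExteriorAlgebra.ι R w)) := by
        rw [← hw, eq_neg_iff_add_eq_zero]
        exact ExteriorAlgebra.ι_add_mul_swap _ _
      -- Multiply out (v_0 e_0 + w)(a + e_0 b) using e_0² = 0 and w e_0 = -e_0 w.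
      refine ⟨ExteriorAlgebra.ι R w * a, v 0 • a - ExteriorAlgebra.ι R w * b, ?_⟩
      rw [hv, map_add, map_smul, hw, ← hv]
      simp only [map_mul, map_sub, map_smul, mul_add, add_mul, mul_sub]
      rw [← mul_assoc (extShift R n (ExteriorAlgebra.ι R w)) (ExteriorAlgebra.ι R e), hanti,
        smul_mul_assoc, smul_mul_assoc, ← mul_assoc (ExteriorAlgebra.ι R e) (ExteriorAlgebra.ι R e),
        ExteriorAlgebra.ι_sq_zero]
      simp [mul_assoc]
      abel

/-- The coordinates on the exterior algebra. -/
noncomputable def coordEquiv (R : Type u) [CommRing R] (n : ℕ) :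
    ((Fin n → Bool) → R) ≃ₗ[R] Ext R n :=
  LinearEquiv.ofBijective (ofCoord n) ⟨ofCoord_injective n, ofCoord_surjective n⟩

/-- Replaces the coordinatewise filtration by the basis-free submodule J • ⊤, the form needed for
tensor products with J. -/
theorem coord_mem_iff {n : ℕ} (J : Ideal R) (f : (Fin n → Bool) → R) :
    (∀ b, f b ∈ J) ↔ ofCoord n f ∈ J • (⊤ : Submodule R (Ext R n)) := by
  constructor
  · intro hf
    have : f = ∑ b, f b • (Pi.single b 1 : (Fin n → Bool) → R) := by
      ext b
      simp [Finset.sum_apply, Pi.single_apply]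
    rw [this, map_sum]
    exact Submodule.sum_mem _ fun b _ => by
      rw [map_smul]
      exact Submodule.smul_mem_smul (hf b) trivial
  · intro h b
    have h₁ := Submodule.mem_map_of_mem
      (f := (LinearMap.proj b).comp (coordEquiv R n).symm.toLinearMap) h
    rw [Submodule.map_smul''] at h₁
    have h₂ := Submodule.smul_mono le_rfl (le_top (a := Submodule.map
      ((LinearMap.proj b).comp (coordEquiv R n).symm.toLinearMap) ⊤)) h₁
    rw [smul_eq_mul, Ideal.mul_top] at h₂
    have e : (coordEquiv R n).symm (ofCoord n f) = f := (coordEquiv R n).symm_apply_apply f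
    rw [LinearMap.comp_apply, LinearEquiv.coe_coe, e] at h₂
    exact h₂

theorem algebraMapInv_map {V W : Type*} [AddCommGroup V] [Module R V] [AddCommGroup W]
    [Module R W] (f : V →ₗ[R] W) (x : ExteriorAlgebra R V) :
    ExteriorAlgebra.algebraMapInv (ExteriorAlgebra.map f x) = ExteriorAlgebra.algebraMapInv x := by
  induction x using exterior_induction with
  | algebraMap c => rw [AlgHom.commutes, AlgHom.commutes, AlgHom.commutes]
  | add x y hx hy => simp only [map_add, hx, hy]
  | ι_mul x v h =>
    rw [map_mul, map_mul, map_mul, ExteriorAlgebra.map_apply_ι]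
    simp [ExteriorAlgebra.algebraMapInv]

/-- Identifies the coordinate at the empty index with the scalar part. An element of positive degree
therefore satisfies the condition on that coordinate in `StrictlyAcyclic`. -/
theorem algebraMapInv_ofCoord (n : ℕ) (f : (Fin n → Bool) → R) :
    ExteriorAlgebra.algebraMapInv (ofCoord n f) = f fun _ => false := by
  induction n with
  | zero => exact ExteriorAlgebra.algebraMap_leftInverse (Fin 0 → R) _
  | succ n ih =>
    rw [ofCoord_succ, map_add, map_mul, extShift, algebraMapInv_map, ih]
    rw [← const_false_succ]
    simp [ExteriorAlgebra.algebraMapInv]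

/-! ### Degrees in the exterior algebra and strict exactness -/

theorem algebraMapInv_eq_zero {n k : ℕ} (x : Ext R n) (hx : x ∈ ⋀[R]^(k + 1) (Fin n → R)) :
    ExteriorAlgebra.algebraMapInv x = 0 := by
  change x ∈ LinearMap.range (ExteriorAlgebra.ι R) ^ (k + 1) at hx
  rw [pow_succ'] at hx
  induction hx using Submodule.mul_induction_on' with
  | mem_mul_mem m hm y hy =>
    obtain ⟨v, rfl⟩ := hm
    simp [ExteriorAlgebra.algebraMapInv]
  | add x _ y _ hx hy => rw [map_add, hx, hy, add_zero]

theorem koszulD_mem {n k : ℕ} (r : Fin n → R) {x : Ext R n} (hx : x ∈ ⋀[R]^(k + 1) (Fin n → R)) :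
    koszulD r x ∈ ⋀[R]^k (Fin n → R) :=
  contractLeft_mem n _ k x hx

theorem koszulD_eq_zero {n : ℕ} (r : Fin n → R) {x : Ext R n} (hx : x ∈ ⋀[R]^0 (Fin n → R)) :
    koszulD r x = 0 := by
  change x ∈ LinearMap.range (ExteriorAlgebra.ι R) ^ 0 at hx
  rw [pow_zero, Submodule.mem_one] at hx
  obtain ⟨c, rfl⟩ := hx
  exact contr_algebraMap _ _

theorem koszulD_koszulD {n : ℕ} (r : Fin n → R) (x : Ext R n) : koszulD r (koszulD r x) = 0 :=
  CliffordAlgebra.contractLeft_contractLeft _ _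

/-- The projection onto the part of degree `k`. -/
noncomputable def extProj (R : Type u) [CommRing R] (n k : ℕ) : Ext R n →ₗ[R] Ext R n :=
  GradedAlgebra.proj (fun k => ⋀[R]^k (Fin n → R)) k

theorem extProj_mem {n : ℕ} (k : ℕ) (x : Ext R n) : extProj R n k x ∈ ⋀[R]^k (Fin n → R) :=
  Subtype.property _

theorem extProj_of_mem {n k : ℕ} {x : Ext R n} (hx : x ∈ ⋀[R]^k (Fin n → R)) :
    extProj R n k x = x :=
  DirectSum.decompose_of_mem_same (fun k => ⋀[R]^k (Fin n → R)) hx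

theorem extProj_of_mem_ne {n k l : ℕ} {x : Ext R n} (hx : x ∈ ⋀[R]^k (Fin n → R)) (h : k ≠ l) :
    extProj R n l x = 0 :=
  DirectSum.decompose_of_mem_ne (fun k => ⋀[R]^k (Fin n → R)) hx h

/-- Since d lowers degree by one, any preimage of a homogeneous boundary can be replaced by its
component of the right degree. -/
theorem koszulD_extProj {n : ℕ} (r : Fin n → R) (k : ℕ) (x : Ext R n) :
    koszulD r (extProj R n (k + 1) x) = extProj R n k (koszulD r x) := by
  induction x using DirectSum.Decomposition.inductionOn (fun k => ⋀[R]^k (Fin n → R)) with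
  | zero => simp
  | add x y hx hy => simp only [map_add, hx, hy]
  | @homogeneous i x =>
    by_cases h : i = k + 1
    · subst h
      rw [extProj_of_mem x.2, extProj_of_mem (koszulD_mem r x.2)]
    · rw [extProj_of_mem_ne x.2 h, map_zero]
      rcases i with _ | i
      · rw [koszulD_eq_zero r x.2, map_zero]
      · rw [extProj_of_mem_ne (koszulD_mem r x.2) (by omega)]

theorem map_mem_smul_top {V W : Type*} [AddCommGroup V] [Module R V] [AddCommGroup W] [Module R W]
    (f : V →ₗ[R] W) (J : Ideal R) {x : V} (hx : x ∈ J • (⊤ : Submodule R V)) :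
    f x ∈ J • (⊤ : Submodule R W) := by
  have := Submodule.mem_map_of_mem (f := f) hx
  rw [Submodule.map_smul''] at this
  exact Submodule.smul_mono le_rfl le_top this

theorem koszulD_mem_smul {n : ℕ} (r : Fin n → R) {J : Ideal R} {x : Ext R n}
    (hx : x ∈ J • (⊤ : Submodule R (Ext R n))) :
    koszulD r x ∈ (seqIdeal r * J) • (⊤ : Submodule R (Ext R n)) := by
  obtain ⟨f, rfl⟩ := ofCoord_surjective n x
  rw [koszulD_ofCoord, ← coord_mem_iff]
  exact coordDiff_mem r J f ((coord_mem_iff J f).2 hx)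

/-- For k > 0 this is `strictlyAcyclic` in coordinates. For k = 0 every element is a cycle, and a
scalar in I^s with s > 0 is a combination of the r_i with coefficients in I^(s-1). The excluded case
s = k = 0 is the homology R/I. The preimage is made homogeneous by projection, which preserves J •
⊤. -/
theorem exists_koszulD_eq {n : ℕ} (r : Fin n → R)
    (hr : RingTheory.Sequence.IsWeaklyRegular R (List.ofFn r)) (s k : ℕ) (hsk : s ≠ 0 ∨ k ≠ 0)
    {z : Ext R n} (hz : z ∈ ⋀[R]^k (Fin n → R)) (hd : koszulD r z = 0)
    (hs : z ∈ seqIdeal r ^ s • (⊤ : Submodule R (Ext R n))) :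
    ∃ y ∈ ⋀[R]^(k + 1) (Fin n → R), y ∈ seqIdeal r ^ (s - 1) • (⊤ : Submodule R (Ext R n)) ∧
      koszulD r y = z := by
  suffices h : ∃ y ∈ seqIdeal r ^ (s - 1) • (⊤ : Submodule R (Ext R n)), koszulD r y = z by
    obtain ⟨y, hy, hyz⟩ := h
    refine ⟨extProj R n (k + 1) y, extProj_mem _ _, map_mem_smul_top _ _ hy, ?_⟩
    rw [koszulD_extProj, hyz, extProj_of_mem hz]
  rcases k with _ | k
  · obtain ⟨s, rfl⟩ : ∃ t, s = t + 1 := ⟨s - 1, by omega⟩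
    have hz' := hz
    change z ∈ LinearMap.range (ExteriorAlgebra.ι R) ^ 0 at hz'
    rw [pow_zero, Submodule.mem_one] at hz'
    obtain ⟨c, rfl⟩ := hz'
    have hc : c ∈ seqIdeal r ^ (s + 1) := by
      have := map_mem_smul_top (ExteriorAlgebra.algebraMapInv : Ext R n →ₐ[R] R).toLinearMap _ hs
      rw [smul_eq_mul, Ideal.mul_top] at this
      have e : ExteriorAlgebra.algebraMapInv (algebraMap R (Ext R n) c) = c :=
        ExteriorAlgebra.algebraMap_leftInverse _ c
      rw [AlgHom.toLinearMap_apply, e] at this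
      exact this
    rw [pow_succ', ← smul_eq_mul] at hc
    obtain ⟨f, hf, -, hd⟩ := exists_coordDiff_eq r _ c hc
    refine ⟨ofCoord n f, (coord_mem_iff _ f).1 hf, ?_⟩
    rw [koszulD_ofCoord, hd]
    -- What is left is independent of the ideal: coordinates concentrated at the empty index
    -- represent the scalar c.
    clear * -
    induction n with
    | zero => 
      change algebraMap R (Ext R 0) _ = _
      simp
    | succ n ih =>
      rw [ofCoord_succ, funext (single_cons_false c), funext (single_cons_true c), ih]
      refine (congrArg _ (congrArg _ (congrArg _ (map_zero (ofCoord n))))).trans ?_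
      simp
  · obtain ⟨f, rfl⟩ := ofCoord_surjective n z
    rw [koszulD_ofCoord, map_eq_zero_iff _ (ofCoord_injective n)] at hd
    obtain ⟨g, hg, hgs⟩ := strictlyAcyclic r hr s f hd
      ((algebraMapInv_ofCoord n f).symm.trans (algebraMapInv_eq_zero _ hz))
      (by simpa using (coord_mem_iff _ f).2 hs)
    exact ⟨ofCoord n g, (coord_mem_iff _ g).1 (by simpa using hgs), by rw [koszulD_ofCoord, hg]⟩

theorem koszulD_mul {n : ℕ} (r : Fin n → R) {k : ℕ} {x : Ext R n}
    (hx : x ∈ ⋀[R]^k (Fin n → R)) (y : Ext R n) :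
    koszulD r (x * y) = koszulD r x * y + (-1 : R) ^ k • (x * koszulD r y) := by
  induction k generalizing x with
  | zero =>
    rw [koszulD_eq_zero r hx]
    change x ∈ LinearMap.range (ExteriorAlgebra.ι R) ^ 0 at hx
    rw [pow_zero, Submodule.mem_one] at hx
    obtain ⟨c, rfl⟩ := hx
    rw [← Algebra.smul_def, map_smul, ← Algebra.smul_def]
    simp
  | succ k ih =>
    change x ∈ LinearMap.range (ExteriorAlgebra.ι R) ^ (k + 1) at hx
    rw [pow_succ'] at hx
    induction hx using Submodule.mul_induction_on' with
    | mem_mul_mem m hm x hx =>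
      obtain ⟨v, rfl⟩ := hm
      have h := ih hx
      rw [koszulD] at h ⊢
      rw [mul_assoc, contr_ι_mul, contr_ι_mul, h, pow_succ]
      simp only [mul_add, sub_mul, mul_assoc, smul_mul_assoc, mul_smul_comm, mul_neg, mul_one,
        neg_smul]
      abel
    | add x _ x' _ hx hx' =>
      rw [add_mul, map_add, map_add, hx, hx', add_mul, add_mul, smul_add]
      abel

end Exterior
end TorBlowup

namespace TorBlowup

universe u

open CategoryTheory MonoidalCategory

section Resolution

variable {R : Type u} [CommRing R]

/-! ### Homology classes -/

theorem cls_congr (C : ChainComplex (ModuleCat.{u} R) ℕ) (k : ℕ) {x y : C.X k} (hx : x ∈ cyc C k)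
    (hy : y ∈ cyc C k) (w : C.X (k + 1)) (h : x - y = C.d (k + 1) k w) :
    cls C k ⟨x, hx⟩ = cls C k ⟨y, hy⟩ := by
  rw [← sub_eq_zero, ← map_sub, ← cls_boundary C k w]
  exact congrArg _ (Subtype.ext h)

theorem liftCycles_apply (C : ChainComplex (ModuleCat.{u} R) ℕ) (k l : ℕ)
    (hl : (ComplexShape.down ℕ).next k = l) {A : ModuleCat.{u} R} (φ : A ⟶ C.X k)
    (hφ : φ ≫ C.d k l = 0) (a : A) (ha : φ a ∈ cyc C k) :
    (C.homologyπ k) (C.liftCycles φ l hl hφ a) = cls C k ⟨φ a, ha⟩ := by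
  refine congrArg (C.homologyπ k).hom ?_
  apply (ModuleCat.mono_iff_injective (C.iCycles k)).1 inferInstance
  have h1 := congrArg (fun f => f.hom a) (C.liftCycles_i φ l hl hφ)
  have h2 := congrArg (fun f => f.hom ⟨φ a, ha⟩) (C.liftCycles_i
    (A := ModuleCat.of R (cyc C k)) (ModuleCat.ofHom (cyc C k).subtype) (k - 1)
    (next_down k) (ModuleCat.hom_ext (LinearMap.ext fun x => x.2)))
  exact h1.trans h2.symm

theorem map_mem_cyc {C D : ChainComplex (ModuleCat.{u} R) ℕ} (f : C ⟶ D) (k : ℕ) {x : C.X k}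
    (hx : x ∈ cyc C k) : f.f k x ∈ cyc D k := by
  have h : C.d k (k - 1) x = 0 := hx
  have := congrArg (fun g => g.hom x) (f.comm k (k - 1))
  exact this.trans ((congrArg (f.f (k - 1)) h).trans (map_zero (f.f (k - 1)).hom))

theorem homologyMap_cls {C D : ChainComplex (ModuleCat.{u} R) ℕ} (f : C ⟶ D) (k : ℕ)
    (z : cyc C k) : HomologicalComplex.homologyMap f k (cls C k z) =
      cls D k ⟨f.f k z, map_mem_cyc f k z.2⟩ := by
  have e : (C.liftCycles (A := ModuleCat.of R (cyc C k)) (ModuleCat.ofHom (cyc C k).subtype) (k - 1)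
      (next_down k) (ModuleCat.hom_ext (LinearMap.ext fun x => x.2)) ≫ C.homologyπ k) ≫
      HomologicalComplex.homologyMap f k =
      D.liftCycles (ModuleCat.ofHom (cyc C k).subtype ≫ f.f k) (k - 1) (next_down k)
        (ModuleCat.hom_ext (LinearMap.ext fun x => map_mem_cyc f k x.2)) ≫ D.homologyπ k := by
    rw [Category.assoc, HomologicalComplex.homologyπ_naturality, ← Category.assoc,
      HomologicalComplex.liftCycles_comp_cyclesMap]
  exact (congrArg (fun g => g.hom z) e).trans (liftCycles_apply D k (k - 1) (next_down k)
    (ModuleCat.ofHom (cyc C k).subtype ≫ f.f k) (ModuleCat.hom_ext (LinearMap.ext fun x =>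
      map_mem_cyc f k x.2)) z (map_mem_cyc f k z.2))

/-! ### Homotopies between lifts -/

/-- A chain map from a complex of projectives to a resolution that covers zero is
null-homotopic. -/
noncomputable def nullHomotopy (C : ChainComplex (ModuleCat.{u} R) ℕ) [∀ k, Projective (C.X k)]
    {Y : ModuleCat.{u} R} (Q : ProjectiveResolution Y) (f : C ⟶ Q.complex)
    (hf : f.f 0 ≫ aug Q = 0) : Homotopy f 0 :=
  Homotopy.mkInductive _ ((exact_aug Q).liftFromProjective (f.f 0) hf)
    ((exact_aug Q).liftFromProjective_comp _ _).symm
    ((Q.exact_succ 0).liftFromProjective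
      (f.f 1 - C.d 1 0 ≫ (exact_aug Q).liftFromProjective (f.f 0) hf) (by
        rw [Preadditive.sub_comp, Category.assoc, f.comm]
        have := (exact_aug Q).liftFromProjective_comp (f.f 0) hf
        change _ ≫ Q.complex.d 1 0 = _ at this
        rw [this, sub_self]))
    (by rw [(Q.exact_succ 0).liftFromProjective_comp]; simp)
    fun n ⟨g, g', w⟩ => ⟨(Q.exact_succ (n + 1)).liftFromProjective
      (f.f (n + 2) - C.d _ _ ≫ g') (by simp [w]), by
        rw [(Q.exact_succ (n + 1)).liftFromProjective_comp]; simp⟩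

/-- No separate case for k = 0 is needed: there k - 1 is again 0, and the differential from 0 to 0
vanishes. -/
theorem nullHomotopy_apply {C D : ChainComplex (ModuleCat.{u} R) ℕ} {f : C ⟶ D}
    (h : Homotopy f 0) (k : ℕ) :
    f.f k = C.d k (k - 1) ≫ h.hom (k - 1) k + h.hom k (k + 1) ≫ D.d (k + 1) k := by
  rw [h.comm k, dNext_nat, prevD_eq _ (show (ComplexShape.down ℕ).Rel (k + 1) k from rfl), HomologicalComplex.zero_f, add_zero]

/-! ### The Koszul complex is a resolution -/

variable {n : ℕ} (r : Fin n → R)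

theorem koszul_d_coe (k : ℕ) (x : ⋀[R]^(k + 1) (Fin n → R)) :
    ((koszul r).d (k + 1) k x : ⋀[R]^k (Fin n → R)) = (⟨koszulD r x, koszulD_mem r x.2⟩ :
      ⋀[R]^k (Fin n → R)) :=
  LinearMap.congr_fun (congrArg ModuleCat.Hom.hom (koszul_d r k)) x

theorem koszul_exactAt (hr : RingTheory.Sequence.IsWeaklyRegular R (List.ofFn r)) (k : ℕ) :
    (koszul r).ExactAt (k + 1) := by
  rw [HomologicalComplex.exactAt_iff' _ (k + 1 + 1) (k + 1) k (by simp) (by simp),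
    ShortComplex.moduleCat_exact_iff]
  intro x hx
  obtain ⟨x, h⟩ : ⋀[R]^(k + 1) (Fin n → R) := x
  have hx' : koszulD r x = 0 := congrArg Subtype.val ((koszul_d_coe r k ⟨x, h⟩).symm.trans hx)
  obtain ⟨y, hy, -, hyx⟩ := exists_koszulD_eq r hr 0 (k + 1) (Or.inr (by omega)) h hx'
    (by rw [pow_zero, Ideal.one_eq_top, Submodule.top_smul]; trivial)
  exact ⟨(⟨y, hy⟩ : ⋀[R]^(k + 2) (Fin n → R)),
    (koszul_d_coe r (k + 1) ⟨y, hy⟩).trans (Subtype.ext hyx)⟩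

theorem zeroEquiv_algebraMap (c : R) (h : algebraMap R (Ext R n) c ∈ ⋀[R]^0 (Fin n → R)) :
    exteriorPower.zeroEquiv R (Fin n → R) ⟨algebraMap R (Ext R n) c, h⟩ = c := by
  rw [← LinearEquiv.eq_symm_apply, exteriorPower.zeroEquiv_symm_apply]
  apply Subtype.ext
  rw [Submodule.coe_smul, exteriorPower.ιMulti_apply_coe, ExteriorAlgebra.ιMulti_zero_apply]
  exact Algebra.algebraMap_eq_smul_one c

theorem koszul_exact_aug (hr : RingTheory.Sequence.IsWeaklyRegular R (List.ofFn r)) :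
    (ShortComplex.mk _ _ (d_koszulAug r)).Exact := by
  rw [ShortComplex.moduleCat_exact_iff]
  intro x hx
  obtain ⟨x, h⟩ : ⋀[R]^0 (Fin n → R) := x
  have h' := h
  change x ∈ LinearMap.range (ExteriorAlgebra.ι R) ^ 0 at h'
  rw [pow_zero, Submodule.mem_one] at h'
  obtain ⟨c, rfl⟩ := h'
  have hc : c ∈ seqIdeal r := by
    rw [← Submodule.Quotient.mk_eq_zero, ← zeroEquiv_algebraMap c h]
    exact hx
  obtain ⟨y, hy, -, hyx⟩ := exists_koszulD_eq r hr 1 0 (Or.inl (by omega)) h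
    (koszulD_eq_zero r h) (by
      rw [Algebra.algebraMap_eq_smul_one, pow_one]
      exact Submodule.smul_mem_smul hc trivial)
  exact ⟨(⟨y, hy⟩ : ⋀[R]^1 (Fin n → R)),
    (koszul_d_coe r 0 ⟨y, hy⟩).trans (Subtype.ext hyx)⟩

instance : Epi (koszulAug r) := by
  rw [ModuleCat.epi_iff_surjective]
  exact (Submodule.mkQ_surjective _).comp (exteriorPower.zeroEquiv R (Fin n → R)).surjective

/-- The Koszul complex of a regular sequence, as a projective resolution. -/
noncomputable def koszulResolution (hr : RingTheory.Sequence.IsWeaklyRegular R (List.ofFn r)) :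
    ProjectiveResolution (ModuleCat.of R (R ⧸ seqIdeal r)) where
  complex := koszul r
  π := (ChainComplex.toSingle₀Equiv _ _).symm ⟨koszulAug r, d_koszulAug r⟩
  quasiIso := ⟨fun k => by
    cases k
    · rw [ChainComplex.quasiIsoAt₀_iff, ShortComplex.quasiIso_iff_of_zeros']
      · refine (ShortComplex.exact_and_epi_g_iff_of_iso (ShortComplex.isoMk
          (S₂ := ShortComplex.mk _ _ (d_koszulAug r)) (Iso.refl ((koszul r).X 1))
          (Iso.refl ((koszul r).X 0)) (Iso.refl (ModuleCat.of R (R ⧸ seqIdeal r))) ?_ ?_)).2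
          ⟨koszul_exact_aug r hr, inferInstanceAs (Epi (koszulAug r))⟩
        · exact (Category.id_comp _).trans (Category.comp_id _).symm
        · refine (Category.id_comp _).trans (Eq.trans ?_ (Category.comp_id _).symm)
          exact (ChainComplex.toSingle₀Equiv_symm_apply_f_zero (koszulAug r) (d_koszulAug r)).symm
      all_goals rfl
    · rw [quasiIsoAt_iff_exactAt']
      · apply koszul_exactAt r hr
      · apply ChainComplex.exactAt_succ_single_obj⟩

theorem koszulLift_aug : (koszulLift r).f 0 ≫ aug (resolution (seqIdeal r)) = koszulAug r :=
  augLift_comp _ _ (d_koszulAug r) _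

end Resolution
section Comparison

variable {R : Type u} [CommRing R] {n : ℕ} (r : Fin n → R)

/-! ### Tor as the homology of the Koszul complex -/

theorem lTensor_rTensor_apply {A B M N : Type*} [AddCommGroup A] [Module R A] [AddCommGroup B]
    [Module R B] [AddCommGroup M] [Module R M] [AddCommGroup N] [Module R N] (g : A →ₗ[R] B)
    (f : M →ₗ[R] N) (x : TensorProduct R A M) :
    LinearMap.lTensor B f (LinearMap.rTensor M g x) =
      LinearMap.rTensor N g (LinearMap.lTensor A f x) := by
  rw [← LinearMap.comp_apply, LinearMap.lTensor_comp_rTensor, ← LinearMap.rTensor_comp_lTensor,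
    LinearMap.comp_apply]

/-- The complex `K ⊗ N`, where `K` is the Koszul complex. -/
noncomputable def koszulTensor (N : ModuleCat.{u} R) : ChainComplex (ModuleCat.{u} R) ℕ :=
  ((tensorRight N).mapHomologicalComplex _).obj (koszul r)

/-- The chain map `K ⊗ N ⟶ P ⊗ N`. -/
noncomputable def koszulTensorLift (N : ModuleCat.{u} R) :
    koszulTensor r N ⟶ resTensor (seqIdeal r) N :=
  ((tensorRight N).mapHomologicalComplex _).map (koszulLift r)

/-- Two projective resolutions of R/I are homotopy equivalent over the identity. The chosen lift
`koszulLift` covers the identity too, so it is homotopic to that equivalence, and tensoring with N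
preserves homotopies. -/
theorem isIso_homologyMap_koszulTensorLift
    (hr : RingTheory.Sequence.IsWeaklyRegular R (List.ofFn r)) (N : ModuleCat.{u} R) (k : ℕ) :
    IsIso (HomologicalComplex.homologyMap (koszulTensorLift r N) k) := by
  let e : HomotopyEquiv (koszul r) (resolution (seqIdeal r)).complex :=
    ProjectiveResolution.homotopyEquiv (koszulResolution r hr) (resolution (seqIdeal r))
  have he : e.hom.f 0 ≫ aug (resolution (seqIdeal r)) = koszulAug r := by
    refine (ProjectiveResolution.lift_commutes_zero (𝟙 _) (koszulResolution r hr)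
      (resolution (seqIdeal r))).trans ((Category.comp_id _).trans ?_)
    simp [koszulResolution]
  have h : Homotopy (koszulLift r) e.hom := Homotopy.equivSubZero.invFun
    (nullHomotopy (koszul r) (resolution (seqIdeal r)) (koszulLift r - e.hom) (by
      rw [HomologicalComplex.sub_f_apply, Preadditive.sub_comp, koszulLift_aug]
      exact sub_eq_zero.2 he.symm))
  have h₁ : HomologicalComplex.homologyMap (koszulTensorLift r N) k =
    (((tensorRight N).mapHomotopyEquiv e).toHomologyIso k).hom :=
      ((tensorRight N).mapHomotopy h).homologyMap_eq k
  rw [h₁]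
  exact (((tensorRight N).mapHomotopyEquiv e).toHomologyIso k).isIso_hom

variable (k : ℕ) (N : Type u) [AddCommGroup N] [Module R N]

/-- The cycles of degree `k` in `K ⊗ N`. -/
noncomputable def koszulCyc : Submodule R (TensorProduct R (⋀[R]^k (Fin n → R)) N) :=
  cyc (koszulTensor r (ModuleCat.of R N)) k

/-- The differential of `K ⊗ N`. -/
noncomputable def koszulTensorD : TensorProduct R (⋀[R]^(k + 1) (Fin n → R)) N →ₗ[R]
    TensorProduct R (⋀[R]^k (Fin n → R)) N :=
  LinearMap.rTensor N (contract (Fintype.linearCombination R r) k)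

theorem koszulTensorD_eq (x : TensorProduct R (⋀[R]^(k + 1) (Fin n → R)) N) :
    (koszulTensor r (ModuleCat.of R N)).d (k + 1) k x = koszulTensorD r k N x :=
  congrArg (fun f : ⋀[R]^(k + 1) (Fin n → R) →ₗ[R] ⋀[R]^k (Fin n → R) => LinearMap.rTensor N f x)
    (congrArg ModuleCat.Hom.hom (koszul_d r k))

variable {N} in
theorem mem_koszulCyc_zero (x : TensorProduct R (⋀[R]^0 (Fin n → R)) N) :
    x ∈ koszulCyc r 0 N := by
  change (koszulTensor r (ModuleCat.of R N)).d 0 (0 - 1) x = 0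
  rw [(koszulTensor r (ModuleCat.of R N)).shape 0 (0 - 1) (by simp)]
  rfl

variable {N k} in
theorem mem_koszulCyc_succ {x : TensorProduct R (⋀[R]^(k + 1) (Fin n → R)) N} :
    x ∈ koszulCyc r (k + 1) N ↔ koszulTensorD r k N x = 0 := by
  rw [← koszulTensorD_eq]
  rfl

/-- The class in `Tor_k(R/I, N)` of a cycle of `K ⊗ N`. -/
noncomputable def koszulCls : koszulCyc r k N →ₗ[R] TorQ (seqIdeal r) k N :=
  (torIso (seqIdeal r) k N).symm.toLinearMap.comp
    ((HomologicalComplex.homologyMap (koszulTensorLift r (ModuleCat.of R N)) k).hom.comp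
      (cls (koszulTensor r (ModuleCat.of R N)) k))

/-- `K_k ⟶ P_k`. -/
noncomputable def liftHom : ⋀[R]^k (Fin n → R) →ₗ[R] (resolution (seqIdeal r)).complex.X k :=
  ((koszulLift r).f k).hom

/-- `K_k ⊗ N ⟶ P_k ⊗ N`. -/
noncomputable def liftTensor : TensorProduct R (⋀[R]^k (Fin n → R)) N →ₗ[R]
    (resTensor (seqIdeal r) (ModuleCat.of R N)).X k :=
  LinearMap.rTensor N (liftHom r k)

variable {N k} in
theorem liftTensor_mem {z : TensorProduct R (⋀[R]^k (Fin n → R)) N} (hz : z ∈ koszulCyc r k N) :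
    liftTensor r k N z ∈ cyc (resTensor (seqIdeal r) (ModuleCat.of R N)) k :=
  map_mem_cyc (koszulTensorLift r (ModuleCat.of R N)) k hz

variable {N k} in
theorem koszulCls_apply (z : TensorProduct R (⋀[R]^k (Fin n → R)) N) (hz : z ∈ koszulCyc r k N) :
    koszulCls r k N ⟨z, hz⟩ = (torIso (seqIdeal r) k N).symm
      (cls (resTensor (seqIdeal r) (ModuleCat.of R N)) k
        ⟨liftTensor r k N z, liftTensor_mem r hz⟩) :=
  congrArg (torIso (seqIdeal r) k N).symm
    (homologyMap_cls (koszulTensorLift r (ModuleCat.of R N)) k ⟨z, hz⟩)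

theorem koszulCls_surjective (hr : RingTheory.Sequence.IsWeaklyRegular R (List.ofFn r)) :
    Function.Surjective (koszulCls r k N) := by
  have := isIso_homologyMap_koszulTensorLift r hr (ModuleCat.of R N) k
  have h : Function.Surjective
      (HomologicalComplex.homologyMap (koszulTensorLift r (ModuleCat.of R N)) k).hom :=
    (ModuleCat.epi_iff_surjective _).1 inferInstance
  exact (torIso (seqIdeal r) k N).symm.surjective.comp (h.comp (cls_surjective _ k))

theorem koszulCls_eq_zero (hr : RingTheory.Sequence.IsWeaklyRegular R (List.ofFn r))
    (z : koszulCyc r k N) (hz : koszulCls r k N z = 0) : ∃ y, koszulTensorD r k N y = z := by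
  have := isIso_homologyMap_koszulTensorLift r hr (ModuleCat.of R N) k
  have h : Function.Injective
      (HomologicalComplex.homologyMap (koszulTensorLift r (ModuleCat.of R N)) k).hom :=
    (ModuleCat.mono_iff_injective _).1 inferInstance
  obtain ⟨y, hy⟩ := cls_eq_zero (koszulTensor r (ModuleCat.of R N)) k z (h (by
    rw [map_zero]
    exact (torIso (seqIdeal r) k N).symm.injective (hz.trans (map_zero _).symm)))
  exact ⟨y, (koszulTensorD_eq r k N y).symm.trans hy⟩

theorem koszulCls_boundary (y : TensorProduct R (⋀[R]^(k + 1) (Fin n → R)) N)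
    (hy : koszulTensorD r k N y ∈ koszulCyc r k N) :
    koszulCls r k N ⟨koszulTensorD r k N y, hy⟩ = 0 := by
  have h : cls (koszulTensor r (ModuleCat.of R N)) k ⟨koszulTensorD r k N y, hy⟩ = 0 :=
    (congrArg _ (Subtype.ext (koszulTensorD_eq r k N y).symm)).trans
      (cls_boundary (koszulTensor r (ModuleCat.of R N)) k y)
  have h' := congrArg (HomologicalComplex.homologyMap
    (koszulTensorLift r (ModuleCat.of R N)) k).hom h
  exact (congrArg (torIso (seqIdeal r) k N).symm (h'.trans (map_zero _))).trans (map_zero _)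

variable {N} {L : Type u} [AddCommGroup L] [Module R L]

/-- Functoriality of Tor in N comes from a natural transformation of the tensor functors; its left
derived map is computed on any projective resolution by applying it degreewise. -/
theorem torIso_torMap (I : Ideal R) (f : N →ₗ[R] L) (x : TorQ I k N) :
    torIso I k L (torMap I k f x) = HomologicalComplex.homologyMap
      (resTensorMap I (ModuleCat.ofHom f)) k (torIso I k N x) := by
  have h := ProjectiveResolution.leftDerived_app_eq
    ((tensoringRight (ModuleCat.{u} R)).map (ModuleCat.ofHom f)) (resolution I) k
  have h' := congrArg (fun g => g ≫
    ((resolution I).isoLeftDerivedObj (tensorRight (ModuleCat.of R L)) k).hom) h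
  have h'' : (NatTrans.leftDerived
      ((tensoringRight (ModuleCat.{u} R)).map (ModuleCat.ofHom f)) k).app _ ≫
      ((resolution I).isoLeftDerivedObj (tensorRight (ModuleCat.of R L)) k).hom =
      ((resolution I).isoLeftDerivedObj (tensorRight (ModuleCat.of R N)) k).hom ≫
      HomologicalComplex.homologyMap (resTensorMap I (ModuleCat.ofHom f)) k := by
    refine h'.trans ?_
    simp only [Category.assoc]
    erw [Iso.inv_hom_id]
    rw [Category.comp_id]
    rfl
  exact congrArg (fun g => g.hom x) h''

theorem torMap_koszulCls (f : N →ₗ[R] L) (z : TensorProduct R (⋀[R]^k (Fin n → R)) N)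
    (hz : z ∈ koszulCyc r k N)
    (hz' : LinearMap.lTensor (⋀[R]^k (Fin n → R)) f z ∈ koszulCyc r k L) :
    torMap (seqIdeal r) k f (koszulCls r k N ⟨z, hz⟩) = koszulCls r k L
      ⟨LinearMap.lTensor (⋀[R]^k (Fin n → R)) f z, hz'⟩ := by
  apply (torIso (seqIdeal r) k L).injective
  rw [torIso_torMap, koszulCls_apply, koszulCls_apply, LinearEquiv.apply_symm_apply,
    LinearEquiv.apply_symm_apply, homologyMap_cls]
  congr 1
  apply Subtype.ext
  exact lTensor_rTensor_apply (liftHom r k) f z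

theorem cls_isoHomologyι₀ (C : ChainComplex (ModuleCat.{u} R) ℕ) {B : ModuleCat.{u} R}
    (f : C.opcycles 0 ⟶ B) (w : cyc C 0) :
    ((ChainComplex.isoHomologyι₀ C).hom ≫ f).hom (cls C 0 w) = (C.pOpcycles 0 ≫ f).hom w.1 := by
  have e : (C.liftCycles (A := ModuleCat.of R (cyc C 0)) (ModuleCat.ofHom (cyc C 0).subtype)
      (0 - 1) (next_down 0) (ModuleCat.hom_ext (LinearMap.ext fun x => x.2)) ≫ C.homologyπ 0) ≫
      (ChainComplex.isoHomologyι₀ C).hom ≫ f =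
      ModuleCat.ofHom (cyc C 0).subtype ≫ C.pOpcycles 0 ≫ f := by
    have h : (ChainComplex.isoHomologyι₀ C).hom = C.homologyι 0 := rfl
    rw [h, Category.assoc, HomologicalComplex.homology_π_ι_assoc,
      HomologicalComplex.liftCycles_i_assoc]
  exact congrArg (fun f => f.hom w) e

/-- The identification of Tor_0 is induced by the augmentation of P, and the lift K → P respects
augmentations. This is how classes such as 1 ⊗ r_i are recognised as Koszul cycles. -/
theorem torZero_koszulCls (z : TensorProduct R (⋀[R]^0 (Fin n → R)) N)
    (hz : z ∈ koszulCyc r 0 N) :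
    torZero (seqIdeal r) N (koszulCls r 0 N ⟨z, hz⟩) =
      LinearMap.rTensor N ((Submodule.mkQ (seqIdeal r)).comp
        (exteriorPower.zeroEquiv R (Fin n → R)).toLinearMap) z := by
  rw [koszulCls_apply]
  have h₁ : ∀ w : cyc (resTensor (seqIdeal r) (ModuleCat.of R N)) 0,
      torZero (seqIdeal r) N ((torIso (seqIdeal r) 0 N).symm (cls _ 0 w)) =
      LinearMap.rTensor N (aug (resolution (seqIdeal r))).hom w.1 := by
    intro w
    have h := (resolution (seqIdeal r)).fromLeftDerivedZero_eq (tensorRight (ModuleCat.of R N))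
    rw [← Iso.inv_comp_eq] at h
    refine (congrArg (fun f => f.hom (cls (resTensor (seqIdeal r) (ModuleCat.of R N)) 0 w)) h).trans
      ?_
    let C := resTensor (seqIdeal r) (ModuleCat.of R N)
    have e := (resolution (seqIdeal r)).pOpcycles_comp_fromLeftDerivedZero'
      (tensorRight (ModuleCat.of R N))
    exact (cls_isoHomologyι₀ C _ w).trans (congrArg (fun f => f.hom w.1) e)
  rw [h₁]
  have h₂ := congrArg (fun f : (koszul r).X 0 ⟶ ModuleCat.of R (R ⧸ seqIdeal r) =>
    LinearMap.rTensor N f.hom z) (koszulLift_aug r)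
  refine Eq.trans ?_ h₂
  exact (LinearMap.congr_fun (LinearMap.rTensor_comp N (aug (resolution (seqIdeal r))).hom
    (liftHom r 0)) z).symm

end Comparison
section Products

variable {R : Type u} [CommRing R] {n : ℕ} (r : Fin n → R)

/-! ### The connecting homomorphism on Koszul cycles -/

theorem δ_cls {S : ShortComplex (ChainComplex (ModuleCat.{u} R) ℕ)} (hS : S.ShortExact) (k : ℕ)
    (y : S.X₂.X (k + 1)) (x : S.X₁.X k) (h : S.f.f k x = S.X₂.d (k + 1) k y)
    (hz : S.g.f (k + 1) y ∈ cyc S.X₃ (k + 1)) (hx : x ∈ cyc S.X₁ k) :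
    (hS.δ (k + 1) k rfl).hom (cls S.X₃ (k + 1) ⟨S.g.f (k + 1) y, hz⟩) = cls S.X₁ k ⟨x, hx⟩ := by
  -- The categorical formula for the connecting map takes morphisms into the complexes; an element
  -- is encoded as a morphism from R and recovered at 1.
  let pt : ∀ {A : ModuleCat.{u} R}, A → (ModuleCat.of R R ⟶ A) := fun {A} a =>
    ModuleCat.ofHom (LinearMap.toSpanSingleton R A a)
  have pt_apply : ∀ {A : ModuleCat.{u} R} (a : A), (pt a).hom (1 : R) = a := fun a =>
    one_smul R a
  have pt_comp : ∀ {A B : ModuleCat.{u} R} (a : A) (f : A ⟶ B), pt a ≫ f = pt (f a) := fun a f =>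
    ModuleCat.hom_ext (LinearMap.ext_ring (by
      change f.hom ((1 : R) • a) = (1 : R) • f.hom a
      rw [one_smul, one_smul]))
  have hz₀ : S.X₃.d (k + 1) k (S.g.f (k + 1) y) = 0 := hz
  have e := hS.δ_eq (k + 1) k rfl (pt (S.g.f (k + 1) y))
    (by rw [pt_comp, hz₀]; exact ModuleCat.hom_ext (LinearMap.toSpanSingleton_zero R _))
    (pt y) (pt_comp _ _) (pt x) (by rw [pt_comp, pt_comp, h]) (k - 1) (next_down k)
  have e' := congrArg (fun f => f.hom (1 : R)) e
  have h₃ := liftCycles_apply S.X₃ (k + 1) k (next_down (k + 1)) (pt (S.g.f (k + 1) y))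
    (by rw [pt_comp, hz₀]; exact ModuleCat.hom_ext (LinearMap.toSpanSingleton_zero R _)) (1 : R)
    (by rw [pt_apply]; exact hz)
  have hx₀ : S.X₁.d k (k - 1) x = 0 := hx
  have h₁ := liftCycles_apply S.X₁ k (k - 1) (next_down k) (pt x)
    (by rw [pt_comp, hx₀]; exact ModuleCat.hom_ext (LinearMap.toSpanSingleton_zero R _)) (1 : R)
    (by rw [pt_apply]; exact hx)
  have h₃' := h₃.trans (congrArg (cls S.X₃ (k + 1)) (Subtype.ext (pt_apply _) :
    _ = (⟨S.g.f (k + 1) y, hz⟩ : cyc S.X₃ (k + 1))))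
  have h₁' := h₁.trans (congrArg (cls S.X₁ k) (Subtype.ext (pt_apply _) :
    _ = (⟨x, hx⟩ : cyc S.X₁ k)))
  rw [← h₃', ← h₁']
  exact e'

/-- The lift K → P commutes with differentials and with maps of coefficients, so a snake diagram
chase in K ⊗ - maps to one in P ⊗ -. -/
theorem torδ_koszulCls {M N L : Type u} [AddCommGroup M] [Module R M] [AddCommGroup N] [Module R N]
    [AddCommGroup L] [Module R L] (f : M →ₗ[R] N) (g : N →ₗ[R] L) (hf : Function.Injective f)
    (hfg : Function.Exact f g) (hg : Function.Surjective g) (k : ℕ)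
    (y : TensorProduct R (⋀[R]^(k + 1) (Fin n → R)) N) (x : TensorProduct R (⋀[R]^k (Fin n → R)) M)
    (h : LinearMap.lTensor _ f x = koszulTensorD r k N y)
    (hz : LinearMap.lTensor _ g y ∈ koszulCyc r (k + 1) L) (hx : x ∈ koszulCyc r k M) :
    torδ (seqIdeal r) f g hf hfg hg k (koszulCls r (k + 1) L ⟨_, hz⟩) =
      koszulCls r k M ⟨x, hx⟩ := by
  rw [torδ, LinearMap.comp_apply, LinearMap.comp_apply, koszulCls_apply, koszulCls_apply,
    LinearEquiv.coe_coe, LinearEquiv.coe_coe, LinearEquiv.apply_symm_apply]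
  congr 1
  have comm : ∀ {A B : Type u} [AddCommGroup A] [AddCommGroup B] [Module R A] [Module R B]
      (f : A →ₗ[R] B) (k : ℕ) (x : TensorProduct R (⋀[R]^k (Fin n → R)) A),
      LinearMap.lTensor ((resolution (seqIdeal r)).complex.X k) f (liftTensor r k A x) =
        liftTensor r k B (LinearMap.lTensor _ f x) := fun f k x =>
    lTensor_rTensor_apply (liftHom r k) f x
  have hd : (resTensor (seqIdeal r) (ModuleCat.of R N)).d (k + 1) k (liftTensor r (k + 1) N y) =
      liftTensor r k N (koszulTensorD r k N y) := by
    rw [← koszulTensorD_eq]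
    exact congrArg (fun φ => φ.hom y) ((koszulTensorLift r (ModuleCat.of R N)).comm (k + 1) k)
  have := δ_cls (resTensor_shortExact (seqIdeal r) f g hf hfg hg) k (liftTensor r (k + 1) N y)
    (liftTensor r k M x) ((comm f k x).trans (by rw [h]; exact hd.symm))
    (by
      have := liftTensor_mem r hz
      rw [← comm] at this
      exact this) (liftTensor_mem r hx)
  refine Eq.trans (congrArg _ (congrArg _ (Subtype.ext ?_))) this
  exact (comm g (k + 1) y).symm

/-! ### The exterior product on Koszul cycles -/

/-- The product `⋀^p × ⋀^q → ⋀^m` for `m = p + q` (zero for other `m`). -/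
noncomputable def wedgeMul (R : Type u) [CommRing R] (n p q m : ℕ) : ⋀[R]^p (Fin n → R) →ₗ[R]
    ⋀[R]^q (Fin n → R) →ₗ[R] ⋀[R]^m (Fin n → R) :=
  ((LinearMap.mul R (Ext R n)).compl₁₂ (Submodule.subtype _) (Submodule.subtype _)).compr₂
    ((extProj R n m).codRestrict _ (extProj_mem m))

theorem wedgeMul_coe {p q m : ℕ} (h : p + q = m) (x : ⋀[R]^p (Fin n → R))
    (y : ⋀[R]^q (Fin n → R)) : (wedgeMul R n p q m x y : Ext R n) = x * y := by
  subst h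
  exact extProj_of_mem (SetLike.GradedMul.mul_mem x.2 y.2)

theorem sqι_hom_ext (C : ChainComplex (ModuleCat.{u} R) ℕ) {m : ℕ} {Y : ModuleCat.{u} R}
    {f g : (sq C).X m ⟶ Y} (h : ∀ p q, p + q = m → sqι C p q m ≫ f = sqι C p q m ≫ g) :
    f = g := by
  apply HomologicalComplex.mapBifunctor.hom_ext
  intro p q hpq
  have := h p q hpq
  rw [sqι, HomologicalComplex.ιMapBifunctorOrZero_eq _ _ _ _ p q m hpq] at this
  exact this

/-- The wedge product `K_p ⊗ K_q ⟶ K_m`. -/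
noncomputable def wedgeComponent (p q m : ℕ) :
    (koszul r).X p ⊗ (koszul r).X q ⟶ (koszul r).X m :=
  (ModuleCat.ofHom (TensorProduct.lift (wedgeMul R n p q m)) :
    ModuleCat.of R (TensorProduct R (⋀[R]^p (Fin n → R)) (⋀[R]^q (Fin n → R))) ⟶
    ModuleCat.of R (⋀[R]^m (Fin n → R)))

/-- The wedge product on `K ⊗ K`. -/
noncomputable def wedgeHom (R : Type u) [CommRing R] {n : ℕ} (r : Fin n → R) (m : ℕ) :
    (sq (koszul r)).X m ⟶ (koszul r).X m :=
  HomologicalComplex.mapBifunctorDesc fun p q _ => wedgeComponent r p q m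

theorem sqι_wedgeHom {p q m : ℕ} (h : p + q = m) (x : ⋀[R]^p (Fin n → R))
    (y : ⋀[R]^q (Fin n → R)) :
    (sqι (koszul r) p q m ≫ wedgeHom R r m).hom (x ⊗ₜ[R] y) = wedgeMul R n p q m x y := by
  have e : sqι (koszul r) p q m ≫ wedgeHom R r m = wedgeComponent r p q m := by
    rw [sqι, HomologicalComplex.ιMapBifunctorOrZero_eq _ _ _ _ p q m h, wedgeHom,
      HomologicalComplex.ι_mapBifunctorDesc]
  exact congrArg (fun f => f.hom (x ⊗ₜ[R] y)) e

/-- The Koszul differential `⋀^k → ⋀^{k-1}`, zero for `k = 0`. -/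
noncomputable def koszulPred (k : ℕ) : ⋀[R]^k (Fin n → R) →ₗ[R] ⋀[R]^(k - 1) (Fin n → R) :=
  ((koszul r).d k (k - 1)).hom

theorem koszulPred_coe (k : ℕ) (x : ⋀[R]^k (Fin n → R)) :
    (koszulPred r k x : Ext R n) = koszulD r x := by
  rcases k with _ | k
  · rw [koszulD_eq_zero r x.2]
    have : (koszul r).d 0 (0 - 1) = 0 := (koszul r).shape _ _ (by simp)
    exact congrArg Subtype.val (congrArg (fun f => f.hom x) this)
  · exact congrArg Subtype.val (koszul_d_coe r k x)

/-- For p = 0 the truncated degree p - 1 no longer adds up with q to m, but then both sides vanish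
because d is zero on scalars. -/
theorem wedgeMul_pred_left {p q m : ℕ} (h : p + q = m + 1) (x : ⋀[R]^p (Fin n → R))
    (y : ⋀[R]^q (Fin n → R)) :
    (wedgeMul R n (p - 1) q m (koszulPred r p x) y : Ext R n) = koszulD r x * y := by
  rcases p with _ | p
  · have : koszulPred r 0 x = 0 := Subtype.ext ((koszulPred_coe r 0 x).trans
      (koszulD_eq_zero r x.2))
    rw [this, koszulD_eq_zero r x.2, map_zero, zero_mul]
    rfl
  · rw [wedgeMul_coe (by omega), koszulPred_coe]

theorem wedgeMul_pred_right {p q m : ℕ} (h : p + q = m + 1) (x : ⋀[R]^p (Fin n → R))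
    (y : ⋀[R]^q (Fin n → R)) :
    (wedgeMul R n p (q - 1) m x (koszulPred r q y) : Ext R n) = x * koszulD r y := by
  rcases q with _ | q
  · have : koszulPred r 0 y = 0 := Subtype.ext ((koszulPred_coe r 0 y).trans
      (koszulD_eq_zero r y.2))
    rw [this, koszulD_eq_zero r y.2, map_zero, mul_zero]
    rfl
  · rw [wedgeMul_coe (by omega), koszulPred_coe]

theorem koszulPred_wedgeMul {p q m : ℕ} (h : p + q = m + 1) (x : ⋀[R]^p (Fin n → R))
    (y : ⋀[R]^q (Fin n → R)) : koszulPred r (m + 1) (wedgeMul R n p q (m + 1) x y) =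
      wedgeMul R n (p - 1) q m (koszulPred r p x) y +
        (-1 : R) ^ p • wedgeMul R n p (q - 1) m x (koszulPred r q y) := by
  apply Subtype.ext
  rw [koszulPred_coe, wedgeMul_coe h, koszulD_mul r x.2, Submodule.coe_add, Submodule.coe_smul,
    wedgeMul_pred_left r h, wedgeMul_pred_right r h]

theorem sqι_d_apply (C : ChainComplex (ModuleCat.{u} R) ℕ) {Y : ModuleCat.{u} R} (p q m : ℕ)
    (h : p + q = m + 1) (f : (sq C).X m ⟶ Y) (x : C.X p) (y : C.X q) :
    (sqι C p q (m + 1) ≫ (sq C).d (m + 1) m ≫ f).hom (x ⊗ₜ[R] y) =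
      (sqι C (p - 1) q m ≫ f).hom (C.d p (p - 1) x ⊗ₜ[R] y) +
        (-1 : R) ^ p • (sqι C p (q - 1) m ≫ f).hom (x ⊗ₜ[R] C.d q (q - 1) y) := by
  have e : sqι C p q (m + 1) ≫ (sq C).d (m + 1) m ≫ f =
      (C.d p (p - 1) ▷ C.X q) ≫ (sqι C (p - 1) q m ≫ f) +
        (-1 : R) ^ p • ((C.X p ◁ C.d q (q - 1)) ≫ (sqι C p (q - 1) m ≫ f)) := by
    rw [← Category.assoc, sqι_d _ _ _ _ _ h rfl]
    simp
  exact congrArg (fun f => f.hom (x ⊗ₜ[R] y)) e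

/-- The wedge product as a chain map. -/
noncomputable def wedgeChain : sq (koszul r) ⟶ koszul r where
  f m := wedgeHom R r m
  comm' := by
    rintro m m' (rfl : m' + 1 = m)
    refine sqι_hom_ext _ fun p q h => ModuleCat.hom_ext (TensorProduct.ext' fun x y => ?_)
    refine Eq.trans ?_ (sqι_d_apply (koszul r) p q m' h (wedgeHom R r m') x y).symm
    have e₁ : (sqι (koszul r) (p - 1) q m' ≫ wedgeHom R r m').hom
        ((koszul r).d p (p - 1) x ⊗ₜ[R] y) = wedgeMul R n (p - 1) q m' (koszulPred r p x) y := by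
      rcases p with _ | p
      · have : (koszul r).d 0 (0 - 1) x = 0 :=
          congrArg (fun f => f.hom x) ((koszul r).shape 0 (0 - 1) (by simp))
        have h' : koszulPred r 0 x = 0 := this
        rw [this, h', TensorProduct.zero_tmul, map_zero, map_zero]
        rfl
      · exact sqι_wedgeHom r (by omega) _ y
    have e₂ : (sqι (koszul r) p (q - 1) m' ≫ wedgeHom R r m').hom
        (x ⊗ₜ[R] (koszul r).d q (q - 1) y) = wedgeMul R n p (q - 1) m' x (koszulPred r q y) := by
      rcases q with _ | q
      · have : (koszul r).d 0 (0 - 1) y = 0 :=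
          congrArg (fun f => f.hom y) ((koszul r).shape 0 (0 - 1) (by simp))
        have h' : koszulPred r 0 y = 0 := this
        rw [this, h', TensorProduct.tmul_zero, map_zero, map_zero]
        rfl
      · exact sqι_wedgeHom r (by omega) x _
    rw [e₁, e₂]
    exact (congrArg (koszulPred r (m' + 1)) (sqι_wedgeHom r h x y)).trans
      (koszulPred_wedgeMul r h x y)


theorem sqι_tensorHom {C D : ChainComplex (ModuleCat.{u} R) ℕ} (f : C ⟶ D) {p q m : ℕ}
    (h : p + q = m) : sqι C p q m ≫ (HomologicalComplex.tensorHom f f).f m =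
      (f.f p ⊗ₘ f.f q) ≫ sqι D p q m := by
  rw [sqι, sqι, HomologicalComplex.ιMapBifunctorOrZero_eq _ _ _ _ p q m h,
    HomologicalComplex.ιMapBifunctorOrZero_eq _ _ _ _ p q m h,
    HomologicalComplex.ι_mapBifunctorMap, MonoidalCategory.tensorHom_def, Category.assoc]
  rfl

/-- The difference of the two lifts `K ⊗ K ⟶ P` of the multiplication of `R/I`. -/
noncomputable def multDiff : sq (koszul r) ⟶ (resolution (seqIdeal r)).complex :=
  HomologicalComplex.tensorHom (koszulLift r) (koszulLift r) ≫ mult (seqIdeal r) -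
    wedgeChain r ≫ koszulLift r

theorem sqι_multDiff {p q m : ℕ} (h : p + q = m) (x : ⋀[R]^p (Fin n → R))
    (y : ⋀[R]^q (Fin n → R)) :
    (sqι (koszul r) p q m ≫ (multDiff r).f m).hom (x ⊗ₜ[R] y) =
      multBil (seqIdeal r) p q m (liftHom r p x) (liftHom r q y) -
        liftHom r m (wedgeMul R n p q m x y) := by
  have e : sqι (koszul r) p q m ≫ (multDiff r).f m =
      ((koszulLift r).f p ⊗ₘ (koszulLift r).f q) ≫
        sqι (resolution (seqIdeal r)).complex p q m ≫ (mult (seqIdeal r)).f m -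
        sqι (koszul r) p q m ≫ wedgeHom R r m ≫ (koszulLift r).f m := by
    rw [multDiff, HomologicalComplex.sub_f_apply, Preadditive.comp_sub, HomologicalComplex.comp_f,
      HomologicalComplex.comp_f, ← Category.assoc, sqι_tensorHom _ h, Category.assoc]
    rfl
  refine (congrArg (fun f => f.hom (x ⊗ₜ[R] y)) e).trans ?_
  have e₂ := sqι_wedgeHom r h x y
  exact congrArg (fun z => multBil (seqIdeal r) p q m (liftHom r p x) (liftHom r q y) -
    liftHom r m z) e₂

theorem aug_liftHom (c : R) (h : algebraMap R (Ext R n) c ∈ ⋀[R]^0 (Fin n → R)) :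
    aug (resolution (seqIdeal r)) (liftHom r 0 ⟨algebraMap R (Ext R n) c, h⟩) =
      (seqIdeal r).mkQ c := by
  have := congrArg (fun f : (koszul r).X 0 ⟶ ModuleCat.of R (R ⧸ seqIdeal r) =>
    f.hom (⟨algebraMap R (Ext R n) c, h⟩ : ⋀[R]^0 (Fin n → R))) (koszulLift_aug r)
  exact this.trans (congrArg (seqIdeal r).mkQ (zeroEquiv_algebraMap c h))

theorem aug_multBil (I : Ideal R) (x y : (resolution I).complex.X 0) :
    aug (resolution I) (multBil I 0 0 0 x y) =
      LinearMap.mul' R (R ⧸ I) (aug (resolution I) x ⊗ₜ[R] aug (resolution I) y) := by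
  have h := sqι_aug I
  rw [← augLift_comp (sq (resolution I).complex) (sqAug I) (d_sqAug I) (resolution I)] at h
  exact congrArg (fun f => f.hom (x ⊗ₜ[R] y)) h

theorem mem_extZero {x : Ext R n} : x ∈ ⋀[R]^0 (Fin n → R) ↔ ∃ c, algebraMap R (Ext R n) c = x := by
  change x ∈ LinearMap.range (ExteriorAlgebra.ι R) ^ 0 ↔ _
  rw [pow_zero, Submodule.mem_one]

/-- On K_0 ⊗ K_0 both composites send a ⊗ b to the class of ab in R/I. Hence the difference of the
two lifts is null-homotopic. -/
theorem multDiff_aug : (multDiff r).f 0 ≫ aug (resolution (seqIdeal r)) = 0 := by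
  refine sqι_hom_ext _ fun p q h => ModuleCat.hom_ext (TensorProduct.ext' fun x y => ?_)
  obtain ⟨rfl, rfl⟩ : p = 0 ∧ q = 0 := by omega
  have e := congrArg (aug (resolution (seqIdeal r))) (sqι_multDiff r h x y)
  refine e.trans ((map_sub (aug (resolution (seqIdeal r))).hom _ _).trans (sub_eq_zero.2 ?_))
  refine (aug_multBil (seqIdeal r) _ _).trans ?_
  obtain ⟨x, hx⟩ : ⋀[R]^0 (Fin n → R) := x
  obtain ⟨y, hy⟩ : ⋀[R]^0 (Fin n → R) := y
  obtain ⟨a, rfl⟩ := mem_extZero.1 hx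
  obtain ⟨b, rfl⟩ := mem_extZero.1 hy
  have hw : wedgeMul R n 0 0 0 ⟨_, hx⟩ ⟨_, hy⟩ =
      ⟨algebraMap R (Ext R n) (a * b), mem_extZero.2 ⟨_, rfl⟩⟩ :=
    Subtype.ext ((wedgeMul_coe rfl _ _).trans (map_mul _ _ _).symm)
  rw [aug_liftHom, aug_liftHom, LinearMap.mul'_apply]
  refine Eq.trans ?_ (congrArg (fun z => aug (resolution (seqIdeal r)) (liftHom r 0 z)) hw).symm
  exact (aug_liftHom r (a * b) _).symm

/-- The homotopy as bilinear maps `K_p × K_q → P_{m+1}`. -/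
noncomputable def multHomotopy (p q m : ℕ) : ⋀[R]^p (Fin n → R) →ₗ[R] ⋀[R]^q (Fin n → R) →ₗ[R]
    (resolution (seqIdeal r)).complex.X (m + 1) :=
  TensorProduct.curry (sqι (koszul r) p q m ≫
    (nullHomotopy _ _ (multDiff r) (multDiff_aug r)).hom m (m + 1)).hom

/-- Degree zero is kept apart from `multHomotopy_succ`: the terms of the homotopy that involve d x
and d y are absent here. -/
theorem multHomotopy_zero (x y : ⋀[R]^0 (Fin n → R)) :
    multBil (seqIdeal r) 0 0 0 (liftHom r 0 x) (liftHom r 0 y) =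
      liftHom r 0 (wedgeMul R n 0 0 0 x y) +
        (resolution (seqIdeal r)).complex.d 1 0 (multHomotopy r 0 0 0 x y) := by
  have h := nullHomotopy_apply (nullHomotopy _ _ (multDiff r) (multDiff_aug r)) 0
  rw [(sq (koszul r)).shape 0 (0 - 1) (by simp), Limits.zero_comp, zero_add] at h
  have h' := congrArg (fun f => (sqι (koszul r) 0 0 0 ≫ f).hom (x ⊗ₜ[R] y)) h
  have h'' := (sqι_multDiff r rfl x y).symm.trans h'
  rw [sub_eq_iff_eq_add'] at h''
  exact h''

theorem multHomotopy_succ {p q m : ℕ} (h : p + q = m + 1) (x : ⋀[R]^p (Fin n → R))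
    (y : ⋀[R]^q (Fin n → R)) :
    multBil (seqIdeal r) p q (m + 1) (liftHom r p x) (liftHom r q y) =
      liftHom r (m + 1) (wedgeMul R n p q (m + 1) x y) +
        ((resolution (seqIdeal r)).complex.d (m + 2) (m + 1) (multHomotopy r p q (m + 1) x y) +
        (multHomotopy r (p - 1) q m (koszulPred r p x) y +
          (-1 : R) ^ p • multHomotopy r p (q - 1) m x (koszulPred r q y))) := by
  have h₁ := nullHomotopy_apply (nullHomotopy _ _ (multDiff r) (multDiff_aug r)) (m + 1)
  have h' := congrArg (fun f => (sqι (koszul r) p q (m + 1) ≫ f).hom (x ⊗ₜ[R] y)) h₁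
  have h'' := (sqι_multDiff r h x y).symm.trans h'
  rw [sub_eq_iff_eq_add', Preadditive.comp_add, add_comm (_ ≫ _ ≫ _)] at h''
  exact h''.trans (congrArg (fun z => liftHom r (m + 1) (wedgeMul R n p q (m + 1) x y) +
    ((resolution (seqIdeal r)).complex.d (m + 2) (m + 1) (multHomotopy r p q (m + 1) x y) + z))
    (sqι_d_apply (koszul r) p q m h
      ((nullHomotopy _ _ (multDiff r) (multDiff_aug r)).hom m (m + 1)) x y))

end Products
-- The exterior product on Tor is the wedge product of Koszul cycles
section TorProduct

variable {R : Type u} [CommRing R] {n : ℕ} (r : Fin n → R)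

/-- Extends a homotopy between bilinear maps to coefficients; by linearity only pure tensors matter.
On a pair of cycles the last two terms vanish and the difference is a boundary. -/
theorem map₂_homotopy {A A' B B' C C' M N L : Type*} [AddCommGroup A] [Module R A]
    [AddCommGroup A'] [Module R A'] [AddCommGroup B] [Module R B] [AddCommGroup B'] [Module R B']
    [AddCommGroup C] [Module R C] [AddCommGroup C'] [Module R C'] [AddCommGroup M] [Module R M]
    [AddCommGroup N] [Module R N] [AddCommGroup L] [Module R L]
    (φ ψ : A →ₗ[R] B →ₗ[R] C') (b : A →ₗ[R] B →ₗ[R] C) (b₁ : A' →ₗ[R] B →ₗ[R] C')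
    (b₂ : A →ₗ[R] B' →ₗ[R] C') (dA : A →ₗ[R] A') (dB : B →ₗ[R] B') (dC : C →ₗ[R] C') (s : R)
    (h : ∀ x y, φ x y = ψ x y + (dC (b x y) + (b₁ (dA x) y + s • b₂ x (dB y))))
    (β : M →ₗ[R] N →ₗ[R] L) (x : TensorProduct R A M) (y : TensorProduct R B N) :
    TensorProduct.map₂ φ β x y = TensorProduct.map₂ ψ β x y +
      (dC.rTensor L (TensorProduct.map₂ b β x y) +
        (TensorProduct.map₂ b₁ β (dA.rTensor M x) y +
        s • TensorProduct.map₂ b₂ β x (dB.rTensor N y))) := by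
  induction x with
  | zero => simp
  | add x x' hx hx' =>
    simp only [map_add, LinearMap.add_apply, hx, hx', smul_add]
    abel
  | tmul x m =>
    induction y with
    | zero => simp
    | add y y' hy hy' =>
      simp only [map_add, hy, hy', smul_add]
      abel
    | tmul y n =>
      simp [h, TensorProduct.add_tmul, TensorProduct.smul_tmul']

theorem map₂_rTensor {A A' B B' C M N L : Type*} [AddCommGroup A] [Module R A]
    [AddCommGroup A'] [Module R A'] [AddCommGroup B] [Module R B] [AddCommGroup B'] [Module R B']
    [AddCommGroup C] [Module R C] [AddCommGroup M] [Module R M]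
    [AddCommGroup N] [Module R N] [AddCommGroup L] [Module R L]
    (φ : A' →ₗ[R] B' →ₗ[R] C) (f : A →ₗ[R] A') (g : B →ₗ[R] B') (β : M →ₗ[R] N →ₗ[R] L)
    (x : TensorProduct R A M) (y : TensorProduct R B N) :
    TensorProduct.map₂ φ β (f.rTensor M x) (g.rTensor N y) =
      TensorProduct.map₂ (φ.compl₁₂ f g) β x y := by
  induction x with
  | zero => simp
  | add x x' hx hx' => simp only [map_add, LinearMap.add_apply, hx, hx']
  | tmul x m =>
    induction y with
    | zero => simp
    | add y y' hy hy' => simp only [map_add, hy, hy']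
    | tmul y n => simp

theorem map₂_compr₂_left {A B C C' M N L : Type*} [AddCommGroup A] [Module R A]
    [AddCommGroup B] [Module R B] [AddCommGroup C] [Module R C] [AddCommGroup C'] [Module R C']
    [AddCommGroup M] [Module R M] [AddCommGroup N] [Module R N] [AddCommGroup L] [Module R L]
    (φ : A →ₗ[R] B →ₗ[R] C) (f : C →ₗ[R] C') (β : M →ₗ[R] N →ₗ[R] L)
    (x : TensorProduct R A M) (y : TensorProduct R B N) :
    TensorProduct.map₂ (φ.compr₂ f) β x y = f.rTensor L (TensorProduct.map₂ φ β x y) := by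
  induction x with
  | zero => simp
  | add x x' hx hx' => simp only [map_add, LinearMap.add_apply, hx, hx']
  | tmul x m =>
    induction y with
    | zero => simp
    | add y y' hy hy' => simp only [map_add, hy, hy']
    | tmul y n => simp

variable {M N L : Type u} [AddCommGroup M] [Module R M] [AddCommGroup N] [Module R N]
  [AddCommGroup L] [Module R L]

theorem koszulPred_rTensor {k : ℕ} {x : TensorProduct R (⋀[R]^k (Fin n → R)) M}
    (hx : x ∈ koszulCyc r k M) : (koszulPred r k).rTensor M x = 0 := hx

/-- The left side multiplies the images of the cycles in P. By the homotopy `multHomotopy` this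
differs from the image of their wedge product by a boundary of P ⊗ L. -/
theorem torProd_koszulCls (β : M →ₗ[R] N →ₗ[R] L) (p q : ℕ)
    (x : TensorProduct R (⋀[R]^p (Fin n → R)) M) (y : TensorProduct R (⋀[R]^q (Fin n → R)) N)
    (hx : x ∈ koszulCyc r p M) (hy : y ∈ koszulCyc r q N)
    (hxy : TensorProduct.map₂ (wedgeMul R n p q (p + q)) β x y ∈ koszulCyc r (p + q) L) :
    torProd (seqIdeal r) β p q (koszulCls r p M ⟨x, hx⟩) (koszulCls r q N ⟨y, hy⟩) =
      koszulCls r (p + q) L ⟨_, hxy⟩ := by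
  rw [koszulCls_apply, koszulCls_apply, koszulCls_apply]
  change (torIso (seqIdeal r) (p + q) L).symm (homPairing (chainPairing (seqIdeal r) β)
    (chainPairing_leibniz (seqIdeal r) β) p q (torIso (seqIdeal r) p M
      ((torIso (seqIdeal r) p M).symm _)) (torIso (seqIdeal r) q N
      ((torIso (seqIdeal r) q N).symm _))) = _
  rw [LinearEquiv.apply_symm_apply, LinearEquiv.apply_symm_apply, homPairing_cls]
  congr 1
  let P := (resolution (seqIdeal r)).complex
  -- With the total degree as a free variable m, the cases m = 0 and m > 0, where the homotopy
  -- formula differs, can be separated.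
  suffices h : ∀ m, p + q = m → ∃ w : TensorProduct R (P.X (m + 1)) L,
      TensorProduct.map₂ (multBil (seqIdeal r) p q m) β ((liftHom r p).rTensor M x)
        ((liftHom r q).rTensor N y) =
      (liftHom r m).rTensor L (TensorProduct.map₂ (wedgeMul R n p q m) β x y) +
        (P.d (m + 1) m).hom.rTensor L w by
    obtain ⟨w, hw⟩ := h _ rfl
    exact cls_congr _ _ _ _ w (sub_eq_iff_eq_add'.2 hw)
  intro m hm
  rw [map₂_rTensor, ← map₂_compr₂_left]
  rcases m with _ | m
  · obtain ⟨rfl, rfl⟩ : p = 0 ∧ q = 0 := by omega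
    refine ⟨TensorProduct.map₂ (multHomotopy r 0 0 0) β x y, ?_⟩
    have := map₂_homotopy ((multBil (seqIdeal r) 0 0 0).compl₁₂ (liftHom r 0) (liftHom r 0))
      ((wedgeMul R n 0 0 0).compr₂ (liftHom r 0)) (multHomotopy r 0 0 0)
      0 0 (0 : _ →ₗ[R] ⋀[R]^0 (Fin n → R)) (0 : _ →ₗ[R] ⋀[R]^0 (Fin n → R)) (P.d 1 0).hom 0
      (fun x y => by
        rw [LinearMap.zero_apply, LinearMap.zero_apply, zero_smul, add_zero, add_zero]
        exact multHomotopy_zero r x y) β x y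
    simpa using this
  · refine ⟨TensorProduct.map₂ (multHomotopy r p q (m + 1)) β x y, ?_⟩
    have := map₂_homotopy ((multBil (seqIdeal r) p q (m + 1)).compl₁₂ (liftHom r p) (liftHom r q))
      ((wedgeMul R n p q (m + 1)).compr₂ (liftHom r (m + 1))) (multHomotopy r p q (m + 1))
      (multHomotopy r (p - 1) q m) (multHomotopy r p (q - 1) m) (koszulPred r p) (koszulPred r q)
      (P.d (m + 2) (m + 1)).hom ((-1) ^ p) (fun x y => multHomotopy_succ r hm x y) β x y
    rw [this, koszulPred_rTensor r hx, koszulPred_rTensor r hy]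
    simp

end TorProduct
end TorBlowup

namespace TorBlowup

universe u

section Ideals

variable {R : Type u} [CommRing R] {n : ℕ} (r : Fin n → R) (J : Ideal R) (k : ℕ)

/-! ### Tor of an ideal as a subquotient of the exterior algebra -/

/-- `⋀^k ⊗ J ⟶ ⋀^k`. -/
noncomputable def tensorToPower : TensorProduct R (⋀[R]^k (Fin n → R)) J →ₗ[R]
    ⋀[R]^k (Fin n → R) :=
  (TensorProduct.rid R _).toLinearMap.comp (LinearMap.lTensor _ J.subtype)

variable {J k}

@[simp]
theorem tensorToPower_tmul (x : ⋀[R]^k (Fin n → R)) (a : J) :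
    tensorToPower J k (x ⊗ₜ[R] a) = (a : R) • x := by
  simp [tensorToPower]

/-- Exterior powers of R^n are flat, so tensoring the inclusion of J into R stays injective. Chains
with coefficients in J can thus be treated as elements of the exterior algebra. -/
theorem tensorToPower_injective : Function.Injective (tensorToPower (n := n) J k) :=
  (TensorProduct.rid R _).injective.comp
    (Module.Flat.lTensor_preserves_injective_linearMap J.subtype Subtype.val_injective)

theorem tensorToPower_mem (x : TensorProduct R (⋀[R]^k (Fin n → R)) J) :
    (tensorToPower J k x : Ext R n) ∈ J • (⊤ : Submodule R (Ext R n)) := by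
  induction x with
  | zero => simp
  | add x y hx hy => rw [map_add]; exact Submodule.add_mem _ hx hy
  | tmul x a => rw [tensorToPower_tmul]; exact Submodule.smul_mem_smul a.2 trivial

theorem exists_tensorToPower_eq {x : Ext R n} (hx : x ∈ ⋀[R]^k (Fin n → R))
    (hJ : x ∈ J • (⊤ : Submodule R (Ext R n))) :
    ∃ t : TensorProduct R (⋀[R]^k (Fin n → R)) J, (tensorToPower J k t : Ext R n) = x := by
  rw [← extProj_of_mem hx]
  clear hx
  refine Submodule.smul_induction_on hJ (fun a ha y _ => ?_) (fun x y hx hy => ?_)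
  · exact ⟨(⟨extProj R n k y, extProj_mem k y⟩ : ⋀[R]^k (Fin n → R)) ⊗ₜ[R] ⟨a, ha⟩, by
      rw [tensorToPower_tmul, map_smul]; rfl⟩
  · obtain ⟨t, ht⟩ := hx
    obtain ⟨u, hu⟩ := hy
    exact ⟨t + u, by rw [map_add, map_add, ← ht, ← hu]; rfl⟩

theorem tensorToPower_koszulTensorD (x : TensorProduct R (⋀[R]^(k + 1) (Fin n → R)) J) :
    (tensorToPower J k (koszulTensorD r k J x) : Ext R n) =
      koszulD r (tensorToPower J (k + 1) x) := by
  induction x with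
  | zero => simp
  | add x y hx hy => simp only [map_add, Submodule.coe_add, hx, hy]
  | tmul x a =>
    rw [koszulTensorD, LinearMap.rTensor_tmul, tensorToPower_tmul, tensorToPower_tmul,
      Submodule.coe_smul, Submodule.coe_smul, map_smul]
    rfl

theorem mem_koszulCyc_iff {x : TensorProduct R (⋀[R]^k (Fin n → R)) J} :
    x ∈ koszulCyc r k J ↔ koszulD r (tensorToPower J k x) = 0 := by
  rcases k with _ | k
  · exact ⟨fun _ => koszulD_eq_zero r (Subtype.property _), fun _ => mem_koszulCyc_zero r x⟩
  · rw [mem_koszulCyc_succ, ← tensorToPower_koszulTensorD]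
    exact ⟨fun h => by rw [h, map_zero]; rfl, fun h =>
      tensorToPower_injective (Subtype.ext (h.trans (by rw [map_zero]; rfl)))⟩

variable (J k)

/-- The cycles of degree `k` of the Koszul complex with coefficients in `J`. -/
noncomputable def extCyc : Submodule R (Ext R n) :=
  ⋀[R]^k (Fin n → R) ⊓ J • (⊤ : Submodule R (Ext R n)) ⊓ LinearMap.ker (koszulD r)

/-- The cycles of `K ⊗ J` as elements of the exterior algebra. -/
noncomputable def extCycEquiv : koszulCyc r k J ≃ₗ[R] extCyc r J k :=
  LinearEquiv.ofBijective
    ((((Submodule.subtype _).comp (tensorToPower J k)).comp (Submodule.subtype _)).codRestrict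
      (extCyc r J k) fun z => ⟨⟨Subtype.property _, tensorToPower_mem _⟩,
        (mem_koszulCyc_iff r).1 z.2⟩) (by
    constructor
    · intro x y h
      have h' : (tensorToPower J k x.1 : Ext R n) = tensorToPower J k y.1 :=
        congrArg (fun z : extCyc r J k => (z : Ext R n)) h
      exact Subtype.ext (tensorToPower_injective (Subtype.ext h'))
    · intro z
      obtain ⟨t, ht⟩ := exists_tensorToPower_eq z.2.1.1 z.2.1.2
      exact ⟨⟨t, (mem_koszulCyc_iff r).2 (by rw [ht]; exact z.2.2)⟩, Subtype.ext ht⟩)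

/-- The class in `Tor_k(R/I, J)` of a cycle with coefficients in `J`. -/
noncomputable def extCls : extCyc r J k →ₗ[R] TorQ (seqIdeal r) k J :=
  (koszulCls r k J).comp (extCycEquiv r J k).symm.toLinearMap

variable {J k}

theorem extCls_eq (z : extCyc r J k) (t : TensorProduct R (⋀[R]^k (Fin n → R)) J)
    (ht : (tensorToPower J k t : Ext R n) = z) (htc : t ∈ koszulCyc r k J) :
    extCls r J k z = koszulCls r k J ⟨t, htc⟩ := by
  have : z = extCycEquiv r J k ⟨t, htc⟩ := Subtype.ext ht.symm
  rw [this, extCls, LinearMap.comp_apply, LinearEquiv.coe_coe, LinearEquiv.symm_apply_apply]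

theorem exists_koszulCyc (z : extCyc r J k) : ∃ (t : TensorProduct R (⋀[R]^k (Fin n → R)) J)
    (h : t ∈ koszulCyc r k J), (tensorToPower J k t : Ext R n) = z ∧
      extCls r J k z = koszulCls r k J ⟨t, h⟩ := by
  obtain ⟨t, ht⟩ := exists_tensorToPower_eq z.2.1.1 z.2.1.2
  have h : t ∈ koszulCyc r k J := (mem_koszulCyc_iff r).2 (by rw [ht]; exact z.2.2)
  exact ⟨t, h, ht, extCls_eq r z t ht h⟩

variable (J k) in
theorem extCls_surjective (hr : RingTheory.Sequence.IsWeaklyRegular R (List.ofFn r)) :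
    Function.Surjective (extCls r J k) :=
  (koszulCls_surjective r k J hr).comp (extCycEquiv r J k).symm.surjective

/-- The preimage y must itself have coefficients in J, which is why plain exactness of K is not
enough and strict exactness is used. -/
theorem extCls_eq_zero_iff (hr : RingTheory.Sequence.IsWeaklyRegular R (List.ofFn r))
    (z : extCyc r J k) : extCls r J k z = 0 ↔ ∃ y ∈ ⋀[R]^(k + 1) (Fin n → R),
      y ∈ J • (⊤ : Submodule R (Ext R n)) ∧ koszulD r y = z := by
  obtain ⟨t, h, ht, e⟩ := exists_koszulCyc r z
  rw [e]
  constructor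
  · intro h₀
    obtain ⟨y, hy⟩ := koszulCls_eq_zero r k J hr _ h₀
    refine ⟨_, Subtype.property (tensorToPower J (k + 1) y), tensorToPower_mem y, ?_⟩
    rw [← ht, ← tensorToPower_koszulTensorD, hy]
  · rintro ⟨y, hy, hyJ, hyz⟩
    obtain ⟨u, rfl⟩ := exists_tensorToPower_eq hy hyJ
    have : koszulTensorD r k J u = t := tensorToPower_injective (Subtype.ext (by
      rw [tensorToPower_koszulTensorD, hyz, ht]))
    subst this
    exact koszulCls_boundary r k J u h

theorem torMap_extCls {J' : Ideal R} (f : J →ₗ[R] J') (hf : ∀ x, (f x : R) = x)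
    (z : extCyc r J k) (hz : (z : Ext R n) ∈ extCyc r J' k) :
    torMap (seqIdeal r) k f (extCls r J k z) = extCls r J' k ⟨z, hz⟩ := by
  obtain ⟨t, h, ht, e⟩ := exists_koszulCyc r z
  have e' : (tensorToPower J' k (LinearMap.lTensor _ f t) : Ext R n) = z := by
    rw [← ht, tensorToPower, tensorToPower, LinearMap.comp_apply, LinearMap.comp_apply,
      ← LinearMap.comp_apply (LinearMap.lTensor _ _), ← LinearMap.lTensor_comp]
    have : J'.subtype.comp f = J.subtype := LinearMap.ext hf
    rw [this]
  have h' := (mem_koszulCyc_iff r).2 ((congrArg (koszulD r) e').trans z.2.2)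
  rw [e, torMap_koszulCls r k f t h h', extCls_eq r ⟨z, hz⟩ _ e' h']

theorem tensorToPower_map₂ (I : Ideal R) (s t p q m : ℕ)
    (x : TensorProduct R (⋀[R]^p (Fin n → R)) ↥(I ^ s))
    (y : TensorProduct R (⋀[R]^q (Fin n → R)) ↥(I ^ t)) (h : p + q = m) :
    (tensorToPower (I ^ (s + t)) m
      (TensorProduct.map₂ (wedgeMul R n p q m) (powMul I s t) x y) : Ext R n) =
      tensorToPower (I ^ s) p x * tensorToPower (I ^ t) q y := by
  induction x with
  | zero => simp
  | add x x' hx hx' => simp only [map_add, LinearMap.add_apply, Submodule.coe_add, add_mul, hx, hx']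
  | tmul x a =>
    induction y with
    | zero => simp
    | add y y' hy hy' => simp only [map_add, Submodule.coe_add, mul_add, hy, hy']
    | tmul y b =>
      rw [TensorProduct.map₂_apply_tmul, TensorProduct.map_tmul, tensorToPower_tmul,
        tensorToPower_tmul, tensorToPower_tmul, Submodule.coe_smul, Submodule.coe_smul, Submodule.coe_smul,
        wedgeMul_coe h, smul_mul_smul_comm]
      rfl

theorem extCyc_mul (I : Ideal R) {s t p q : ℕ} {x y : Ext R n} (hx : x ∈ extCyc r (I ^ s) p)
    (hy : y ∈ extCyc r (I ^ t) q) : x * y ∈ extCyc r (I ^ (s + t)) (p + q) := by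
  refine ⟨⟨SetLike.GradedMul.mul_mem hx.1.1 hy.1.1, ?_⟩, ?_⟩
  · obtain ⟨u, rfl⟩ := exists_tensorToPower_eq hx.1.1 hx.1.2
    obtain ⟨v, rfl⟩ := exists_tensorToPower_eq hy.1.1 hy.1.2
    rw [← tensorToPower_map₂ I s t p q (p + q) u v rfl]
    exact tensorToPower_mem _
  · have h₁ : koszulD r x = 0 := hx.2
    have h₂ : koszulD r y = 0 := hy.2
    change koszulD r (x * y) = 0
    rw [koszulD_mul r hx.1.1, h₁, h₂]
    simp

/-- Combines the wedge description of the product with (a x)(b y) = (ab)(x y). It turns every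
identity in A into one in the exterior algebra. -/
theorem torProd_extCls (s t p q : ℕ) (x : extCyc r (seqIdeal r ^ s) p)
    (y : extCyc r (seqIdeal r ^ t) q) :
    torProd (seqIdeal r) (powMul (seqIdeal r) s t) p q (extCls r _ p x) (extCls r _ q y) =
      extCls r _ (p + q) ⟨x * y, extCyc_mul r _ x.2 y.2⟩ := by
  obtain ⟨u, hu, hux, ex⟩ := exists_koszulCyc r x
  obtain ⟨v, hv, hvy, ey⟩ := exists_koszulCyc r y
  have e := tensorToPower_map₂ (seqIdeal r) s t p q (p + q) u v rfl
  rw [hux, hvy] at e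
  have h := (mem_koszulCyc_iff r).2 ((congrArg (koszulD r) e).trans (extCyc_mul r _ x.2 y.2).2)
  rw [ex, ey, torProd_koszulCls r _ p q u v hu hv h, extCls_eq r _ _ e h]

theorem algebraMap_mem_extCyc {c : R} (hc : c ∈ J) :
    algebraMap R (Ext R n) c ∈ extCyc r J 0 := by
  refine ⟨⟨mem_extZero.2 ⟨c, rfl⟩, ?_⟩, koszulD_eq_zero r (mem_extZero.2 ⟨c, rfl⟩)⟩
  rw [Algebra.algebraMap_eq_smul_one]
  exact Submodule.smul_mem_smul hc trivial

theorem torZero_extCls {c : R} (hc : c ∈ J) : torZero (seqIdeal r) J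
    (extCls r J 0 ⟨algebraMap R (Ext R n) c, algebraMap_mem_extCyc r hc⟩) = 1 ⊗ₜ[R] ⟨c, hc⟩ := by
  have h₁ : algebraMap R (Ext R n) 1 ∈ ⋀[R]^0 (Fin n → R) := mem_extZero.2 ⟨1, rfl⟩
  rw [extCls_eq r _ ((⟨_, h₁⟩ : ⋀[R]^0 (Fin n → R)) ⊗ₜ[R] ⟨c, hc⟩)
    (by
      rw [tensorToPower_tmul, Submodule.coe_smul]
      exact (congrArg (c • ·) (map_one (algebraMap R (Ext R n)))).trans
        (Algebra.algebraMap_eq_smul_one c).symm)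
    (mem_koszulCyc_zero r _), torZero_koszulCls, LinearMap.rTensor_tmul]
  congr 1
  exact congrArg (seqIdeal r).mkQ (zeroEquiv_algebraMap 1 h₁)

/-! ### The conormal module -/

theorem projStar_extCls (z : extCyc r (seqIdeal r) k) (t : TensorProduct R (⋀[R]^k (Fin n → R))
    (seqIdeal r)) (ht : (tensorToPower (seqIdeal r) k t : Ext R n) = z)
    (h' : LinearMap.lTensor _ (seqIdeal r).toCotangent t ∈ koszulCyc r k (seqIdeal r).Cotangent) :
    projStar (seqIdeal r) k (extCls r (seqIdeal r) k z) =
      koszulCls r k (seqIdeal r).Cotangent ⟨_, h'⟩ := by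
  have h : t ∈ koszulCyc r k (seqIdeal r) :=
    (mem_koszulCyc_iff r).2 ((congrArg (koszulD r) ht).trans z.2.2)
  rw [extCls_eq r z t ht h]
  exact torMap_koszulCls r k _ t h h'

theorem lTensor_mem_koszulCyc {M N : Type u} [AddCommGroup M] [Module R M] [AddCommGroup N]
    [Module R N] (f : M →ₗ[R] N) {t : TensorProduct R (⋀[R]^k (Fin n → R)) M}
    (ht : t ∈ koszulCyc r k M) : LinearMap.lTensor _ f t ∈ koszulCyc r k N := by
  rcases k with _ | k
  · exact mem_koszulCyc_zero r _
  · rw [mem_koszulCyc_succ] at ht ⊢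
    rw [koszulTensorD] at ht ⊢
    rw [← lTensor_rTensor_apply, ht, map_zero]

/-- If the class of z dies, then z - d y has coefficients in the kernel I² of I → I/I², for some y
over I. Strictness writes this cycle as d w with w again over I, so z = d(w + y) is already a
boundary with coefficients in I. -/
theorem projStar_injective (hr : RingTheory.Sequence.IsWeaklyRegular R (List.ofFn r)) (k : ℕ) :
    Function.Injective (projStar (seqIdeal r) k) := by
  rw [injective_iff_map_eq_zero]
  intro x hx
  obtain ⟨z, rfl⟩ := extCls_surjective r (seqIdeal r) k hr x
  obtain ⟨t, h, ht, -⟩ := exists_koszulCyc r z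
  have h' := lTensor_mem_koszulCyc r (seqIdeal r).toCotangent h
  rw [projStar_extCls r z t ht h'] at hx
  obtain ⟨y, hy⟩ := koszulCls_eq_zero r k _ hr _ hx
  obtain ⟨y, rfl⟩ := LinearMap.lTensor_surjective _ (seqIdeal r).toCotangent_surjective y
  have hy' : LinearMap.lTensor _ (seqIdeal r).toCotangent (t - koszulTensorD r k _ y) = 0 := by
    rw [map_sub, sub_eq_zero, koszulTensorD, lTensor_rTensor_apply]
    exact hy.symm
  obtain ⟨v, hv⟩ := (lTensor_exact (⋀[R]^k (Fin n → R))
    (LinearMap.exact_subtype_ker_map (seqIdeal r).toCotangent)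
    (seqIdeal r).toCotangent_surjective _).1 hy'
  have hmem : ∀ v, (tensorToPower (seqIdeal r) k (LinearMap.lTensor (⋀[R]^k (Fin n → R))
      (LinearMap.ker (seqIdeal r).toCotangent).subtype v) : Ext R n) ∈
      seqIdeal r ^ 2 • (⊤ : Submodule R (Ext R n)) := by
    intro v
    induction v with
    | zero => simp
    | add x y hx hy =>
      rw [map_add, map_add, Submodule.coe_add]
      exact Submodule.add_mem _ hx hy
    | tmul x a =>
      rw [LinearMap.lTensor_tmul, tensorToPower_tmul]
      exact Submodule.smul_mem_smul ((Ideal.toCotangent_eq_zero _ _).1 a.2) trivial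
  have h₂ := hmem v
  rw [hv, map_sub, Submodule.coe_sub, tensorToPower_koszulTensorD, ht] at h₂
  obtain ⟨w, hw, hwI, hwz⟩ := exists_koszulD_eq r hr 2 k (Or.inl two_ne_zero)
    (Submodule.sub_mem _ z.2.1.1 (koszulD_mem r (Subtype.property _)))
    (by rw [map_sub, koszulD_koszulD, sub_zero]; exact z.2.2) h₂
  rw [extCls_eq_zero_iff r hr]
  refine ⟨_, Submodule.add_mem _ hw (Subtype.property (tensorToPower (seqIdeal r) (k + 1) y)),
    Submodule.add_mem _ (by simpa using hwI) (tensorToPower_mem y), ?_⟩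
  rw [map_add, hwz, sub_add_cancel]

theorem koszulD_mem_extCyc {x : Ext R n} (hx : x ∈ ⋀[R]^(k + 1) (Fin n → R)) :
    koszulD r x ∈ extCyc r (seqIdeal r) k := by
  refine ⟨⟨koszulD_mem r hx, ?_⟩, koszulD_koszulD r x⟩
  have := koszulD_mem_smul r (J := ⊤) (x := x) (by rw [Submodule.top_smul]; trivial)
  rwa [Ideal.mul_top] at this

/-- The connecting map lifts v ⊗ 1 to coefficients R/I², applies d, and reads d v in I/I². As d v
has coefficients in I and is a cycle, it already defines a class in Tor_k(R/I, I). -/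
theorem connecting_koszulClass (v : ⋀[R]^(k + 1) (Fin n → R)) :
    connecting (seqIdeal r) k (koszulClass r (k + 1) v) =
      projStar (seqIdeal r) k (extCls r (seqIdeal r) k ⟨_, koszulD_mem_extCyc r v.2⟩) := by
  obtain ⟨t, h, ht, -⟩ := exists_koszulCyc r ⟨_, koszulD_mem_extCyc r v.2⟩
  have h' := lTensor_mem_koszulCyc r (seqIdeal r).toCotangent h
  rw [projStar_extCls r _ t ht h']
  let y : TensorProduct R (⋀[R]^(k + 1) (Fin n → R)) (R ⧸ seqIdeal r ^ 2) :=
    v ⊗ₜ[R] (seqIdeal r ^ 2).mkQ 1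
  have hz : LinearMap.lTensor (⋀[R]^(k + 1) (Fin n → R)) (Submodule.factor
      (Ideal.pow_le_self two_ne_zero) : (R ⧸ seqIdeal r ^ 2) →ₗ[R] (R ⧸ seqIdeal r)) y ∈
      koszulCyc r (k + 1) (R ⧸ seqIdeal r) := by
    rw [mem_koszulCyc_succ]
    change contract (Fintype.linearCombination R r) k v ⊗ₜ[R] (seqIdeal r).mkQ 1 = 0
    refine Submodule.smul_induction_on
      (p := fun w : ⋀[R]^k (Fin n → R) => w ⊗ₜ[R] (seqIdeal r).mkQ 1 = 0)
      (contract_linearCombination r k v) (fun c hc w _ => ?_) (fun x y hx hy => ?_)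
    · rw [TensorProduct.smul_tmul, ← map_smul, smul_eq_mul, mul_one, Submodule.mkQ_apply,
        (Submodule.Quotient.mk_eq_zero _).2 hc, TensorProduct.tmul_zero]
    · rw [TensorProduct.add_tmul, hx, hy, add_zero]
  have key := torδ_koszulCls r (seqIdeal r).cotangentToQuotientSquare
    (Submodule.factor (Ideal.pow_le_self two_ne_zero) :
      (R ⧸ seqIdeal r ^ 2) →ₗ[R] (R ⧸ seqIdeal r))
    (Ideal.cotangentToQuotientSquare_injective _) (fun x => by
      obtain ⟨x, rfl⟩ := Submodule.mkQ_surjective _ x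
      constructor
      · intro h
        exact ⟨(seqIdeal r).toCotangent ⟨x, (Submodule.Quotient.mk_eq_zero _).1 h⟩, rfl⟩
      · rintro ⟨y, hy⟩
        obtain ⟨y, rfl⟩ := (seqIdeal r).toCotangent_surjective y
        rw [← hy]
        exact (Submodule.Quotient.mk_eq_zero _).2 y.2) (Submodule.factor_surjective _) k y
    (LinearMap.lTensor _ (seqIdeal r).toCotangent t) (by
      have e₁ : LinearMap.lTensor (⋀[R]^k (Fin n → R)) (seqIdeal r).subtype t =
          contract (Fintype.linearCombination R r) k v ⊗ₜ[R] (1 : R) := by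
        apply (TensorProduct.rid R _).injective
        refine Subtype.ext (ht.trans ?_)
        rw [TensorProduct.rid_tmul, one_smul]
        rfl
      have e₂ : (seqIdeal r).cotangentToQuotientSquare.comp (seqIdeal r).toCotangent =
          (seqIdeal r ^ 2).mkQ.comp (seqIdeal r).subtype := rfl
      rw [← LinearMap.comp_apply, ← LinearMap.lTensor_comp, e₂, LinearMap.lTensor_comp,
        LinearMap.comp_apply, e₁]
      rfl) hz h'
  refine Eq.trans ?_ key
  rw [koszulCls_apply]
  rfl

end Ideals
section Wedge

variable (R : Type u) [CommRing R] (n k : ℕ)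

/-! ### Coordinates with respect to the basis `e_{i_1} ∧ ⋯ ∧ e_{i_k}` -/

/-- The basis `e_{i_1} ∧ ⋯ ∧ e_{i_k}` of `⋀^k R^n`. -/
noncomputable def wedgeBasis : Module.Basis (Fin k ↪o Fin n) R (⋀[R]^k (Fin n → R)) :=
  ((Pi.basisFun R (Fin n)).exteriorPower k).reindex Set.powersetCard.ofFinEmbEquiv.symm

variable {R n k}

theorem wedgeBasis_apply (i : Fin k ↪o Fin n) : wedgeBasis R n k i = wedge R i := by
  rw [wedgeBasis, Module.Basis.reindex_apply, exteriorPower.basis_apply,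
    exteriorPower.ιMulti_family, Equiv.symm_symm, Equiv.symm_apply_apply]
  exact congrArg _ (funext fun j => Pi.basisFun_apply R (Fin n) (i j))

theorem sum_wedge (x : ⋀[R]^k (Fin n → R)) :
    ∑ i, (wedgeBasis R n k).repr x i • (wedge R i : Ext R n) = x := by
  have h := congrArg Subtype.val ((wedgeBasis R n k).sum_repr x)
  simpa only [Submodule.coe_sum, Submodule.coe_smul, wedgeBasis_apply] using h

theorem wedgeBasis_repr_mem {J : Ideal R} (x : ⋀[R]^k (Fin n → R))
    (hx : (x : Ext R n) ∈ J • (⊤ : Submodule R (Ext R n))) (i : Fin k ↪o Fin n) :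
    (wedgeBasis R n k).repr x i ∈ J := by
  obtain ⟨t, ht⟩ := exists_tensorToPower_eq x.2 hx
  obtain rfl : tensorToPower J k t = x := Subtype.ext ht
  clear ht hx
  induction t with
  | zero => simp
  | add x y hx hy => rw [map_add, map_add, Finsupp.add_apply]; exact J.add_mem hx hy
  | tmul x a =>
    rw [tensorToPower_tmul, map_smul, Finsupp.smul_apply]
    exact J.mul_mem_right _ a.2

end Wedge

section Bigraded

variable {R : Type u} [CommRing R] {n : ℕ} (r : Fin n → R)

/-! ### Homogeneous elements of the bigraded algebra -/

/-- The element of bidegree `(s, k)` given by a cycle. -/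
noncomputable def bigradedCls (s k : ℕ) :
    extCyc r (seqIdeal r ^ s) k →ₗ[R] BlowupTor (seqIdeal r) :=
  (BlowupTor.of (seqIdeal r) s k).comp (extCls r (seqIdeal r ^ s) k)

theorem bigradedCls_congr {s s' k k' : ℕ} {x x' : Ext R n} (hx : x ∈ extCyc r (seqIdeal r ^ s) k)
    (hx' : x' ∈ extCyc r (seqIdeal r ^ s') k') (hs : s = s') (hk : k = k') (h : x = x') :
    bigradedCls r s k ⟨x, hx⟩ = bigradedCls r s' k' ⟨x', hx'⟩ := by
  subst hs hk h
  rfl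

theorem bigradedCls_mul (s t k l : ℕ) (x : extCyc r (seqIdeal r ^ s) k)
    (y : extCyc r (seqIdeal r ^ t) l) : bigradedCls r s k x * bigradedCls r t l y =
      bigradedCls r (s + t) (k + l) ⟨x * y, extCyc_mul r _ x.2 y.2⟩ :=
  (of_mul_of (seqIdeal r) s k t l _ _).trans
    (congrArg (BlowupTor.of (seqIdeal r) (s + t) (k + l)) (torProd_extCls r s t k l x y))

/-- Regularity enters because homogeneous elements have to be represented by Koszul cycles. -/
theorem bigraded_induction (hr : RingTheory.Sequence.IsWeaklyRegular R (List.ofFn r))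
    {p : BlowupTor (seqIdeal r) → Prop} (x : BlowupTor (seqIdeal r)) (zero : p 0)
    (add : ∀ x y, p x → p y → p (x + y)) (cls : ∀ s k z, p (bigradedCls r s k z)) : p x := by
  refine DirectSum.induction_on (motive := p) x zero (fun i y => ?_) add
  obtain ⟨z, rfl⟩ := extCls_surjective r (seqIdeal r ^ i.1) i.2 hr y
  exact cls i.1 i.2 z

/-- The element of bidegree `(s, 0)` given by an element of `I ^ s`. -/
noncomputable def degreeZeroCls (s : ℕ) : ↥(seqIdeal r ^ s) →ₗ[R] BlowupTor (seqIdeal r) :=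
  (bigradedCls r s 0).comp ((Algebra.linearMap R (Ext R n)).restrict
    fun _ hc => algebraMap_mem_extCyc r hc)

theorem degreeZeroCls_eq (s : ℕ) (c : ↥(seqIdeal r ^ s)) : degreeZeroCls r s c =
    BlowupTor.of _ s 0 ((torZero (seqIdeal r) _).symm (1 ⊗ₜ[R] c)) := by
  refine congrArg (BlowupTor.of (seqIdeal r) s 0) ?_
  rw [LinearEquiv.eq_symm_apply]
  exact torZero_extCls r c.2

theorem exists_degreeZeroCls_eq (s : ℕ) (z : extCyc r (seqIdeal r ^ s) 0) :
    ∃ c, bigradedCls r s 0 z = degreeZeroCls r s c := by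
  obtain ⟨c, hc⟩ := mem_extZero.1 z.2.1.1
  have h : c ∈ seqIdeal r ^ s := by
    have := map_mem_smul_top (ExteriorAlgebra.algebraMapInv (R := R) (M := Fin n → R)).toLinearMap
      (seqIdeal r ^ s) z.2.1.2
    rw [← hc] at this
    simpa using this
  exact ⟨⟨c, h⟩, bigradedCls_congr r z.2 _ rfl rfl hc.symm⟩

theorem degreeZeroCls_congr {s s' : ℕ} {c c' : R} (hc : c ∈ seqIdeal r ^ s)
    (hc' : c' ∈ seqIdeal r ^ s') (hs : s = s') (h : c = c') :
    degreeZeroCls r s ⟨c, hc⟩ = degreeZeroCls r s' ⟨c', hc'⟩ := by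
  subst hs h
  rfl

theorem degreeZeroCls_mul (s t : ℕ) (c : ↥(seqIdeal r ^ s)) (d : ↥(seqIdeal r ^ t)) :
    degreeZeroCls r s c * degreeZeroCls r t d =
      degreeZeroCls r (s + t) ⟨c * d, pow_add (seqIdeal r) s t ▸ Ideal.mul_mem_mul c.2 d.2⟩ :=
  (bigradedCls_mul r s t 0 0 _ _).trans
    (bigradedCls_congr r _ _ rfl rfl (map_mul (algebraMap R (Ext R n)) (c : R) d).symm)

/-- A boundary in degree zero is d y with y over I^s, and d multiplies coefficients by elements of
I. This is the injectivity of I^s/I^(s+1) → Tor_0(R/I, I^s). -/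
theorem degreeZeroCls_eq_zero (hr : RingTheory.Sequence.IsWeaklyRegular R (List.ofFn r)) (s : ℕ)
    (c : ↥(seqIdeal r ^ s)) (h : degreeZeroCls r s c = 0) : (c : R) ∈ seqIdeal r ^ (s + 1) := by
  have h' : extCls r (seqIdeal r ^ s) 0 ⟨algebraMap R (Ext R n) c, algebraMap_mem_extCyc r c.2⟩ = 0 :=
    DirectSum.of_injective (β := fun p : ℕ × ℕ => TorQ (seqIdeal r) p.2 ↥(seqIdeal r ^ p.1)) (s, 0)
      (h.trans (map_zero _).symm)
  obtain ⟨y, -, hy, hyc⟩ := (extCls_eq_zero_iff r hr _).1 h'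
  have := map_mem_smul_top (ExteriorAlgebra.algebraMapInv (R := R) (M := Fin n → R)).toLinearMap
    _ (koszulD_mem_smul r hy)
  rw [hyc] at this
  simpa [pow_succ'] using this

theorem one_eq_degreeZeroCls :
    (1 : BlowupTor (seqIdeal r)) = degreeZeroCls r 0 ⟨1, by simp⟩ :=
  (degreeZeroCls_eq r 0 _).symm

theorem polyVar_eq_degreeZeroCls (i : Fin n) :
    polyVar r i = degreeZeroCls r 1 ⟨r i, by rw [pow_one]; exact mem_seqIdeal r i⟩ :=
  (degreeZeroCls_eq r 1 _).symm

theorem ofIdeal_extCls (k : ℕ) (z : extCyc r (seqIdeal r) k) :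
    ofIdeal (seqIdeal r) k (extCls r (seqIdeal r) k z) =
      bigradedCls r 1 k ⟨z, by rw [pow_one]; exact z.2⟩ :=
  congrArg (BlowupTor.of (seqIdeal r) 1 k) (torMap_extCls r _ (fun _ => rfl) z _)

/-! ### The algebra axioms -/

theorem mk_smul_bigraded (c : R) (x : BlowupTor (seqIdeal r)) :
    Ideal.Quotient.mk (seqIdeal r) c • x = c • x := by
  refine DFinsupp.ext fun i => ?_
  exact ((torQ_isTorsion (seqIdeal r) i.2 ↥(seqIdeal r ^ i.1)).mk_smul c _)

theorem bigraded_smul_mul (c : R ⧸ seqIdeal r) (x y : BlowupTor (seqIdeal r)) :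
    (c • x) * y = c • (x * y) := by
  obtain ⟨c, rfl⟩ := Ideal.Quotient.mk_surjective c
  rw [mk_smul_bigraded, mk_smul_bigraded]
  exact LinearMap.map_smul₂ (BlowupTor.mulHom (seqIdeal r)) c x y

theorem bigraded_mul_smul (c : R ⧸ seqIdeal r) (x y : BlowupTor (seqIdeal r)) :
    x * (c • y) = c • (x * y) := by
  obtain ⟨c, rfl⟩ := Ideal.Quotient.mk_surjective c
  rw [mk_smul_bigraded, mk_smul_bigraded]
  exact map_smul (BlowupTor.mulHom (seqIdeal r) x) c y

/-- On classes of cycles this is associativity of the exterior algebra. The two bidegrees agree only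
up to associativity of addition, so the comparison goes through `bigradedCls_congr`. -/
theorem bigraded_mul_assoc (hr : RingTheory.Sequence.IsWeaklyRegular R (List.ofFn r))
    (x y z : BlowupTor (seqIdeal r)) : x * y * z = x * (y * z) := by
  induction x using bigraded_induction r hr with
  | zero => simp
  | add x x' hx hx' => rw [add_mul, add_mul, add_mul, hx, hx']
  | cls s k x =>
    induction y using bigraded_induction r hr with
    | zero => simp
    | add y y' hy hy' => rw [mul_add, add_mul, add_mul, mul_add, hy, hy']
    | cls t l y =>
      induction z using bigraded_induction r hr with
      | zero => simp
      | add z z' hz hz' => rw [mul_add, mul_add, mul_add, hz, hz']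
      | cls u m z =>
        rw [bigradedCls_mul, bigradedCls_mul, bigradedCls_mul, bigradedCls_mul]
        exact bigradedCls_congr r _ _ (add_assoc s t u) (add_assoc k l m) (mul_assoc _ _ _)

theorem bigraded_one_mul (hr : RingTheory.Sequence.IsWeaklyRegular R (List.ofFn r))
    (x : BlowupTor (seqIdeal r)) : 1 * x = x := by
  induction x using bigraded_induction r hr with
  | zero => simp
  | add x x' hx hx' => rw [mul_add, hx, hx']
  | cls s k x =>
    rw [one_eq_degreeZeroCls]
    refine (bigradedCls_mul r 0 s 0 k _ _).trans
      (bigradedCls_congr r _ x.2 (zero_add s) (zero_add k) ?_)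
    change algebraMap R (Ext R n) 1 * (x : Ext R n) = x
    rw [map_one, one_mul]

theorem bigraded_mul_one (hr : RingTheory.Sequence.IsWeaklyRegular R (List.ofFn r))
    (x : BlowupTor (seqIdeal r)) : x * 1 = x := by
  induction x using bigraded_induction r hr with
  | zero => simp
  | add x x' hx hx' => rw [add_mul, hx, hx']
  | cls s k x =>
    rw [one_eq_degreeZeroCls]
    refine (bigradedCls_mul r s 0 k 0 _ _).trans
      (bigradedCls_congr r _ x.2 (add_zero s) (add_zero k) ?_)
    change (x : Ext R n) * algebraMap R (Ext R n) 1 = x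
    rw [map_one, mul_one]

end Bigraded
section Polynomial

variable {R : Type u} [CommRing R] {n : ℕ} (r : Fin n → R)

/-! ### The polynomial subring -/

theorem homogeneousEval_single {M : Type*} [AddCommGroup M] [Module R M] {s : ℕ} (α : Fin n → ℕ)
    (hα : ∑ i, α i = s) (c : M) :
    homogeneousEval r s (Pi.single α c) = (∏ i, r i ^ α i) • c := by
  induction n generalizing s with
  | zero =>
    obtain rfl : s = 0 := by simpa using hα.symm
    rw [homogeneousEval, if_pos rfl, Subsingleton.elim α Fin.elim0]
    simp
  | succ n ih =>
    obtain ⟨a, β, rfl⟩ : ∃ a β, α = Fin.cons a β := ⟨α 0, Fin.tail α, by simp⟩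
    rw [Fin.sum_univ_succ] at hα
    simp only [Fin.cons_zero, Fin.cons_succ] at hα
    simp only [homogeneousEval, LinearMap.sum_apply, LinearMap.smul_apply, LinearMap.comp_apply]
    rw [Finset.sum_eq_single (a, ∑ i, β i)]
    · have : LinearMap.funLeft R M (fun β => (Fin.cons a β : Fin (n + 1) → ℕ))
          (Pi.single (Fin.cons a β) c) = Pi.single β c := by
        funext γ
        simp [LinearMap.funLeft_apply, Pi.single_apply, Fin.cons_inj]
      rw [this, ih (Fin.tail r) β rfl, Fin.prod_univ_succ, smul_smul]
      rfl
    · intro ij hij hne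
      have h : ij.1 ≠ a := by
        rintro rfl
        rw [Finset.HasAntidiagonal.mem_antidiagonal] at hij
        exact hne (Prod.ext rfl (by simp only; omega))
      have : LinearMap.funLeft R M (fun β => (Fin.cons ij.1 β : Fin (n + 1) → ℕ))
          (Pi.single (Fin.cons a β) c) = 0 := by
        funext γ
        simp [LinearMap.funLeft_apply, Fin.cons_inj, h]
      rw [this, map_zero, smul_zero]
    · intro h
      exact absurd (Finset.HasAntidiagonal.mem_antidiagonal.2 hα) h

open MvPolynomial

theorem degree_eq_of_coeff_ne_zero {s : ℕ} {F : MvPolynomial (Fin n) R} (hF : F.IsHomogeneous s)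
    {α : Fin n →₀ ℕ} (hα : coeff α F ≠ 0) : α.degree = s := by
  rw [Finsupp.degree_eq_weight_one]
  exact hF hα

theorem homogeneousEval_coeff {s : ℕ} {F : MvPolynomial (Fin n) R} (hF : F.IsHomogeneous s) :
    homogeneousEval r s (fun α => coeff (Finsupp.equivFunOnFinite.symm α) F) = eval r F := by
  have h : (fun α => coeff (Finsupp.equivFunOnFinite.symm α) F) =
      ∑ β ∈ F.support, Pi.single (⇑β) (coeff β F) := by
    funext α
    rw [Finset.sum_apply]
    obtain ⟨γ, rfl⟩ := Finsupp.equivFunOnFinite.surjective α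
    rw [Equiv.symm_apply_apply]
    change coeff γ F = ∑ x ∈ F.support, (Pi.single (⇑x) (coeff x F) : _ → R) ⇑γ
    simp only [Pi.single_apply, DFunLike.coe_fn_eq]
    rw [Finset.sum_ite_eq]
    split_ifs with h
    · rfl
    · exact notMem_support_iff.1 h
  rw [h, map_sum, eval_eq']
  refine Finset.sum_congr rfl fun β hβ => ?_
  rw [homogeneousEval_single r _ (by
    rw [← Finsupp.degree_eq_sum]
    exact degree_eq_of_coeff_ne_zero hF (mem_support_iff.1 hβ)), smul_eq_mul, mul_comm]

theorem eval_mem_pow {s : ℕ} {F : MvPolynomial (Fin n) R} (hF : F.IsHomogeneous s) :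
    eval r F ∈ seqIdeal r ^ s :=
  (Ideal.mem_span_pow_iff_exists_isHomogeneous r _).2 ⟨F, hF, rfl⟩

theorem coeff_mem_of_eval_mem (hr : RingTheory.Sequence.IsWeaklyRegular R (List.ofFn r)) {s : ℕ}
    {F : MvPolynomial (Fin n) R} (hF : F.IsHomogeneous s)
    (h : eval r F ∈ seqIdeal r ^ (s + 1)) (α : Fin n →₀ ℕ) : coeff α F ∈ seqIdeal r := by
  -- Quasi-regularity speaks only of exponents of total degree s; all other coefficients of F are
  -- zero.
  by_cases hα : coeff α F = 0
  · rw [hα]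
    exact zero_mem _
  have := mem_smul_top_of_homogeneousEval_mem r hr s
    (fun α => coeff (Finsupp.equivFunOnFinite.symm α) F)
    (by rw [homogeneousEval_coeff r hF]; simpa using h) α
    (by rw [← Finsupp.degree_eq_sum]; exact degree_eq_of_coeff_ne_zero hF hα)
  simpa using this

/-- The class in `Tor_0(R/I, I^s)` of a monomial of degree `s`. -/
noncomputable def monomialCls (α : Fin n →₀ ℕ) : BlowupTor (seqIdeal r) :=
  degreeZeroCls r α.degree ⟨eval r (monomial α 1), eval_mem_pow r (isHomogeneous_monomial 1 rfl)⟩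

/-- The homomorphism `R/I[x_1, …, x_n] → ⨁ Tor_k(R/I, I^s)`. -/
noncomputable def polynomialMap :
    MvPolynomial (Fin n) (R ⧸ seqIdeal r) →ₗ[R ⧸ seqIdeal r] BlowupTor (seqIdeal r) :=
  (basisMonomials (Fin n) (R ⧸ seqIdeal r)).constr (R ⧸ seqIdeal r) (monomialCls r)

theorem polynomialMap_monomial (α : Fin n →₀ ℕ) (c : R ⧸ seqIdeal r) :
    polynomialMap r (monomial α c) = c • monomialCls r α := by
  have : monomial α c = c • basisMonomials (Fin n) (R ⧸ seqIdeal r) α := by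
    rw [coe_basisMonomials, smul_monomial, smul_eq_mul, mul_one]
  rw [this, map_smul, polynomialMap, Module.Basis.constr_basis]

/-- Summing over monomials shows that only the value of the form at r, as an element of I^s,
matters. Questions about the polynomial ring thereby become questions about powers of I. -/
theorem polynomialMap_map {s : ℕ} {F : MvPolynomial (Fin n) R} (hF : F.IsHomogeneous s) :
    polynomialMap r (map (Ideal.Quotient.mk (seqIdeal r)) F) =
      degreeZeroCls r s ⟨eval r F, eval_mem_pow r hF⟩ := by
  have hmem : ∀ α ∈ F.support, eval r (monomial α (coeff α F)) ∈ seqIdeal r ^ s := fun α hα =>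
    eval_mem_pow r (isHomogeneous_monomial _ (degree_eq_of_coeff_ne_zero hF (mem_support_iff.1 hα)))
  have h : (⟨eval r F, eval_mem_pow r hF⟩ : ↥(seqIdeal r ^ s)) =
      ∑ α ∈ F.support.attach, ⟨_, hmem α.1 α.2⟩ := by
    apply Subtype.ext
    rw [AddSubmonoidClass.coe_finsetSum]
    refine (congrArg (eval r) F.as_sum).trans ((map_sum _ _ _).trans ?_)
    exact (Finset.sum_attach F.support fun α => eval r (monomial α (coeff α F))).symm
  rw [h, map_sum]
  conv_lhs => rw [F.as_sum, map_sum, map_sum, ← Finset.sum_attach]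
  refine Finset.sum_congr rfl fun α _ => ?_
  rw [map_monomial, polynomialMap_monomial, mk_smul_bigraded, monomialCls, ← map_smul]
  refine degreeZeroCls_congr r _ _ (degree_eq_of_coeff_ne_zero hF (mem_support_iff.1 α.2)) ?_
  rw [smul_eq_mul, ← smul_eval, smul_monomial, smul_eq_mul, mul_one]

theorem polynomialMap_one : polynomialMap r 1 = 1 := by
  rw [one_eq_degreeZeroCls, ← map_one (map (Ideal.Quotient.mk (seqIdeal r))),
    polynomialMap_map r (isHomogeneous_one (Fin n) R)]
  exact degreeZeroCls_congr r _ _ rfl (map_one _)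

theorem polynomialMap_X (i : Fin n) : polynomialMap r (X i) = polyVar r i := by
  rw [polyVar_eq_degreeZeroCls, ← map_X (Ideal.Quotient.mk (seqIdeal r)),
    polynomialMap_map r (isHomogeneous_X R i)]
  exact degreeZeroCls_congr r _ _ rfl (eval_X _)

theorem monomialCls_mul (α β : Fin n →₀ ℕ) :
    monomialCls r α * monomialCls r β = monomialCls r (α + β) := by
  rw [monomialCls, monomialCls, degreeZeroCls_mul]
  refine degreeZeroCls_congr r _ _ (map_add Finsupp.degree α β).symm ?_
  rw [← map_mul, monomial_mul, mul_one]

theorem polynomialMap_mul (f g : MvPolynomial (Fin n) (R ⧸ seqIdeal r)) :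
    polynomialMap r (f * g) = polynomialMap r f * polynomialMap r g := by
  induction f using MvPolynomial.induction_on' with
  | add f f' hf hf' => rw [add_mul, map_add, map_add, add_mul, hf, hf']
  | monomial α a =>
    induction g using MvPolynomial.induction_on' with
    | add g g' hg hg' => rw [mul_add, map_add, map_add, mul_add, hg, hg']
    | monomial β b =>
      rw [monomial_mul, polynomialMap_monomial, polynomialMap_monomial, polynomialMap_monomial,
        bigraded_smul_mul, bigraded_mul_smul, monomialCls_mul, smul_smul]

theorem component_degreeZeroCls (s : ℕ) (c : ↥(seqIdeal r ^ s)) {t k : ℕ} (h : (s, 0) ≠ (t, k)) :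
    BlowupTor.component (seqIdeal r) t k (degreeZeroCls r s c) = 0 :=
  DirectSum.of_eq_of_ne (β := fun p : ℕ × ℕ => TorQ (seqIdeal r) p.2 ↥(seqIdeal r ^ p.1))
    _ _ _ h.symm

theorem polynomialMap_map_eq_sum (F : MvPolynomial (Fin n) R) :
    polynomialMap r (map (Ideal.Quotient.mk (seqIdeal r)) F) =
      ∑ s ∈ Finset.range (F.totalDegree + 1), degreeZeroCls r s
        ⟨_, eval_mem_pow r (homogeneousComponent_isHomogeneous s F)⟩ := by
  conv_lhs => rw [← sum_homogeneousComponent F, map_sum, map_sum]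
  exact Finset.sum_congr rfl fun s _ =>
    polynomialMap_map r (homogeneousComponent_isHomogeneous s F)

/-- Lift the polynomial to R. The bigrading separates its homogeneous components, each of which then
has value at r in I^(s+1), s being its degree; quasi-regularity puts all its coefficients in I. -/
theorem polynomialMap_injective (hr : RingTheory.Sequence.IsWeaklyRegular R (List.ofFn r)) :
    Function.Injective (polynomialMap r) := by
  rw [injective_iff_map_eq_zero]
  intro f hf
  obtain ⟨F, rfl⟩ := map_surjective _ Ideal.Quotient.mk_surjective f
  rw [polynomialMap_map_eq_sum] at hf
  conv_lhs => rw [← sum_homogeneousComponent F, map_sum]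
  refine Finset.sum_eq_zero fun s hs => ?_
  have h₀ : degreeZeroCls r s ⟨_, eval_mem_pow r (homogeneousComponent_isHomogeneous s F)⟩ = 0 := by
    have h := congrArg (BlowupTor.component (seqIdeal r) s 0) hf
    rw [map_sum, map_zero, Finset.sum_eq_single_of_mem s hs fun t _ ht =>
      component_degreeZeroCls r t _ (by simpa using ht)] at h
    have h₁ : BlowupTor.component (seqIdeal r) s 0 (degreeZeroCls r s
        ⟨_, eval_mem_pow r (homogeneousComponent_isHomogeneous s F)⟩) = extCls r _ 0 _ :=
      DirectSum.of_eq_same (β := fun p : ℕ × ℕ => TorQ (seqIdeal r) p.2 ↥(seqIdeal r ^ p.1))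
        (s, 0) _
    exact (congrArg (BlowupTor.of (seqIdeal r) s 0) (h₁.symm.trans h)).trans (map_zero _)
  ext α
  rw [coeff_map, coeff_zero, Ideal.Quotient.eq_zero_iff_mem]
  exact coeff_mem_of_eval_mem r hr (homogeneousComponent_isHomogeneous s F)
    (degreeZeroCls_eq_zero r hr s _ h₀) α

theorem degreeZeroCls_mem_range (s : ℕ) (c : ↥(seqIdeal r ^ s)) :
    degreeZeroCls r s c ∈ LinearMap.range (polynomialMap r) := by
  obtain ⟨F, hF, hc⟩ := (Ideal.mem_span_pow_iff_exists_isHomogeneous r _).1 c.2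
  exact ⟨_, (polynomialMap_map r hF).trans (congrArg _ (Subtype.ext hc))⟩

/-- Every element of I^s is the value at r of a form of degree s, so each class in Tor_0(R/I, I^s)
is hit; conversely forms only produce such classes. -/
theorem mem_range_polynomialMap (hr : RingTheory.Sequence.IsWeaklyRegular R (List.ofFn r))
    (x : BlowupTor (seqIdeal r)) : x ∈ Set.range (polynomialMap r) ↔
      ∀ s k, k ≠ 0 → BlowupTor.component (seqIdeal r) s k x = 0 := by
  constructor
  · rintro ⟨f, rfl⟩ s k hk
    obtain ⟨F, rfl⟩ := map_surjective _ Ideal.Quotient.mk_surjective f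
    rw [polynomialMap_map_eq_sum, map_sum]
    exact Finset.sum_eq_zero fun t _ => component_degreeZeroCls r t _ (by simp [hk.symm])
  · intro h
    classical
    have hx := DirectSum.sum_support_of
      (β := fun p : ℕ × ℕ => TorQ (seqIdeal r) p.2 ↥(seqIdeal r ^ p.1)) x
    change x ∈ LinearMap.range (polynomialMap r)
    rw [← hx]
    refine Submodule.sum_mem _ fun i _ => ?_
    obtain ⟨s, k⟩ := i
    by_cases hk : k = 0
    · subst hk
      obtain ⟨z, hz⟩ := extCls_surjective r (seqIdeal r ^ s) 0 hr
        (BlowupTor.component (seqIdeal r) s 0 x)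
      obtain ⟨c, hc⟩ := exists_degreeZeroCls_eq r s z
      have := degreeZeroCls_mem_range r s c
      rw [← hc] at this
      exact (congrArg (BlowupTor.of (seqIdeal r) s 0) hz) ▸ this
    · have := (congrArg (BlowupTor.of (seqIdeal r) s k) (h s k hk)).trans (map_zero _)
      exact this ▸ zero_mem _

end Polynomial
section Generators

variable {R : Type u} [CommRing R] {n : ℕ} (r : Fin n → R)

/-! ### The generators -/

/-- The class `a_{(i_0, …, i_k)}` of the cycle `d (e_{i_0} ∧ ⋯ ∧ e_{i_k})`. -/
noncomputable def wedgeCls (k : ℕ) (i : Fin (k + 1) ↪o Fin n) : TorQ (seqIdeal r) k (seqIdeal r) :=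
  extCls r (seqIdeal r) k ⟨_, koszulD_mem_extCyc r (wedge R i).2⟩

theorem mk_smul_torQ {k : ℕ} {N : Type u} [AddCommGroup N] [Module R N] (c : R)
    (x : TorQ (seqIdeal r) k N) : Ideal.Quotient.mk (seqIdeal r) c • x = c • x :=
  (torQ_isTorsion (seqIdeal r) k N).mk_smul c x

theorem sum_smul_wedgeCls (k : ℕ) (v : ⋀[R]^(k + 1) (Fin n → R)) :
    ∑ i, (wedgeBasis R n (k + 1)).repr v i • wedgeCls r k i =
      extCls r (seqIdeal r) k ⟨_, koszulD_mem_extCyc r v.2⟩ := by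
  simp only [wedgeCls, ← map_smul, ← map_sum]
  refine congrArg _ (Subtype.ext ?_)
  rw [AddSubmonoidClass.coe_finsetSum]
  simp only [Submodule.coe_smul, ← map_smul, ← map_sum]
  rw [sum_wedge]

/-- A cycle with coefficients in I is a boundary d y in K, including for k = 0, and y is a
combination of basis wedges. -/
theorem span_wedgeCls (hr : RingTheory.Sequence.IsWeaklyRegular R (List.ofFn r)) (k : ℕ) :
    Submodule.span (R ⧸ seqIdeal r) (Set.range (wedgeCls r k)) = ⊤ := by
  rw [eq_top_iff]
  rintro x -
  obtain ⟨z, rfl⟩ := extCls_surjective r (seqIdeal r) k hr x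
  obtain ⟨y, hy, -, hyz⟩ := exists_koszulD_eq r hr 1 k (Or.inl one_ne_zero) z.2.1.1 z.2.2
    (by rw [pow_one]; exact z.2.1.2)
  have h := sum_smul_wedgeCls r k ⟨y, hy⟩
  have e : (⟨koszulD r y, koszulD_mem_extCyc r hy⟩ : extCyc r (seqIdeal r) k) = z :=
    Subtype.ext hyz
  rw [e] at h
  rw [← h]
  refine Submodule.sum_mem _ fun i _ => ?_
  rw [← mk_smul_torQ]
  exact Submodule.smul_mem _ _ (Submodule.subset_span ⟨i, rfl⟩)

/-- A relation lifts to v in ∧^(k+1) with d v = d y and y over I. Exactness in degree k + 1 > 0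
makes v - y a boundary, whose coefficients lie in I, so those of v do too. -/
theorem linearIndependent_wedgeCls (hr : RingTheory.Sequence.IsWeaklyRegular R (List.ofFn r))
    (k : ℕ) : LinearIndependent (R ⧸ seqIdeal r) (wedgeCls r k) := by
  rw [Fintype.linearIndependent_iff]
  intro g hg i
  choose c hc using fun i => Ideal.Quotient.mk_surjective (g i)
  simp only [← hc, mk_smul_torQ] at hg
  let v : ⋀[R]^(k + 1) (Fin n → R) := ∑ i, c i • wedgeBasis R n (k + 1) i
  have hv : ∀ i, (wedgeBasis R n (k + 1)).repr v i = c i := fun i => by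
    rw [Module.Basis.repr_sum_self]
  have h := sum_smul_wedgeCls r k v
  simp only [hv] at h
  rw [hg] at h
  obtain ⟨y, hy, hyI, hyv⟩ := (extCls_eq_zero_iff r hr _).1 h.symm
  obtain ⟨w, -, -, hw⟩ := exists_koszulD_eq r hr 0 (k + 1) (Or.inr (Nat.succ_ne_zero k))
    (Submodule.sub_mem _ v.2 hy) (by rw [map_sub, hyv, sub_self])
    (by rw [pow_zero, Ideal.one_eq_top, Submodule.top_smul]; trivial)
  have hwI := koszulD_mem_smul r (J := ⊤) (x := w) (by rw [Submodule.top_smul]; trivial)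
  rw [Ideal.mul_top, hw] at hwI
  have hvI : (v : Ext R n) ∈ seqIdeal r • (⊤ : Submodule R (Ext R n)) := by
    have := Submodule.add_mem _ hwI hyI
    rwa [sub_add_cancel] at this
  rw [← hc, Ideal.Quotient.eq_zero_iff_mem, ← hv i]
  exact wedgeBasis_repr_mem v hvI i

theorem degreeZeroCls_mul_ofIdeal_wedgeCls (s k : ℕ) (c : ↥(seqIdeal r ^ s))
    (i : Fin (k + 1) ↪o Fin n)
    (h : (c : R) • koszulD r (wedge R i) ∈ extCyc r (seqIdeal r ^ (s + 1)) k) :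
    degreeZeroCls r s c * ofIdeal (seqIdeal r) k (wedgeCls r k i) =
      bigradedCls r (s + 1) k ⟨_, h⟩ := by
  rw [wedgeCls, ofIdeal_extCls]
  refine (bigradedCls_mul r s 1 0 k _ _).trans (bigradedCls_congr r _ h rfl (zero_add k) ?_)
  exact (Algebra.smul_def (c : R) (koszulD r (wedge R i : Ext R n))).symm

/-- For s, k > 0, strictness gives z = d y with y over I^(s-1). Expanding y in basis wedges makes
the class of z a sum of products of a class in Tor_0(R/I, I^(s-1)), which comes from a polynomial,
with one of the a's. -/
theorem eq_top_of_mem (hr : RingTheory.Sequence.IsWeaklyRegular R (List.ofFn r))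
    (S : AddSubgroup (BlowupTor (seqIdeal r))) (hφ : ∀ f, polynomialMap r f ∈ S)
    (ha : ∀ k (i : Fin (k + 1) ↪o Fin n), 0 < k → k < n →
      ofIdeal (seqIdeal r) k (wedgeCls r k i) ∈ S)
    (hmul : ∀ x ∈ S, ∀ y ∈ S, x * y ∈ S) : S = ⊤ := by
  have h₀ : ∀ s c, degreeZeroCls r s c ∈ S := fun s c => by
    obtain ⟨f, hf⟩ := degreeZeroCls_mem_range r s c
    exact hf ▸ hφ f
  rw [eq_top_iff]
  rintro x -
  induction x using bigraded_induction r hr with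
  | zero => exact S.zero_mem
  | add x y hx hy => exact S.add_mem hx hy
  | cls s k z =>
    rcases Nat.eq_zero_or_pos k with rfl | hk
    · obtain ⟨c, hc⟩ := exists_degreeZeroCls_eq r s z
      exact hc ▸ h₀ s c
    obtain ⟨y, hy, hyI, hyz⟩ := exists_koszulD_eq r hr s k (Or.inr hk.ne') z.2.1.1 z.2.2 z.2.1.2
    -- For s = 0 the coefficients are R, and Tor_k(R/I, R) vanishes in positive degree k.
    rcases s with _ | s
    · have : extCls r (seqIdeal r ^ 0) k z = 0 :=
        (extCls_eq_zero_iff r hr z).2 ⟨y, hy, hyI, hyz⟩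
      rw [bigradedCls, LinearMap.comp_apply, this, map_zero]
      exact S.zero_mem
    · rw [Nat.add_sub_cancel] at hyI
      let c := (wedgeBasis R n (k + 1)).repr ⟨y, hy⟩
      have hc : ∀ i, c i ∈ seqIdeal r ^ s := wedgeBasis_repr_mem ⟨y, hy⟩ hyI
      have hmem : ∀ i, c i • koszulD r (wedge R i) ∈ extCyc r (seqIdeal r ^ (s + 1)) k := by
        intro i
        have hd := koszulD_mem_extCyc r (wedge R i).2
        refine ⟨⟨Submodule.smul_mem _ _ hd.1.1, ?_⟩, Submodule.smul_mem _ _ hd.2⟩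
        rw [pow_succ, mul_smul]
        exact Submodule.smul_mem_smul (hc i) hd.1.2
      have hz : z = ∑ i, (⟨_, hmem i⟩ : extCyc r (seqIdeal r ^ (s + 1)) k) := by
        apply Subtype.ext
        rw [AddSubmonoidClass.coe_finsetSum, ← hyz]
        simp only [← map_smul, ← map_sum]
        exact congrArg _ (sum_wedge ⟨y, hy⟩).symm
      rw [hz, map_sum]
      refine S.sum_mem fun i _ => ?_
      rw [← degreeZeroCls_mul_ofIdeal_wedgeCls r s k ⟨c i, hc i⟩ i (hmem i)]
      -- The bound k < n comes from the index itself: an increasing family of k + 1 elements of `Fin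
      -- n` exists.
      have hkn : k + 1 ≤ n := by
        simpa using Fintype.card_le_of_injective i i.injective
      exact hmul _ (h₀ _ _) _ (ha k i hk hkn)

end Generators
end TorBlowup

open TorBlowup
theorem mainTheorem5 {R : Type*} [CommRing R] {n : ℕ} (r : Fin n → R)
    (hr : RingTheory.Sequence.IsRegular R (List.ofFn r)) :
    -- `⨁_{s,k} Tor_k(R/I, I^s)` is an associative unital algebra over `R/I`
    (∀ x y z : BlowupTor (seqIdeal r), x * y * z = x * (y * z)) ∧
    (∀ x : BlowupTor (seqIdeal r), 1 * x = x ∧ x * 1 = x) ∧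
    (∀ (c : R ⧸ seqIdeal r) (x y : BlowupTor (seqIdeal r)),
      (c • x) * y = c • (x * y) ∧ x * (c • y) = c • (x * y)) ∧
    -- the part of degree `k = 0` is a copy of the polynomial ring `R/I[x_1, …, x_n]`
    ∃ φ : MvPolynomial (Fin n) (R ⧸ seqIdeal r) →ₗ[R ⧸ seqIdeal r] BlowupTor (seqIdeal r),
      φ 1 = 1 ∧ (∀ f g, φ (f * g) = φ f * φ g) ∧ (∀ i, φ (MvPolynomial.X i) = polyVar r i) ∧
      Function.Injective φ ∧
      (∀ x, x ∈ Set.range φ ↔ ∀ s k, k ≠ 0 → BlowupTor.component (seqIdeal r) s k x = 0) ∧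
      -- `p_*` is injective, and `a k i` is the element with `p_* (a k i) = ∂(e_{i_0} ∧ ⋯ ∧ e_{i_k})`
      (∀ k, Function.Injective (projStar (seqIdeal r) k)) ∧
      ∃ a : ∀ k : ℕ, (Fin (k + 1) ↪o Fin n) → TorQ (seqIdeal r) k ↥(seqIdeal r),
        (∀ k i, projStar (seqIdeal r) k (a k i) =
          connecting (seqIdeal r) k (koszulClass r (k + 1) (wedge R i))) ∧
        -- these elements form a basis of `Tor_k(R/I, I)` for `0 < k < n`
        (∀ k, 0 < k → k < n → LinearIndependent (R ⧸ seqIdeal r) (a k) ∧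
          Submodule.span (R ⧸ seqIdeal r) (Set.range (a k)) = ⊤) ∧
        -- and, with the polynomial ring, they generate the algebra
        (∀ S : AddSubgroup (BlowupTor (seqIdeal r)),
          (∀ f, φ f ∈ S) →
          (∀ k i, 0 < k → k < n → ofIdeal (seqIdeal r) k (a k i) ∈ S) →
          (∀ x ∈ S, ∀ y ∈ S, x * y ∈ S) → S = ⊤) := by
  have h := hr.toIsWeaklyRegular
  exact ⟨bigraded_mul_assoc r h, fun x => ⟨bigraded_one_mul r h x, bigraded_mul_one r h x⟩,
    fun c x y => ⟨bigraded_smul_mul r c x y, bigraded_mul_smul r c x y⟩, polynomialMap r,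
    polynomialMap_one r, polynomialMap_mul r, polynomialMap_X r, polynomialMap_injective r h,
    mem_range_polynomialMap r h, projStar_injective r h, wedgeCls r,
    fun k i => (connecting_koszulClass r (wedge R i)).symm,
    fun k _ _ => ⟨linearIndependent_wedgeCls r h k, span_wedgeCls r h k⟩, eq_top_of_mem r h⟩
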